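/- Let $(\Omega,\mathscr G,P)$ be a probability space, and let $L^0$ and $\bar L^0$ be the spaces of $\mathscr G$-measurable random variables with values in $\mathbb R$ and in $[-\infty,\infty]$, modulo $P$-a.s. equality and ordered a.s.; $L^0_{++}$ is the set of $\lambda\in L^0$ with $\lambda>0$ a.s. The ring $L^0$ carries the topology generated by the balls $\{n:|m-n|\le\varepsilon\}$, $m\in L^0$, $\varepsilon\in L^0_{++}$. In $\bar L^0$ we set $0\cdot(\pm\infty)=0$ and $\infty-\infty=-\infty$. Let $\mathcal X$ be a conditional locally convex topological $L^0$-module, that is, a topological $L^0$-module such that: every concatenation $\sum_i 1_{A_i}X_i$ of a sequence in $\mathcal X$ along a countable measurable partition $(A_i)$ of $\Omega$ exists in $\mathcal X$; zero has a base of neighbourhoods that are $L^0$-convex, $L^0$-absorbent, $L^0$-balanced and $\sigma$-stable (closed under such concatenations); and $\sum_i 1_{A_i}U_i$ is a neighbourhood of zero for all neighbourhoods $U_i$ of zero and all countable measurable partitions $(A_i)$. Let $\mathcal X^*$ be the $L^0$-module of continuous $L^0$-linear maps $\mathcal X\to L^0$, $\langle X^*,X\rangle:=X^*(X)$, equipped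 with the weak topology generated by the evaluations at the elements of $\mathcal X$. Let $\mathcal K\subseteq\mathcal X$ be a closed $L^0$-convex cone containing $0$ (so $\lambda\mathcal K\subseteq\mathcal K$ for $\lambda\in L^0_{++}$), and $\mathcal K^\circ=\{X^*\in\mathcal X^*:\langle X^*,X\rangle\ge0\ \forall X\in\mathcal K\}$. A conditional assessment index is a map $\alpha:\mathcal X\to\bar L^0$ that is local, $\alpha(1_AX+1_{A^c}Y)=1_A\alpha(X)+1_{A^c}\alpha(Y)$ for $A\in\mathscr G$; quasiconcave, $\alpha(\lambda X+(1-\lambda)Y)\ge\alpha(X)\wedge\alpha(Y)$ for $\lambda\in L^0$, $0\le\lambda\le1$; and monotone, $\alpha(X)\ge\alpha(Y)$ if $X-Y\in\mathcal K$. It is upper semicontinuous if $\{\alpha\ge m\}$ is closed for every $m\in\bar L^0$. For $F:\bar L^0\to\bar L^0$ put $F^-(m)=\operatorname{ess\,sup}\{F(n):n<m\text{ on }\{m>-\infty\}\}$ on $\{m>-\infty\}$ and $F^-(m)=-\infty$ on $\{m=-\infty\}$; $F^+(m)=\operatorname{ess\,inf}\{F(n):n>m\text{ on }\{m<\infty\}\}$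 on $\{m<\infty\}$ and $F^+(m)=\infty$ on $\{m=\infty\}$. A conditional risk function is a map $R:\mathcal K^\circ\times\bar L^0\to\bar L^0$ that is jointly local and such that each $F=R(X^*,\cdot)$ is increasing and right-continuous, i.e. $F=F^+$. It is minimal if moreover 1. $R$ is jointly quasiconvex, $R(\lambda X^*+(1-\lambda)Y^*,\lambda s+(1-\lambda)t)\le R(X^*,s)\vee R(Y^*,t)$ for $\lambda\in L^0$, $0\le\lambda\le1$, and $R(\lambda X^*,s)=R(X^*,s/\lambda)$ for $\lambda\in L^0_{++}$; 2. $\operatorname{ess\,sup}_{s\in L^0}R(X^*,s)=\operatorname{ess\,sup}_{s\in L^0}R(Y^*,s)$ for all $X^*,Y^*\in\mathcal K^\circ$; 3. $R^-$ (left-continuous version in the second argument) is jointly lower semicontinuous: $\{(X^*,s)\in\mathcal K^\circ\times L^0:R^-(X^*,s)\le m\}$ is closed for every $m\in\bar L^0$. **Theorem.** (i) Let $\alpha:\mathcal X\to\bar L^0$ be an upper semicontinuous conditional assessment index. Then there is exactly one minimal conditional risk function $R$ with the normalization $R(0,s)=-\infty$ on $\{s<0\}$ for all $s\in\bar L^0$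 such that $$\alpha(X)=\operatorname*{ess\,inf}_{X^*\in\mathcal K^\circ}R(X^*,\langle X^*,X\rangle),\qquad X\in\mathcal X.\tag{1}$$ Moreover, without the normalization, any two minimal conditional risk functions $R,R'$ satisfying (1) differ at most where $X^*$ vanishes and $s<0$: for all $X^*\in\mathcal K^\circ$, $s\in\bar L^0$ and $X\in\mathcal X$, $R(X^*,s)=R'(X^*,s)$ a.s. on $\{\langle X^*,X\rangle\ne0\}\cup\{s\ge0\}$. (ii) Conversely, for every conditional risk function $R$, the right-hand side of (1) defines an upper semicontinuous conditional assessment index. -/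

import Mathlib

open MeasureTheory Filter Topology

noncomputable section

namespace CondIndex

variable {Ω : Type*} [MeasurableSpace Ω]

/-! ### The spaces `L⁰` and `L̄⁰` -/

/-- `L⁰`: real random variables modulo almost sure equality, ordered almost surely. -/
abbrev L0 (P : Measure Ω) := Ω →ₘ[P] ℝ

/-- `L̄⁰`: random variables with values in `[-∞, ∞]` modulo almost sure equality. -/
abbrev Lbar (P : Measure Ω) := Ω →ₘ[P] EReal

instance instCommRingL0 (P : Measure Ω) : CommRing (L0 P) :=
  { (inferInstance : AddCommGroup (L0 P)), (inferInstance : CommMonoid (L0 P)) with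
    left_distrib := fun a b c => by
      apply AEEqFun.ext
      filter_upwards [AEEqFun.coeFn_mul a (b + c), AEEqFun.coeFn_add b c,
        AEEqFun.coeFn_add (a * b) (a * c), AEEqFun.coeFn_mul a b, AEEqFun.coeFn_mul a c]
        with ω h1 h2 h3 h4 h5
      simp only [h1, h2, h3, h4, h5, Pi.mul_apply, Pi.add_apply, mul_add]
    right_distrib := fun a b c => by
      apply AEEqFun.ext
      filter_upwards [AEEqFun.coeFn_mul (a + b) c, AEEqFun.coeFn_add a b,
        AEEqFun.coeFn_add (a * c) (b * c), AEEqFun.coeFn_mul a c, AEEqFun.coeFn_mul b c]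
        with ω h1 h2 h3 h4 h5
      simp only [h1, h2, h3, h4, h5, Pi.mul_apply, Pi.add_apply, add_mul]
    zero_mul := fun a => by
      apply AEEqFun.ext
      filter_upwards [AEEqFun.coeFn_mul 0 a, AEEqFun.coeFn_zero (μ := P) (β := ℝ)] with ω h1 h2
      simp only [h1, h2, Pi.mul_apply, Pi.zero_apply, zero_mul]
    mul_zero := fun a => by
      apply AEEqFun.ext
      filter_upwards [AEEqFun.coeFn_mul a 0, AEEqFun.coeFn_zero (μ := P) (β := ℝ)] with ω h1 h2
      simp only [h1, h2, Pi.mul_apply, Pi.zero_apply, mul_zero] }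

/-- Membership in `L⁰₊₊`: almost surely strictly positive. -/
def IsPos {P : Measure Ω} (m : L0 P) : Prop := ∀ᵐ ω ∂P, 0 < m ω

/-- The ball `{n : |m - n| ≤ ε a.s.}` with random radius `ε`. -/
def ball {P : Measure Ω} (m ε : L0 P) : Set (L0 P) := {n | ∀ᵐ ω ∂P, |m ω - n ω| ≤ ε ω}

theorem mem_ball_zero {P : Measure Ω} {n ε : L0 P} :
    n ∈ ball 0 ε ↔ ∀ᵐ ω ∂P, |n ω| ≤ ε ω := by
  have h0 := AEEqFun.coeFn_zero (α := Ω) (μ := P) (β := ℝ)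
  constructor <;> intro h
  · filter_upwards [h, h0] with ω h h0
    simpa [h0] using h
  · filter_upwards [h, h0] with ω h h0
    simpa [h0] using h

/-- The balls around zero form a neighbourhood basis of zero of a ring topology. -/
@[reducible]
def ballBasis (P : Measure Ω) : RingFilterBasis (L0 P) where
  sets := {U | ∃ ε : L0 P, IsPos ε ∧ U = ball 0 ε}
  nonempty := ⟨_, 1, by
    filter_upwards [AEEqFun.coeFn_one (α := Ω) (μ := P) (β := ℝ)] with ω h
    simp [h], rfl⟩
  inter_sets := by
    rintro _ _ ⟨ε, hε, rfl⟩ ⟨δ, hδ, rfl⟩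
    refine ⟨_, ⟨ε ⊓ δ, ?_, rfl⟩, ?_⟩
    · filter_upwards [hε, hδ, AEEqFun.coeFn_inf ε δ] with ω h1 h2 h3
      simp [h3, h1, h2]
    · intro n hn
      rw [mem_ball_zero] at hn
      refine ⟨mem_ball_zero.2 ?_, mem_ball_zero.2 ?_⟩ <;>
      · filter_upwards [hn, AEEqFun.coeFn_inf ε δ] with ω h1 h2
        rw [h2] at h1
        simp at h1
        tauto
  zero' := by
    rintro _ ⟨ε, hε, rfl⟩
    rw [mem_ball_zero]
    filter_upwards [hε, AEEqFun.coeFn_zero (α := Ω) (μ := P) (β := ℝ)] with ω h h0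
    simpa [h0] using h.le
  add' := by
    rintro _ ⟨ε, hε, rfl⟩
    have hh := AEEqFun.coeFn_smul (1 / 2 : ℝ) ε
    refine ⟨_, ⟨(1 / 2 : ℝ) • ε, ?_, rfl⟩, ?_⟩
    · filter_upwards [hε, hh] with ω h1 h2
      rw [h2, Pi.smul_apply, smul_eq_mul]
      positivity
    · rintro _ ⟨a, ha, b, hb, rfl⟩
      rw [mem_ball_zero] at *
      filter_upwards [ha, hb, hh, AEEqFun.coeFn_add a b] with ω h1 h2 h3 h4
      simp only [h3, h4, Pi.smul_apply, smul_eq_mul, Pi.add_apply] at *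
      linarith [abs_add_le (a ω) (b ω)]
  neg' := by
    rintro _ ⟨ε, hε, rfl⟩
    refine ⟨_, ⟨ε, hε, rfl⟩, fun a ha => ?_⟩
    simp only [Set.mem_preimage]
    rw [mem_ball_zero] at *
    filter_upwards [ha, AEEqFun.coeFn_neg a] with ω h1 h2
    simpa [h2] using h1
  conj' := by
    rintro x _ ⟨ε, hε, rfl⟩
    exact ⟨_, ⟨ε, hε, rfl⟩, fun a ha => by simpa using ha⟩
  mul' := by
    rintro _ ⟨ε, hε, rfl⟩
    have hm := AEEqFun.coeFn_inf ε 1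
    have h1 := AEEqFun.coeFn_one (α := Ω) (μ := P) (β := ℝ)
    refine ⟨_, ⟨ε ⊓ 1, ?_, rfl⟩, ?_⟩
    · filter_upwards [hε, hm, h1] with ω h1 h2 h3
      simp [h1, h2, h3]
    · rintro _ ⟨a, ha, b, hb, rfl⟩
      rw [mem_ball_zero] at *
      filter_upwards [ha, hb, hm, h1, AEEqFun.coeFn_mul a b] with ω ha hb hm h1 hab
      simp only [hm, hab, h1, Pi.mul_apply, Pi.one_apply, le_inf_iff, abs_mul] at *
      nlinarith [abs_nonneg (a ω), abs_nonneg (b ω)]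
  mul_left' := by
    rintro x _ ⟨ε, hε, rfl⟩
    obtain ⟨δ, hδ⟩ : ∃ δ : L0 P, ∀ᵐ ω ∂P, δ ω = ε ω / (|x ω| + 1) :=
      ⟨AEEqFun.mk (fun ω => ε ω / (|x ω| + 1))
        ((ε.stronglyMeasurable.measurable.div
          (x.stronglyMeasurable.measurable.abs.add_const 1)).aestronglyMeasurable),
        AEEqFun.coeFn_mk _ _⟩
    refine ⟨_, ⟨δ, ?_, rfl⟩, fun a ha => ?_⟩
    · filter_upwards [hε, hδ] with ω h1 h2
      rw [h2]
      positivity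
    · simp only [Set.mem_preimage]
      rw [mem_ball_zero] at *
      filter_upwards [hε, ha, hδ, AEEqFun.coeFn_mul x a] with ω h1 h2 h3 h4
      rw [h4, Pi.mul_apply, abs_mul]
      rw [h3, le_div_iff₀ (by positivity)] at h2
      nlinarith [abs_nonneg (x ω), abs_nonneg (a ω)]
  mul_right' := by
    rintro x _ ⟨ε, hε, rfl⟩
    obtain ⟨δ, hδ⟩ : ∃ δ : L0 P, ∀ᵐ ω ∂P, δ ω = ε ω / (|x ω| + 1) :=
      ⟨AEEqFun.mk (fun ω => ε ω / (|x ω| + 1))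
        ((ε.stronglyMeasurable.measurable.div
          (x.stronglyMeasurable.measurable.abs.add_const 1)).aestronglyMeasurable),
        AEEqFun.coeFn_mk _ _⟩
    refine ⟨_, ⟨δ, ?_, rfl⟩, fun a ha => ?_⟩
    · filter_upwards [hε, hδ] with ω h1 h2
      rw [h2]
      positivity
    · simp only [Set.mem_preimage]
      rw [mem_ball_zero] at *
      filter_upwards [hε, ha, hδ, AEEqFun.coeFn_mul a x] with ω h1 h2 h3 h4
      rw [h4, Pi.mul_apply, abs_mul]
      rw [h3, le_div_iff₀ (by positivity)] at h2
      nlinarith [abs_nonneg (x ω), abs_nonneg (a ω)]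

/-- The topology of `L⁰` induced by the balls with random radius `ε ∈ L⁰₊₊`. -/
instance instTopologyL0 (P : Measure Ω) : TopologicalSpace (L0 P) := (ballBasis P).topology

instance instTopologicalRingL0 (P : Measure Ω) : IsTopologicalRing (L0 P) :=
  (ballBasis P).isTopologicalRing

/-- The balls around `m` are a neighbourhood basis of `m`. -/
theorem mem_nhds_iff_ball {P : Measure Ω} (m : L0 P) (V : Set (L0 P)) :
    V ∈ 𝓝 m ↔ ∃ ε : L0 P, IsPos ε ∧ ball m ε ⊆ V := by
  have hb : ∀ ε : L0 P, ball m ε = (fun y => m + y) '' ball 0 ε := by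
    intro ε
    ext n
    simp only [Set.mem_image, mem_ball_zero]
    constructor
    · intro h
      refine ⟨n - m, ?_, by abel⟩
      filter_upwards [h, AEEqFun.coeFn_sub n m] with ω h1 h2
      rw [h2, Pi.sub_apply, abs_sub_comm]
      exact h1
    · rintro ⟨y, hy, rfl⟩
      filter_upwards [hy, AEEqFun.coeFn_add m y] with ω h1 h2
      rw [h2, Pi.add_apply]
      simpa using h1
  have h := ((ballBasis P).toAddGroupFilterBasis.nhds_hasBasis m).mem_iff (t := V)
  refine h.trans ⟨?_, ?_⟩
  · rintro ⟨_, ⟨ε, hε, rfl⟩, hV⟩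
    exact ⟨ε, hε, (hb ε).trans_subset hV⟩
  · rintro ⟨ε, hε, hV⟩
    exact ⟨ball 0 ε, ⟨ε, hε, rfl⟩, (hb ε).symm.trans_subset hV⟩

/-- The indicator `1_A` of a measurable set, as an element of `L⁰`. -/
def ind (P : Measure Ω) {A : Set Ω} (hA : MeasurableSet A) : L0 P :=
  AEEqFun.mk (A.indicator fun _ => (1 : ℝ))
    ((measurable_const.indicator hA).aestronglyMeasurable)

/-- The embedding `L⁰ → L̄⁰`. -/
def toBar {P : Measure Ω} (m : L0 P) : Lbar P :=
  AEEqFun.comp Real.toEReal continuous_coe_real_ereal m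

open Classical in
/-- `1_A m + 1_{Aᶜ} n` in `L̄⁰`, with `0 · (±∞) = 0`. -/
def glue {P : Measure Ω} {A : Set Ω} (hA : MeasurableSet A) (m n : Lbar P) : Lbar P :=
  AEEqFun.mk (A.piecewise m n)
    ((m.stronglyMeasurable.measurable.piecewise hA
      n.stronglyMeasurable.measurable).aestronglyMeasurable)

/-- `l m + k n` in `L̄⁰` for `l, k ∈ L⁰`, with `0 · (±∞) = 0` and `∞ - ∞ = -∞`
(the conventions of `EReal`). -/
def combBar {P : Measure Ω} (l : L0 P) (m : Lbar P) (k : L0 P) (n : Lbar P) : Lbar P :=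
  AEEqFun.mk (fun ω => (l ω : EReal) * m ω + (k ω : EReal) * n ω)
    (((l.stronglyMeasurable.measurable.coe_real_ereal.mul m.stronglyMeasurable.measurable).add
      (k.stronglyMeasurable.measurable.coe_real_ereal.mul
        n.stronglyMeasurable.measurable)).aestronglyMeasurable)

/-- `s / l` in `L̄⁰`. -/
def divBar {P : Measure Ω} (s : Lbar P) (l : L0 P) : Lbar P :=
  AEEqFun.mk (fun ω => s ω * (((l ω)⁻¹ : ℝ) : EReal))
    ((s.stronglyMeasurable.measurable.mul
      l.stronglyMeasurable.measurable.inv.coe_real_ereal).aestronglyMeasurable)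

/-! ### Essential infima and suprema -/

/-- For a finite measure every subset of `L̄⁰` has a greatest lower bound. -/
theorem exists_isGLB {P : Measure Ω} [IsFiniteMeasure P] (S : Set (Lbar P)) :
    ∃ a, IsGLB S a := by
  classical
  let D : ℚ → Set (Lbar P) → Set Ω := fun q c => ⋃ f ∈ c, {ω | f ω < ((q : ℝ) : EReal)}
  have hDm : ∀ q c, c.Countable → MeasurableSet (D q c) := fun q c hc =>
    MeasurableSet.biUnion hc fun f _ =>
      measurableSet_lt f.stronglyMeasurable.measurable measurable_const
  have hmono : ∀ q c d, c ⊆ d → D q c ⊆ D q d := fun q c d h =>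
    Set.biUnion_subset_biUnion_left h
  have key : ∀ q, ∃ c ⊆ S, c.Countable ∧ ∀ d ⊆ S, d.Countable → P (D q d) ≤ P (D q c) := by
    intro q
    let T : Set ENNReal := {x | ∃ c ⊆ S, c.Countable ∧ x = P (D q c)}
    have hT : T.Nonempty := ⟨_, ∅, Set.empty_subset _, Set.countable_empty, rfl⟩
    obtain ⟨u, -, hu, huT⟩ := exists_seq_tendsto_sSup hT (OrderTop.bddAbove T)
    choose c hcS hcc hcu using huT
    refine ⟨⋃ n, c n, Set.iUnion_subset hcS, Set.countable_iUnion hcc, fun d hd hdc => ?_⟩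
    refine (le_sSup ⟨d, hd, hdc, rfl⟩ : P (D q d) ≤ sSup T).trans ?_
    refine le_of_tendsto' hu fun n => ?_
    rw [hcu n]
    exact measure_mono (hmono q _ _ (Set.subset_iUnion c n))
  choose c hcS hcc hmax using key
  let C := ⋃ q, c q
  have hCc : C.Countable := Set.countable_iUnion hcc
  have hCS : C ⊆ S := Set.iUnion_subset hcS
  have hgm : Measurable fun ω => ⨅ f ∈ C, (f : Lbar P) ω :=
    Measurable.biInf C hCc fun f _ => f.stronglyMeasurable.measurable
  refine ⟨AEEqFun.mk _ hgm.aestronglyMeasurable, ?_, ?_⟩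
  · intro f hf
    rw [← AEEqFun.coeFn_le]
    have hae : ∀ q : ℚ, ∀ᵐ ω ∂P, f ω < ((q : ℝ) : EReal) → ω ∈ D q C := by
      intro q
      have hins : (insert f C).Countable := hCc.insert f
      have h1 : P (D q (insert f C)) ≤ P (D q C) :=
        (hmax q _ (Set.insert_subset hf hCS) hins).trans
          (measure_mono (hmono q _ _ (Set.subset_iUnion c q)))
      have h2 : P (D q (insert f C) \ D q C) = 0 := by
        rw [measure_sdiff (hmono q _ _ (Set.subset_insert f C)) (hDm q C hCc).nullMeasurableSet
          (measure_ne_top P _)]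
        exact tsub_eq_zero_of_le h1
      refine measure_mono_null (fun ω hω => ?_) h2
      simp only [Set.mem_compl_iff, Set.mem_ofPred_eq, Classical.not_imp] at hω
      exact ⟨Set.mem_biUnion (Set.mem_insert f C) hω.1, hω.2⟩
    filter_upwards [AEEqFun.coeFn_mk _ hgm.aestronglyMeasurable, ae_all_iff.2 hae] with ω h1 h2
    rw [h1]
    by_contra hlt
    rw [not_le] at hlt
    obtain ⟨q, hq1, hq2⟩ := EReal.lt_iff_exists_rat_btwn.1 hlt
    obtain ⟨g, hg, hgq⟩ := Set.mem_iUnion₂.1 (h2 q hq1)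
    exact absurd (lt_of_le_of_lt (iInf₂_le g hg) hgq) (not_lt.2 hq2.le)
  · intro b hb
    rw [← AEEqFun.coeFn_le]
    have hall : ∀ᵐ ω ∂P, ∀ f ∈ C, b ω ≤ (f : Lbar P) ω :=
      (ae_ball_iff hCc).2 fun f hf => AEEqFun.coeFn_le.2 (hb (hCS hf))
    filter_upwards [AEEqFun.coeFn_mk _ hgm.aestronglyMeasurable, hall] with ω h1 h2
    rw [h1]
    exact le_iInf₂ h2

open Classical in
/-- The essential infimum of a set in `L̄⁰`: its greatest lower bound. -/
def essInfSet {P : Measure Ω} (S : Set (Lbar P)) : Lbar P :=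
  if h : ∃ a, IsGLB S a then h.choose else AEEqFun.const Ω ⊤

theorem isGLB_essInfSet {P : Measure Ω} [IsFiniteMeasure P] (S : Set (Lbar P)) :
    IsGLB S (essInfSet S) := by
  unfold essInfSet
  rw [dif_pos (exists_isGLB S)]
  exact (exists_isGLB S).choose_spec

/-- The essential supremum of a set in `L̄⁰`: its least upper bound, that is, the essential
infimum of its set of upper bounds. -/
def essSupSet {P : Measure Ω} (S : Set (Lbar P)) : Lbar P := essInfSet (upperBounds S)

theorem isLUB_essSupSet {P : Measure Ω} [IsFiniteMeasure P] (S : Set (Lbar P)) :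
    IsLUB S (essSupSet S) :=
  isGLB_upperBounds.1 (isGLB_essInfSet _)

/-! ### Left- and right-continuous versions of increasing functions on `L̄⁰` -/

theorem measurableSet_bot_lt {P : Measure Ω} (m : Lbar P) : MeasurableSet {ω | ⊥ < m ω} :=
  measurableSet_lt measurable_const m.stronglyMeasurable.measurable

theorem measurableSet_lt_top {P : Measure Ω} (m : Lbar P) : MeasurableSet {ω | m ω < ⊤} :=
  measurableSet_lt m.stronglyMeasurable.measurable measurable_const

/-- `F⁻(m) = esssup {F(n) : n < m on {m > -∞}}` on `{m > -∞}`, and `-∞` on `{m = -∞}`. -/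
def leftVersion {P : Measure Ω} (F : Lbar P → Lbar P) (m : Lbar P) : Lbar P :=
  glue (measurableSet_bot_lt m)
    (essSupSet {x | ∃ n : Lbar P, (∀ᵐ ω ∂P, ⊥ < m ω → n ω < m ω) ∧ x = F n})
    (AEEqFun.const Ω ⊥)

/-- `F⁺(m) = essinf {F(n) : n > m on {m < ∞}}` on `{m < ∞}`, and `∞` on `{m = ∞}`. -/
def rightVersion {P : Measure Ω} (F : Lbar P → Lbar P) (m : Lbar P) : Lbar P :=
  glue (measurableSet_lt_top m)
    (essInfSet {x | ∃ n : Lbar P, (∀ᵐ ω ∂P, m ω < ⊤ → m ω < n ω) ∧ x = F n})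
    (AEEqFun.const Ω ⊤)

/-! ### Conditional locally convex topological `L⁰`-modules -/

section Modules

variable {P : Measure Ω} {X : Type*} [AddCommGroup X] [Module (L0 P) X]

/-- A countable measurable partition of `Ω` (some of the sets may be empty). -/
structure IsPartition (A : ℕ → Set Ω) : Prop where
  measurable : ∀ i, MeasurableSet (A i)
  disjoint : Pairwise fun i j => Disjoint (A i) (A j)
  cover : ⋃ i, A i = Set.univ

variable (P) in
/-- `y` is a concatenation `∑ 1_{A_i} x_i`. -/
def IsConcat {A : ℕ → Set Ω} (hA : IsPartition A) (x : ℕ → X) (y : X) : Prop :=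
  ∀ i, ind P (hA.measurable i) • y = ind P (hA.measurable i) • x i

variable (P) in
/-- `σ`-stability: `C` contains all concatenations `∑ 1_{A_i} x_i` of its elements. -/
def SigmaStable (C : Set X) : Prop :=
  ∀ (A : ℕ → Set Ω) (hA : IsPartition A) (x : ℕ → X), (∀ i, x i ∈ C) →
    ∀ y, IsConcat P hA x y → y ∈ C

variable (P) in
/-- `L⁰`-convexity. -/
def L0Convex (C : Set X) : Prop :=
  ∀ l : L0 P, 0 ≤ l → l ≤ 1 → ∀ x ∈ C, ∀ y ∈ C, l • x + (1 - l) • y ∈ C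

variable (P) in
/-- `L⁰`-absorbent: every `x` lies in `l U` for some `l ∈ L⁰₊₊`. -/
def L0Absorbent (U : Set X) : Prop :=
  ∀ x : X, ∃ l : L0 P, IsPos l ∧ ∃ u ∈ U, x = l • u

variable (P) in
/-- `L⁰`-balanced: `l U ⊆ U` whenever `|l| ≤ 1`. -/
def L0Balanced (U : Set X) : Prop :=
  ∀ l : L0 P, (∀ᵐ ω ∂P, |l ω| ≤ 1) → ∀ x ∈ U, l • x ∈ U

variable (P X) in
/-- Conditional local convexity of a topological `L⁰`-module: the module is `σ`-stable, zero has
a neighbourhood base of `σ`-stable, `L⁰`-convex, `L⁰`-absorbent and `L⁰`-balanced sets, and the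
system of neighbourhoods of zero is stable under concatenation along countable partitions. -/
structure IsConditionallyLocallyConvex [TopologicalSpace X] : Prop where
  exists_concat : ∀ (A : ℕ → Set Ω) (hA : IsPartition A) (x : ℕ → X), ∃ y, IsConcat P hA x y
  nhds_base : ∀ V ∈ 𝓝 (0 : X), ∃ U ∈ 𝓝 (0 : X), U ⊆ V ∧
    SigmaStable P U ∧ L0Convex P U ∧ L0Absorbent P U ∧ L0Balanced P U
  nhds_concat : ∀ (A : ℕ → Set Ω) (hA : IsPartition A) (U : ℕ → Set X),
    (∀ i, U i ∈ 𝓝 (0 : X)) →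
      {y | ∃ x : ℕ → X, (∀ i, x i ∈ U i) ∧ IsConcat P hA x y} ∈ 𝓝 (0 : X)

variable (P) in
/-- An `L⁰`-convex cone containing zero. -/
structure IsConvexCone (K : Set X) : Prop where
  convex : L0Convex P K
  smul_mem : ∀ l : L0 P, IsPos l → ∀ x ∈ K, l • x ∈ K
  zero_mem : (0 : X) ∈ K

/-! ### Conditional assessment indices -/

/-- A conditional assessment index: local, quasiconcave, and monotone for the preorder
`x ≽ y ↔ x - y ∈ K`. -/
structure IsAssessmentIndex (K : Set X) (α : X → Lbar P) : Prop where
  isLocal : ∀ (A : Set Ω) (hA : MeasurableSet A) (x y : X),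
    α (ind P hA • x + ind P hA.compl • y) = glue hA (α x) (α y)
  quasiconcave : ∀ l : L0 P, 0 ≤ l → l ≤ 1 → ∀ x y : X,
    α x ⊓ α y ≤ α (l • x + (1 - l) • y)
  monotone : ∀ x y : X, x - y ∈ K → α y ≤ α x

/-- Upper semicontinuity: all upper level sets, with levels in `L̄⁰`, are closed. -/
def IsUSC [TopologicalSpace X] (α : X → Lbar P) : Prop :=
  ∀ m : Lbar P, IsClosed {x | m ≤ α x}

/-! ### Conditional risk functions -/

variable [TopologicalSpace X]

/-- The polar cone `K°` in the `L⁰`-dual, which carries the weak topology of evaluations. -/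
def polarCone (K : Set X) : Set (WeakDual (L0 P) X) := {Z | ∀ x ∈ K, 0 ≤ Z x}

/-- A conditional risk function `R : K° × L̄⁰ → L̄⁰`. -/
structure IsRiskFunction {K : Set X} (R : polarCone (P := P) K → Lbar P → Lbar P) : Prop where
  isLocal : ∀ (A : Set Ω) (hA : MeasurableSet A) (Z₁ Z₂ Z : polarCone (P := P) K),
    Z.1 = ind P hA • Z₁.1 + ind P hA.compl • Z₂.1 →
      ∀ s t : Lbar P, R Z (glue hA s t) = glue hA (R Z₁ s) (R Z₂ t)
  increasing : ∀ Z, Monotone (R Z)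
  rightContinuous : ∀ Z, R Z = rightVersion (R Z)

/-- A conditional risk function is minimal if it is jointly quasiconvex with
`R(l Z, s) = R(Z, s / l)`, has a uniform asymptotic maximum, and its left-continuous version is
jointly lower semicontinuous on `K° × L⁰`. -/
structure IsMinimalRiskFunction {K : Set X} (R : polarCone (P := P) K → Lbar P → Lbar P) : Prop
    extends IsRiskFunction R where
  quasiconvex : ∀ l : L0 P, 0 ≤ l → l ≤ 1 → ∀ Z₁ Z₂ Z : polarCone (P := P) K,
    Z.1 = l • Z₁.1 + (1 - l) • Z₂.1 →
      ∀ s t : Lbar P, R Z (combBar l s (1 - l) t) ≤ R Z₁ s ⊔ R Z₂ t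
  scaling : ∀ l : L0 P, IsPos l → ∀ Z Z' : polarCone (P := P) K, Z'.1 = l • Z.1 →
    ∀ s : Lbar P, R Z' s = R Z (divBar s l)
  asymptoticMax : ∀ Z Z' : polarCone (P := P) K,
    essSupSet (Set.range fun s : L0 P => R Z (toBar s)) =
      essSupSet (Set.range fun s : L0 P => R Z' (toBar s))
  lsc : ∀ m : Lbar P,
    IsClosed {p : polarCone (P := P) K × L0 P | leftVersion (R p.1) (toBar p.2) ≤ m}

/-- The normalization at the zero functional: `R(0, s) = -∞` on `{s < 0}`. -/
def IsNormalizedAtZero {K : Set X} (R : polarCone (P := P) K → Lbar P → Lbar P) : Prop :=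
  ∀ Z : polarCone (P := P) K, Z.1 = 0 → ∀ s : Lbar P, ∀ᵐ ω ∂P, s ω < 0 → R Z s ω = ⊥

/-- The function `x ↦ essinf_{Z ∈ K°} R(Z, ⟨Z, x⟩)`. -/
def robust {K : Set X} (R : polarCone (P := P) K → Lbar P → Lbar P) (x : X) : Lbar P :=
  essInfSet (Set.range fun Z : polarCone (P := P) K => R Z (toBar (Z.1 x)))

end Modules

end CondIndex

end

open CondIndex

noncomputable section

namespace CondIndex

variable {Ω : Type*} [MeasurableSpace Ω] {P : Measure Ω}

/-! ### Pointwise descriptions of the operations on `L⁰` and `L̄⁰` -/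

/-! Existence. The candidate is explicit: let `levelSup α Z s` be the essential supremum of `α x`
over the parts of `Ω` where `⟨Z, x⟩ < s`, and let `minRisk α` be its right-continuous version.
Minimality is read off the definition. If `l⟨Z₁, x⟩ + (1 - l)⟨Z₂, x⟩ < l s + (1 - l) t`, then `⟨Z₁,
x⟩ < s` or `⟨Z₂, x⟩ < t`, which gives quasiconvexity. The asymptotic maximum is `esssup α` for every
`Z`. A value of `levelSup` above `m` is witnessed by one point `x` with `⟨Z, x⟩ < s`, which is an
open condition on `(Z, s)`, and this gives lower semicontinuity.

The inequality `α ≤ robust (minRisk α)` is immediate. If it were strict on a nonnull set, a rational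
`q` would fit between the two sides on a nonnull part of it. There `x` lies outside a nonempty
closed convex level set of `α` at height `q`. The conditional Hahn–Banach theorem separates it by
some `Z`, which lies in the polar cone because `α` is monotone. The strict gap bounds `minRisk α Z
⟨Z, x⟩` by `q` on a nonnull set, a contradiction (`exists_separating_polarCone`, `robust_minRisk`).

Uniqueness. Any risk function representing `α` dominates `levelSup`. For the converse let `R` be
minimal and suppose `R⁻(Z₀, s₀) > q > levelSup α Z₀ s₀` on a nonnull set. By minimality `{R⁻ ≤ q}`
is a closed convex set, stable under positive scaling of pairs. Separating `(Z₀, s₀)` from it gives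
`x` and `β ≤ 0` with `⟨Z, x⟩ + β s ≥ 0` on this set and `⟨Z₀, x⟩ + β s₀ < 0`. If `β < 0`, normalise
it to `-1`: then `s ≤ ⟨Z, x⟩` on the whole set, so `α x ≥ q`, while `⟨Z₀, x⟩ < s₀`; this contradicts
the choice of `q`. Strict negativity of `β` is obtained by adding a small multiple of a second
separating pair, which separates `(0, 1)`; this is possible because `R⁻(0, 1)` dominates all other
values, by the scaling and asymptotic conditions. If the sublevel set is empty, `α ≥ q` everywhere
and it suffices that the half-space `{⟨Z₀, ·⟩ < s₀}` be nonempty. This is where `⟨Z₀, x⟩ ≠ 0` or `s₀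
> 0` enters, and why a normalization at zero is needed (`IsMinimalRiskFunction.exists_le_robust`,
`IsMinimalRiskFunction.leftVersion_le_levelSup`).

Converse statement. Locality, quasiconcavity and monotonicity follow from `R(Z, ·)` being local and
increasing, and right-continuity makes the sets `{s | m ≤ R(Z, s)}` closed.

Throughout, a scalar choice "for each `ω`" is replaced by gluing along countable partitions:
`exists_lt_on_of_stable` turns approximation on parts into approximation by one element on a whole
set. -/

theorem exists_ae_eq_real (P : Measure Ω) {f : Ω → ℝ} (hf : Measurable f) :
    ∃ g : L0 P, ∀ᵐ ω ∂P, g ω = f ω :=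
  ⟨AEEqFun.mk f hf.aestronglyMeasurable, AEEqFun.coeFn_mk _ _⟩

theorem exists_ae_eq_ereal (P : Measure Ω) {f : Ω → EReal} (hf : Measurable f) :
    ∃ g : Lbar P, ∀ᵐ ω ∂P, g ω = f ω :=
  ⟨AEEqFun.mk f hf.aestronglyMeasurable, AEEqFun.coeFn_mk _ _⟩

theorem ae_le_of_le {β : Type*} [TopologicalSpace β] [Preorder β] {f g : Ω →ₘ[P] β} (h : f ≤ g) :
    ∀ᵐ ω ∂P, f ω ≤ g ω := AEEqFun.coeFn_le.2 h

theorem le_of_ae_le {β : Type*} [TopologicalSpace β] [Preorder β] {f g : Ω →ₘ[P] β}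
    (h : ∀ᵐ ω ∂P, f ω ≤ g ω) : f ≤ g := AEEqFun.coeFn_le.1 h

theorem ae_add (a b : L0 P) : ∀ᵐ ω ∂P, (a + b) ω = a ω + b ω := AEEqFun.coeFn_add a b
theorem ae_sub (a b : L0 P) : ∀ᵐ ω ∂P, (a - b) ω = a ω - b ω := AEEqFun.coeFn_sub a b
theorem ae_mul (a b : L0 P) : ∀ᵐ ω ∂P, (a * b) ω = a ω * b ω := AEEqFun.coeFn_mul a b
theorem ae_neg (a : L0 P) : ∀ᵐ ω ∂P, (-a) ω = -a ω := AEEqFun.coeFn_neg a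
theorem ae_zero : ∀ᵐ ω ∂P, (0 : L0 P) ω = 0 := AEEqFun.coeFn_zero
theorem ae_one : ∀ᵐ ω ∂P, (1 : L0 P) ω = 1 := AEEqFun.coeFn_one

theorem ae_toBar (a : L0 P) : ∀ᵐ ω ∂P, toBar a ω = (a ω : EReal) :=
  AEEqFun.coeFn_comp _ continuous_coe_real_ereal a

theorem ae_ind_of_mem {A : Set Ω} (hA : MeasurableSet A) : ∀ᵐ ω ∂P, ω ∈ A → ind P hA ω = 1 := by
  filter_upwards [AEEqFun.coeFn_mk (μ := P) _
    ((measurable_const.indicator hA :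
      Measurable (A.indicator fun _ => (1 : ℝ))).aestronglyMeasurable)]
    with ω h hω
  exact h.trans (Set.indicator_of_mem hω _)

theorem ae_ind_of_notMem {A : Set Ω} (hA : MeasurableSet A) :
    ∀ᵐ ω ∂P, ω ∉ A → ind P hA ω = 0 := by
  filter_upwards [AEEqFun.coeFn_mk (μ := P) _
    ((measurable_const.indicator hA :
      Measurable (A.indicator fun _ => (1 : ℝ))).aestronglyMeasurable)]
    with ω h hω
  exact h.trans (Set.indicator_of_notMem hω _)

theorem ae_glue_of_mem {A : Set Ω} (hA : MeasurableSet A) (m n : Lbar P) :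
    ∀ᵐ ω ∂P, ω ∈ A → glue hA m n ω = m ω := by
  classical
  filter_upwards [AEEqFun.coeFn_mk (μ := P) _
    ((m.stronglyMeasurable.measurable.piecewise hA
      n.stronglyMeasurable.measurable).aestronglyMeasurable)] with ω h hω
  refine Eq.trans ?_ (Set.piecewise_eq_of_mem A m n hω)
  rw [← h]
  unfold glue
  congr!

theorem ae_glue_of_notMem {A : Set Ω} (hA : MeasurableSet A) (m n : Lbar P) :
    ∀ᵐ ω ∂P, ω ∉ A → glue hA m n ω = n ω := by
  classical
  filter_upwards [AEEqFun.coeFn_mk (μ := P) _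
    ((m.stronglyMeasurable.measurable.piecewise hA
      n.stronglyMeasurable.measurable).aestronglyMeasurable)] with ω h hω
  refine Eq.trans ?_ (Set.piecewise_eq_of_notMem A m n hω)
  rw [← h]
  unfold glue
  congr!

theorem ae_combBar (l : L0 P) (m : Lbar P) (k : L0 P) (n : Lbar P) :
    ∀ᵐ ω ∂P, combBar l m k n ω = (l ω : EReal) * m ω + (k ω : EReal) * n ω :=
  AEEqFun.coeFn_mk _ _

theorem ae_divBar (s : Lbar P) (l : L0 P) :
    ∀ᵐ ω ∂P, divBar s l ω = s ω * (((l ω)⁻¹ : ℝ) : EReal) :=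
  AEEqFun.coeFn_mk _ _

theorem ae_constBar (c : EReal) : ∀ᵐ ω ∂P, (AEEqFun.const Ω c : Lbar P) ω = c :=
  AEEqFun.coeFn_const _ c

theorem measurable_coe_L0 (a : L0 P) : Measurable fun ω => a ω := a.stronglyMeasurable.measurable

theorem measurable_coe_Lbar (a : Lbar P) : Measurable fun ω => a ω :=
  a.stronglyMeasurable.measurable

theorem measurable_toEReal_L0 (a : L0 P) : Measurable fun ω => (a ω : EReal) :=
  (measurable_coe_L0 a).coe_real_ereal

theorem exists_ae_eq_real_cases {A : Set Ω} (hA : MeasurableSet A) {f g : Ω → ℝ}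
    (hf : Measurable f) (hg : Measurable g) :
    ∃ c : L0 P, ∀ᵐ ω ∂P, (ω ∈ A → c ω = f ω) ∧ (ω ∉ A → c ω = g ω) := by
  classical
  obtain ⟨c, hc⟩ := exists_ae_eq_real P (hf.piecewise hA hg)
  refine ⟨c, hc.mono fun ω h => ⟨fun hω => ?_, fun hω => ?_⟩⟩
  · rw [h, Set.piecewise_eq_of_mem _ _ _ hω]
  · rw [h, Set.piecewise_eq_of_notMem _ _ _ hω]

theorem exists_ae_eq_ereal_cases {A : Set Ω} (hA : MeasurableSet A) {f g : Ω → EReal}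
    (hf : Measurable f) (hg : Measurable g) :
    ∃ c : Lbar P, ∀ᵐ ω ∂P, (ω ∈ A → c ω = f ω) ∧ (ω ∉ A → c ω = g ω) := by
  classical
  obtain ⟨c, hc⟩ := exists_ae_eq_ereal P (hf.piecewise hA hg)
  refine ⟨c, hc.mono fun ω h => ⟨fun hω => ?_, fun hω => ?_⟩⟩
  · rw [h, Set.piecewise_eq_of_mem _ _ _ hω]
  · rw [h, Set.piecewise_eq_of_notMem _ _ _ hω]

instance instIsOrderedAddMonoidL0 : IsOrderedAddMonoid (L0 P) where
  add_le_add_left a b h c := by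
    apply le_of_ae_le
    filter_upwards [ae_le_of_le h, ae_add a c, ae_add b c] with ω h1 h2 h3
    rw [h2, h3]
    linarith

theorem L0.mul_nonneg {a b : L0 P} (ha : 0 ≤ a) (hb : 0 ≤ b) : 0 ≤ a * b := by
  apply le_of_ae_le
  filter_upwards [ae_le_of_le ha, ae_le_of_le hb, ae_zero (P := P), ae_mul a b] with ω h1 h2 h3 h4
  rw [h4, h3]
  rw [h3] at h1 h2
  exact _root_.mul_nonneg h1 h2

theorem L0.mul_le_mul_of_nonneg {a b c : L0 P} (h : b ≤ c) (ha : 0 ≤ a) : a * b ≤ a * c := by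
  rw [← sub_nonneg, ← mul_sub]
  exact L0.mul_nonneg ha (sub_nonneg.2 h)

theorem ae_nonneg {a : L0 P} (h : 0 ≤ a) : ∀ᵐ ω ∂P, 0 ≤ a ω := by
  filter_upwards [ae_le_of_le h, ae_zero (P := P)] with ω h1 h2
  rwa [h2] at h1

theorem nonneg_of_ae {a : L0 P} (h : ∀ᵐ ω ∂P, 0 ≤ a ω) : 0 ≤ a := by
  apply le_of_ae_le
  filter_upwards [h, ae_zero (P := P)] with ω h1 h2
  rwa [h2]

theorem ae_le_one {a : L0 P} (h : a ≤ 1) : ∀ᵐ ω ∂P, a ω ≤ 1 := by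
  filter_upwards [ae_le_of_le h, ae_one (P := P)] with ω h1 h2
  rwa [h2] at h1

theorem le_one_of_ae {a : L0 P} (h : ∀ᵐ ω ∂P, a ω ≤ 1) : a ≤ 1 := by
  apply le_of_ae_le
  filter_upwards [h, ae_one (P := P)] with ω h1 h2
  rwa [h2]

theorem zero_le_one_L0 : (0 : L0 P) ≤ 1 :=
  nonneg_of_ae (ae_one.mono fun ω h => by rw [h]; exact zero_le_one)

theorem ind_add_ind_compl {A : Set Ω} (hA : MeasurableSet A) :
    ind P hA + ind P hA.compl = 1 := by
  apply AEEqFun.ext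
  filter_upwards [ae_add (ind P hA) (ind P hA.compl), ae_one (P := P), ae_ind_of_mem (P := P) hA,
    ae_ind_of_notMem (P := P) hA, ae_ind_of_mem (P := P) hA.compl,
    ae_ind_of_notMem (P := P) hA.compl] with ω h1 h2 h3 h4 h5 h6
  rw [h1, h2]
  by_cases hω : ω ∈ A
  · rw [h3 hω, h6 (by simpa using hω)]; simp
  · rw [h4 hω, h5 hω]; simp

theorem ind_nonneg {A : Set Ω} (hA : MeasurableSet A) : 0 ≤ ind P hA := by
  apply nonneg_of_ae
  filter_upwards [ae_ind_of_mem (P := P) hA, ae_ind_of_notMem (P := P) hA] with ω h1 h2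
  by_cases hω : ω ∈ A
  · rw [h1 hω]; simp
  · rw [h2 hω]

/-- Two elements of `L⁰` that agree on `A` have the same product with `1_A`. -/
theorem ind_mul_eq_of_ae {A : Set Ω} (hA : MeasurableSet A) {a b : L0 P}
    (h : ∀ᵐ ω ∂P, ω ∈ A → a ω = b ω) : ind P hA * a = ind P hA * b := by
  apply AEEqFun.ext
  filter_upwards [ae_mul (ind P hA) a, ae_mul (ind P hA) b, ae_ind_of_notMem (P := P) hA, h]
    with ω h1 h2 h3 h4
  rw [h1, h2]
  by_cases hω : ω ∈ A
  · rw [h4 hω]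
  · rw [h3 hω]; simp

theorem ae_eq_of_ind_mul_eq {A : Set Ω} (hA : MeasurableSet A) {a b : L0 P}
    (h : ind P hA * a = ind P hA * b) : ∀ᵐ ω ∂P, ω ∈ A → a ω = b ω := by
  have := ae_mul (ind P hA) a
  rw [h] at this
  filter_upwards [this, ae_mul (ind P hA) b, ae_ind_of_mem (P := P) hA] with ω h1 h2 h3 hω
  rw [h2, h3 hω] at h1
  simpa using h1.symm

theorem IsPos.le {a : L0 P} (h : IsPos a) : 0 ≤ a :=
  nonneg_of_ae (h.mono fun _ h => h.le)

theorem exists_inv_of_isPos {a : L0 P} (h : IsPos a) : ∃ b : L0 P, IsPos b ∧ a * b = 1 ∧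
    ∀ᵐ ω ∂P, b ω = (a ω)⁻¹ := by
  obtain ⟨b, hb⟩ := exists_ae_eq_real P (measurable_coe_L0 a).inv
  refine ⟨b, ?_, ?_, hb⟩
  · filter_upwards [h, hb] with ω h1 h2
    rw [h2]
    exact inv_pos.2 h1
  · apply AEEqFun.ext
    filter_upwards [h, hb, ae_mul a b, ae_one (P := P)] with ω h1 h2 h3 h4
    rw [h3, h4, h2]
    exact mul_inv_cancel₀ h1.ne.symm

/-! ### Null sets -/

/-- Proof by contradiction on a set of positive measure. -/
theorem ae_of_forall_measure_zero {p : Ω → Prop} (hp : MeasurableSet {ω | p ω})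
    (h : P {ω | ¬ p ω} ≠ 0 → MeasurableSet {ω | ¬ p ω} → False) : ∀ᵐ ω ∂P, p ω := by
  by_contra hc
  exact h (by rwa [ae_iff] at hc) hp.compl

theorem exists_of_ae_of_measure_ne_zero {A : Set Ω} (hA : P A ≠ 0) {p : Ω → Prop}
    (h : ∀ᵐ ω ∂P, p ω) : ∃ ω ∈ A, p ω := by
  by_contra! hc
  refine hA (measure_mono_null (fun ω hω => ?_) (ae_iff.1 h))
  exact hc ω hω

/-! ### Essential infima and suprema, pointwise -/

variable [IsFiniteMeasure P]

theorem ae_essInfSet_le {S : Set (Lbar P)} {x : Lbar P} (hx : x ∈ S) :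
    ∀ᵐ ω ∂P, essInfSet S ω ≤ x ω := ae_le_of_le ((isGLB_essInfSet S).1 hx)

theorem ae_le_essSupSet {S : Set (Lbar P)} {x : Lbar P} (hx : x ∈ S) :
    ∀ᵐ ω ∂P, x ω ≤ essSupSet S ω := ae_le_of_le ((isLUB_essSupSet S).1 hx)

/-- A greatest lower bound only sees inequalities on all of `Ω`; replacing `b` by `⊥` off `A` makes
the local bound a global one. -/
theorem ae_le_essInfSet_on {S : Set (Lbar P)} {A : Set Ω} (hA : MeasurableSet A) {b : Lbar P}
    (h : ∀ x ∈ S, ∀ᵐ ω ∂P, ω ∈ A → b ω ≤ x ω) : ∀ᵐ ω ∂P, ω ∈ A → b ω ≤ essInfSet S ω := by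
  have h1 : glue hA b (AEEqFun.const Ω ⊥) ≤ essInfSet S := by
    refine (isGLB_essInfSet S).2 fun x hx => le_of_ae_le ?_
    filter_upwards [h x hx, ae_glue_of_mem hA b (AEEqFun.const Ω ⊥),
      ae_glue_of_notMem hA b (AEEqFun.const Ω ⊥), ae_constBar (P := P) ⊥] with ω h1 h2 h3 h4
    by_cases hω : ω ∈ A
    · rw [h2 hω]; exact h1 hω
    · rw [h3 hω, h4]; exact bot_le
  filter_upwards [ae_le_of_le h1, ae_glue_of_mem hA b (AEEqFun.const Ω ⊥)] with ω h1 h2 hω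
  rwa [h2 hω] at h1

theorem ae_essSupSet_le_on {S : Set (Lbar P)} {A : Set Ω} (hA : MeasurableSet A) {b : Lbar P}
    (h : ∀ x ∈ S, ∀ᵐ ω ∂P, ω ∈ A → x ω ≤ b ω) : ∀ᵐ ω ∂P, ω ∈ A → essSupSet S ω ≤ b ω := by
  have h1 : essSupSet S ≤ glue hA b (AEEqFun.const Ω ⊤) := by
    refine (isLUB_essSupSet S).2 fun x hx => le_of_ae_le ?_
    filter_upwards [h x hx, ae_glue_of_mem hA b (AEEqFun.const Ω ⊤),
      ae_glue_of_notMem hA b (AEEqFun.const Ω ⊤), ae_constBar (P := P) ⊤] with ω h1 h2 h3 h4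
    by_cases hω : ω ∈ A
    · rw [h2 hω]; exact h1 hω
    · rw [h3 hω, h4]; exact le_top
  filter_upwards [ae_le_of_le h1, ae_glue_of_mem hA b (AEEqFun.const Ω ⊤)] with ω h1 h2 hω
  rwa [h2 hω] at h1

theorem exists_lt_of_lt_essSupSet {S : Set (Lbar P)} {m : Lbar P} {A : Set Ω}
    (hA : MeasurableSet A) (hPA : P A ≠ 0) (h : ∀ᵐ ω ∂P, ω ∈ A → m ω < essSupSet S ω) :
    ∃ x ∈ S, P (A ∩ {ω | m ω < x ω}) ≠ 0 := by
  by_contra! hc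
  have h1 := ae_essSupSet_le_on hA (S := S) (b := m) fun x hx => by
    have := measure_eq_zero_iff_ae_notMem.1 (hc x hx)
    filter_upwards [this] with ω h hω
    by_contra hlt
    exact h ⟨hω, not_le.1 hlt⟩
  obtain ⟨ω, hω, h2, h3⟩ := exists_of_ae_of_measure_ne_zero hPA (h.and h1)
  exact absurd (h2 hω) (not_lt.2 (h3 hω))

end CondIndex

end

/-! ### Exhaustion, infima in `L⁰`, and the conditional Hahn–Banach theorem -/

noncomputable section

namespace CondIndex

variable {Ω : Type*} [MeasurableSpace Ω] {P : Measure Ω}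

/-! ### Partitions and gluing -/

theorem exists_isPartition_subset {B : ℕ → Set Ω} (hB : ∀ n, MeasurableSet (B n))
    (hcov : ⋃ n, B n = Set.univ) : ∃ A : ℕ → Set Ω, IsPartition A ∧ ∀ n, A n ⊆ B n :=
  ⟨disjointed B, ⟨fun n => MeasurableSet.disjointed hB n, disjoint_disjointed B,
    (iUnion_disjointed).trans hcov⟩, disjointed_subset B⟩

theorem IsPartition.ae_of_forall {A : ℕ → Set Ω} (hA : IsPartition A) {p : Ω → Prop}
    (h : ∀ n, ∀ᵐ ω ∂P, ω ∈ A n → p ω) : ∀ᵐ ω ∂P, p ω := by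
  filter_upwards [ae_all_iff.2 h] with ω hω
  obtain ⟨n, hn⟩ := Set.mem_iUnion.1 (hA.cover ▸ Set.mem_univ ω : ω ∈ ⋃ i, A i)
  exact hω n hn

theorem IsPartition.exists_concat_real {A : ℕ → Set Ω} (hA : IsPartition A) (y : ℕ → L0 P) :
    ∃ z : L0 P, ∀ n, ∀ᵐ ω ∂P, ω ∈ A n → z ω = y n ω := by
  obtain ⟨f, hf, hfy⟩ := exists_measurable_piecewise A hA.measurable (fun n ω => y n ω)
    (fun n => measurable_coe_L0 (y n)) (fun i j hij ω hω =>
      absurd hω.2 (Set.disjoint_left.1 (hA.disjoint hij) hω.1))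
  obtain ⟨z, hz⟩ := exists_ae_eq_real P hf
  exact ⟨z, fun n => hz.mono fun ω h hω => h.trans (hfy n hω)⟩

/-- Exhaustion: if the elements of a family that is stable under gluing get below `e` on a part of
each nonnull subset of `T`, one of them is below `e` on all of `T`. -/
theorem exists_lt_on_of_stable [IsFiniteMeasure P] {S : Set (L0 P)} (hne : S.Nonempty)
    (hS : ∀ A, IsPartition A → ∀ y : ℕ → L0 P, (∀ n, y n ∈ S) →
      ∃ z ∈ S, ∀ n, ∀ᵐ ω ∂P, ω ∈ A n → z ω ≤ y n ω)
    {T : Set Ω} (hT : MeasurableSet T) {e : L0 P}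
    (h : ∀ B ⊆ T, MeasurableSet B → P B ≠ 0 → ∃ y ∈ S, P (B ∩ {ω | y ω < e ω}) ≠ 0) :
    ∃ z ∈ S, ∀ᵐ ω ∂P, ω ∈ T → z ω < e ω := by
  have hm : ∀ y : L0 P, MeasurableSet (T ∩ {ω | y ω < e ω}) := fun y =>
    hT.inter (measurableSet_lt (measurable_coe_L0 y) (measurable_coe_L0 e))
  -- `D` below is the union of the sets won by a maximising sequence, so no member of `S` wins a set
  -- of measure larger than `P D`.
  let Q : Set ENNReal := (fun y : L0 P => P (T ∩ {ω | y ω < e ω})) '' S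
  obtain ⟨u, -, hu, huQ⟩ := exists_seq_tendsto_sSup (hne.image _ : Q.Nonempty) (OrderTop.bddAbove Q)
  choose y hyS hyu using huQ
  let D := ⋃ n, T ∩ {ω | y n ω < e ω}
  have hD : MeasurableSet D := MeasurableSet.iUnion fun n => hm (y n)
  have hDle : sSup Q ≤ P D := le_of_tendsto' hu fun n => by
    rw [← hyu n]
    exact measure_mono (Set.subset_iUnion (fun n => T ∩ {ω | y n ω < e ω}) n)
  -- Any `y'` can be improved to be below `e` on `D` without being raised elsewhere: glue `y'` on
  -- `Dᶜ` (index `0`) with the maximising sequence on `D`.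
  have key : ∀ y' ∈ S, ∃ z ∈ S, ∀ᵐ ω ∂P,
      (ω ∈ D → z ω < e ω) ∧ (ω ∉ D → z ω ≤ y' ω) := by
    intro y' hy'
    obtain ⟨A, hA, hAB⟩ := exists_isPartition_subset
      (B := fun n => Nat.casesOn n Dᶜ fun k => T ∩ {ω | y k ω < e ω})
      (fun n => by cases n with
        | zero => exact hD.compl
        | succ k => exact hm (y k))
      (by
        ext ω
        simp only [Set.mem_iUnion, Set.mem_univ, iff_true]
        by_cases hω : ω ∈ D
        · obtain ⟨n, hn⟩ := Set.mem_iUnion.1 hω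
          exact ⟨n + 1, hn⟩
        · exact ⟨0, hω⟩)
    obtain ⟨z, hzS, hz⟩ := hS A hA (fun n => Nat.casesOn n y' y)
      (fun n => by cases n with
        | zero => exact hy'
        | succ k => exact hyS k)
    refine ⟨z, hzS, hA.ae_of_forall fun n => ?_⟩
    filter_upwards [hz n] with ω hω hn
    cases n with
    | zero => exact ⟨fun h => absurd h (hAB 0 hn), fun _ => hω hn⟩
    | succ k =>
      refine ⟨fun _ => (hω hn).trans_lt (hAB (k + 1) hn).2, fun h => absurd ?_ h⟩
      exact Set.mem_iUnion.2 ⟨k, hAB (k + 1) hn⟩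
  -- If some `y'` won a nonnull part of `T \ D`, its improvement would win strictly more than `P D`.
  have hTD : P (T \ D) = 0 := by
    by_contra hc
    obtain ⟨y', hy', hy'p⟩ := h (T \ D) Set.sdiff_subset (hT.diff hD) hc
    obtain ⟨z, hzS, hz⟩ := key y' hy'
    have h1 : P (T ∩ {ω | z ω < e ω}) ≤ P D :=
      (le_sSup (Set.mem_image_of_mem (fun y : L0 P => P (T ∩ {ω | y ω < e ω})) hzS)).trans hDle
    have h2 : P (D ∪ (T \ D ∩ {ω | y' ω < e ω})) ≤ P (T ∩ {ω | z ω < e ω}) := by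
      refine measure_mono_ae ?_
      filter_upwards [hz] with ω hω hmem
      rcases hmem with hmem | hmem
      · obtain ⟨n, hn⟩ := Set.mem_iUnion.1 hmem
        exact ⟨hn.1, hω.1 hmem⟩
      · exact ⟨hmem.1.1, (hω.2 hmem.1.2).trans_lt hmem.2⟩
    rw [measure_union (Set.disjoint_left.2 fun ω h1 h2 => h2.1.2 h1)
      ((hT.diff hD).inter (measurableSet_lt (measurable_coe_L0 y') (measurable_coe_L0 e)))] at h2
    have h3 := h2.trans h1
    have h4 : P D + P (T \ D ∩ {ω | y' ω < e ω}) ≤ P D + 0 := by simpa using h3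
    rw [ENNReal.add_le_add_iff_left (measure_ne_top P D)] at h4
    exact hy'p (le_antisymm h4 bot_le)
  obtain ⟨y', hy'⟩ := hne
  obtain ⟨z, hzS, hz⟩ := key y' hy'
  refine ⟨z, hzS, ?_⟩
  filter_upwards [hz, measure_eq_zero_iff_ae_notMem.1 hTD] with ω h1 h2 hω
  by_contra hc
  exact h2 ⟨hω, fun hD => hc (h1.1 hD)⟩

/-! ### Infima in `L⁰` -/

/-- The essential infimum exists in `L̄⁰`; a real lower bound and one real member force it to be
finite. -/
theorem exists_isGLB_real [IsFiniteMeasure P] {S : Set (L0 P)} (hne : S.Nonempty) {b : L0 P}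
    (hb : b ∈ lowerBounds S) : ∃ g, IsGLB S g := by
  obtain ⟨y, hy⟩ := hne
  set h := essInfSet (toBar '' S) with hh
  obtain ⟨g, hg⟩ := exists_ae_eq_real P (measurable_coe_Lbar h).ereal_toReal
  have hbh : ∀ᵐ ω ∂P, (b ω : EReal) ≤ h ω := by
    have : toBar b ≤ h := by
      refine (isGLB_essInfSet _).2 ?_
      rintro _ ⟨x, hx, rfl⟩
      apply le_of_ae_le
      filter_upwards [ae_toBar b, ae_toBar x, ae_le_of_le (hb hx)] with ω h1 h2 h3
      rw [h1, h2]
      exact_mod_cast h3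
    filter_upwards [ae_le_of_le this, ae_toBar b] with ω h1 h2
    rwa [h2] at h1
  have hle : ∀ x ∈ S, ∀ᵐ ω ∂P, h ω ≤ (x ω : EReal) := fun x hx => by
    filter_upwards [ae_essInfSet_le (Set.mem_image_of_mem toBar hx), ae_toBar x] with ω h1 h2
    rwa [h2] at h1
  have hgh : ∀ᵐ ω ∂P, (g ω : EReal) = h ω := by
    filter_upwards [hg, hbh, hle y hy] with ω h1 h2 h3
    rw [h1]
    exact EReal.coe_toReal (fun h => by simp [h] at h3) (fun h => by simp [h] at h2)
  refine ⟨g, fun x hx => le_of_ae_le ?_, fun c hc => le_of_ae_le ?_⟩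
  · filter_upwards [hle x hx, hgh] with ω h1 h2
    rw [← h2] at h1
    exact_mod_cast h1
  · have : toBar c ≤ h := by
      refine (isGLB_essInfSet _).2 ?_
      rintro _ ⟨x, hx, rfl⟩
      apply le_of_ae_le
      filter_upwards [ae_toBar c, ae_toBar x, ae_le_of_le (hc hx)] with ω h1 h2 h3
      rw [h1, h2]
      exact_mod_cast h3
    filter_upwards [ae_le_of_le this, ae_toBar c, hgh] with ω h1 h2 h3
    rw [h2, ← h3] at h1
    exact_mod_cast h1

theorem ae_le_isGLB_on {S : Set (L0 P)} {g : L0 P} (hg : IsGLB S g) {A : Set Ω}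
    (hA : MeasurableSet A) {b : L0 P} (h : ∀ x ∈ S, ∀ᵐ ω ∂P, ω ∈ A → b ω ≤ x ω) :
    ∀ᵐ ω ∂P, ω ∈ A → b ω ≤ g ω := by
  obtain ⟨c, hc⟩ := exists_ae_eq_real_cases (P := P) hA (measurable_coe_L0 b) (measurable_coe_L0 g)
  have h1 : c ≤ g := by
    refine hg.2 fun x hx => le_of_ae_le ?_
    filter_upwards [h x hx, hc, ae_le_of_le (hg.1 hx)] with ω h1 h2 h3
    by_cases hω : ω ∈ A
    · rw [h2.1 hω]; exact h1 hω
    · rw [h2.2 hω]; exact h3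
  filter_upwards [ae_le_of_le h1, hc] with ω h1 h2 hω
  rwa [h2.1 hω] at h1

theorem exists_lt_of_isGLB_lt {S : Set (L0 P)} {g : L0 P} (hg : IsGLB S g) {e : L0 P} {A : Set Ω}
    (hA : MeasurableSet A) (hPA : P A ≠ 0) (h : ∀ᵐ ω ∂P, ω ∈ A → g ω < e ω) :
    ∃ x ∈ S, P (A ∩ {ω | x ω < e ω}) ≠ 0 := by
  by_contra! hc
  have h1 := ae_le_isGLB_on hg hA (b := e) fun x hx => by
    filter_upwards [measure_eq_zero_iff_ae_notMem.1 (hc x hx)] with ω h hω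
    by_contra hlt
    exact h ⟨hω, not_le.1 hlt⟩
  obtain ⟨ω, hω, h2, h3⟩ := exists_of_ae_of_measure_ne_zero hPA (h.and h1)
  exact absurd (h2 hω) (not_lt.2 (h3 hω))

/-- The conditional substitute for choosing an element close to the infimum: stability under gluing
lets one member do so on all of `T`. -/
theorem exists_lt_on_of_isGLB [IsFiniteMeasure P] {S : Set (L0 P)} (hne : S.Nonempty)
    (hS : ∀ A, IsPartition A → ∀ y : ℕ → L0 P, (∀ n, y n ∈ S) →
      ∃ z ∈ S, ∀ n, ∀ᵐ ω ∂P, ω ∈ A n → z ω ≤ y n ω)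
    {g : L0 P} (hg : IsGLB S g) {T : Set Ω} (hT : MeasurableSet T) {e : L0 P}
    (h : ∀ᵐ ω ∂P, ω ∈ T → g ω < e ω) : ∃ z ∈ S, ∀ᵐ ω ∂P, ω ∈ T → z ω < e ω :=
  exists_lt_on_of_stable hne hS hT fun _ hBT hB hPB =>
    exists_lt_of_isGLB_lt hg hB hPB (h.mono fun _ h hω => h (hBT hω))

theorem le_add_of_isGLB {S T : Set (L0 P)} {a b c : L0 P} (ha : IsGLB S a) (hb : IsGLB T b)
    (h : ∀ x ∈ S, ∀ y ∈ T, c ≤ x + y) : c ≤ a + b := by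
  have h1 : ∀ y ∈ T, c - y ≤ a := fun y hy =>
    ha.2 fun x hx => sub_le_iff_le_add.2 (h x hx y hy)
  have h2 : c - a ≤ b := hb.2 fun y hy => sub_le_comm.1 (h1 y hy)
  exact sub_le_iff_le_add'.1 h2

/-- Division by `l` is possible only on `{0 < l}`; where `l = 0`, any single member of `S` already
shows `c ≤ 0`. -/
theorem le_mul_of_isGLB {S : Set (L0 P)} (hne : S.Nonempty) {a c l : L0 P} (ha : IsGLB S a)
    (hl : 0 ≤ l) (h : ∀ x ∈ S, c ≤ l * x) : c ≤ l * a := by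
  have hm : MeasurableSet {ω | 0 < l ω} := measurableSet_lt measurable_const (measurable_coe_L0 l)
  obtain ⟨d, hd⟩ := exists_ae_eq_real P ((measurable_coe_L0 c).div (measurable_coe_L0 l))
  have h1 := ae_le_isGLB_on ha hm (b := d) fun x hx => by
    filter_upwards [hd, ae_le_of_le (h x hx), ae_mul l x] with ω h1 h2 h3 hω
    rw [h3] at h2
    rw [h1]
    exact (div_le_iff₀' hω).2 h2
  obtain ⟨y, hy⟩ := hne
  apply le_of_ae_le
  filter_upwards [h1, hd, ae_le_of_le (h y hy), ae_mul l y, ae_mul l a, ae_nonneg hl]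
    with ω h1 h2 h3 h4 h5 h6
  rw [h5]
  rcases h6.eq_or_lt with h0 | h0
  · rw [h4, ← h0] at h3
    rw [← h0]
    simpa using h3
  · have := h1 h0
    rw [h2] at this
    exact (div_le_iff₀' h0).1 this

/-! ### The Hahn–Banach theorem for `L⁰`-modules -/

section HahnBanach

variable {E : Type*} [AddCommGroup E] [Module (L0 P) E]

/-- `L⁰`-sublinear maps. -/
structure IsSublinear (q : E → L0 P) : Prop where
  add_le : ∀ x y, q (x + y) ≤ q x + q y
  smul_le : ∀ l : L0 P, 0 ≤ l → ∀ x, q (l • x) ≤ l * q x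

namespace IsSublinear

variable {q : E → L0 P}

theorem map_zero (hq : IsSublinear q) : q 0 = 0 := by
  apply le_antisymm
  · simpa using hq.smul_le 0 le_rfl 0
  · have := hq.add_le 0 0
    rw [add_zero] at this
    exact nonneg_of_le_add_right this

theorem neg_le (hq : IsSublinear q) (x : E) : -q (-x) ≤ q x := by
  have := hq.add_le x (-x)
  rw [add_neg_cancel, hq.map_zero] at this
  exact neg_le_iff_add_nonneg.2 this

/-- The infimum of a family that decomposes as in the hypotheses is sublinear. -/
theorem of_isGLB {S : E → Set (L0 P)} (hne : ∀ x, (S x).Nonempty) (hq : ∀ x, IsGLB (S x) (q x))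
    (hadd : ∀ x y, ∀ a ∈ S x, ∀ b ∈ S y, ∃ c ∈ S (x + y), c ≤ a + b)
    (hsmul : ∀ l : L0 P, 0 ≤ l → ∀ x, ∀ a ∈ S x, ∃ c ∈ S (l • x), c ≤ l * a) :
    IsSublinear q where
  add_le x y := le_add_of_isGLB (hq x) (hq y) fun a ha b hb => by
    obtain ⟨c, hc, hle⟩ := hadd x y a ha b hb
    exact ((hq _).1 hc).trans hle
  smul_le l hl x := le_mul_of_isGLB (hne x) (hq x) hl fun a ha => by
    obtain ⟨c, hc, hle⟩ := hsmul l hl x a ha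
    exact ((hq _).1 hc).trans hle

/-- As `l` may vanish, the invertible `l + 1` is used instead: `(l + 1) * q x ≤ q ((l + 1) • x) ≤ q
(l • x) + q x`, and `q x` cancels. -/
theorem mul_le (hq : IsSublinear q) {l : L0 P} (hl : 0 ≤ l) (x : E) : l * q x ≤ q (l • x) := by
  have hl1 : IsPos (l + 1) := by
    filter_upwards [ae_nonneg hl, ae_add l 1, ae_one (P := P)] with ω h1 h2 h3
    rw [h2, h3]
    linarith
  obtain ⟨k, hk, hlk, -⟩ := exists_inv_of_isPos hl1
  have h1 : q x ≤ k * q ((l + 1) • x) := by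
    have := hq.smul_le k hk.le ((l + 1) • x)
    rwa [smul_smul, mul_comm k, hlk, one_smul] at this
  have h2 := L0.mul_le_mul_of_nonneg h1 hl1.le
  rw [← mul_assoc, hlk, one_mul, add_smul, one_smul, add_mul, one_mul] at h2
  exact le_of_add_le_add_right (h2.trans (hq.add_le _ _))

/-- A sublinear map that is odd is linear. -/
theorem exists_linearMap_eq (hq : IsSublinear q) (hneg : ∀ x, q (-x) = -q x) :
    ∃ f : E →ₗ[L0 P] L0 P, ∀ x, f x = q x := by
  have hadd : ∀ x y, q (x + y) = q x + q y := fun x y => by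
    refine le_antisymm (hq.add_le x y) ?_
    have := hq.add_le (-x) (-y)
    rw [← neg_add, hneg, hneg, hneg, ← neg_add] at this
    exact neg_le_neg_iff.1 this
  have hpos : ∀ l : L0 P, 0 ≤ l → ∀ x, q (l • x) = l * q x := fun l hl x =>
    le_antisymm (hq.smul_le l hl x) (hq.mul_le hl x)
  refine ⟨{ toFun := q, map_add' := hadd, map_smul' := fun l x => ?_ }, fun x => rfl⟩
  have h0 : l = (l ⊔ 0) - (-l ⊔ 0) := by
    apply AEEqFun.ext
    filter_upwards [ae_sub (l ⊔ 0) (-l ⊔ 0), AEEqFun.coeFn_sup l 0, AEEqFun.coeFn_sup (-l) 0,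
      ae_neg l, ae_zero (P := P)] with ω h1 h2 h3 h4 h5
    rw [h1, h2, h3, h4, h5]
    rcases le_total (l ω) 0 with h | h
    · rw [max_eq_right h, max_eq_left (by linarith)]; ring
    · rw [max_eq_left h, max_eq_right (by linarith)]; ring
  rw [RingHom.id_apply, smul_eq_mul]
  conv_lhs => rw [h0]
  conv_rhs => rw [h0]
  rw [sub_smul, sub_eq_add_neg, hadd, hneg, hpos _ le_sup_right, hpos _ le_sup_right, sub_mul,
    sub_eq_add_neg]

variable [IsFiniteMeasure P]

/-- The pointwise infimum along the chain is bounded below by `-p (-x)`. It is sublinear because, of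
two members of the chain, the smaller one can be used for both summands. -/
theorem exists_isGLB_chain {p : E → L0 P} {c : Set (E → L0 P)}
    (hcp : ∀ q ∈ c, IsSublinear q ∧ q ≤ p) (hc : IsChain (· ≤ ·) c) (hne : c.Nonempty) :
    ∃ q : E → L0 P, IsSublinear q ∧ ∀ r ∈ c, q ≤ r := by
  have hb : ∀ x : E, -p (-x) ∈ lowerBounds ((fun r : E → L0 P => r x) '' c) := by
    rintro x _ ⟨r, hr, rfl⟩
    exact (neg_le_neg ((hcp r hr).2 (-x))).trans ((hcp r hr).1.neg_le x)
  choose q hq using fun x => exists_isGLB_real (hne.image fun r : E → L0 P => r x) (hb x)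
  refine ⟨q, of_isGLB (fun x => hne.image _) hq ?_ ?_, fun r hr x => (hq x).1 ⟨r, hr, rfl⟩⟩
  · rintro x y _ ⟨r, hr, rfl⟩ _ ⟨t, ht, rfl⟩
    rcases hc.total hr ht with h | h
    · exact ⟨r (x + y), ⟨r, hr, rfl⟩, ((hcp r hr).1.add_le x y).trans (add_le_add le_rfl (h y))⟩
    · exact ⟨t (x + y), ⟨t, ht, rfl⟩, ((hcp t ht).1.add_le x y).trans (add_le_add (h x) le_rfl)⟩
  · rintro l hl x _ ⟨r, hr, rfl⟩
    exact ⟨r (l • x), ⟨r, hr, rfl⟩, (hcp r hr).1.smul_le l hl x⟩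

/-- The infimum over `l ≥ 0` of `q (y + l • x) - l * q x` is sublinear in `y` and below `q`, hence
equal to `q`. Evaluating at `y = -x`, `l = 1` gives `q (-x) ≤ -q x`. -/
theorem map_neg_of_minimal (hq : IsSublinear q)
    (hmin : ∀ r : E → L0 P, IsSublinear r → r ≤ q → r = q) (x : E) : q (-x) = -q x := by
  let S : E → Set (L0 P) := fun y => {a | ∃ l : L0 P, 0 ≤ l ∧ a = q (y + l • x) - l * q x}
  have hne : ∀ y, (S y).Nonempty := fun y => ⟨_, 0, le_rfl, rfl⟩
  have hb : ∀ y, -q (-y) ∈ lowerBounds (S y) := by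
    rintro y _ ⟨l, hl, rfl⟩
    have h1 := hq.add_le (y + l • x) (-y)
    rw [add_neg_cancel_comm] at h1
    have h2 := (hq.mul_le hl x).trans h1
    rw [neg_le_iff_add_nonneg]
    rw [sub_add_eq_add_sub]
    exact sub_nonneg.2 h2
  choose r hr using fun y => exists_isGLB_real (hne y) (hb y)
  have hrs : IsSublinear r := by
    refine of_isGLB hne hr ?_ ?_
    · rintro y z _ ⟨l, hl, rfl⟩ _ ⟨k, hk, rfl⟩
      refine ⟨_, ⟨l + k, add_nonneg hl hk, rfl⟩, ?_⟩
      have h1 := hq.add_le (y + l • x) (z + k • x)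
      have e : y + z + (l + k) • x = y + l • x + (z + k • x) := by rw [add_smul]; abel
      rw [e, add_mul, sub_add_sub_comm]
      exact sub_le_sub_right h1 _
    · rintro k hk y _ ⟨l, hl, rfl⟩
      refine ⟨_, ⟨k * l, L0.mul_nonneg hk hl, rfl⟩, ?_⟩
      have h1 := hq.smul_le k hk (y + l • x)
      rw [smul_add, smul_smul] at h1
      rw [mul_sub, mul_assoc]
      exact sub_le_sub_right h1 _
  have hrq : r = q := hmin r hrs fun y => by
    simpa using (hr y).1 ⟨0, le_rfl, rfl⟩
  have h1 : q (-x) ≤ -q x := by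
    have h2 := (hr (-x)).1 ⟨1, zero_le_one_L0, rfl⟩
    rw [hrq] at h2
    simpa [hq.map_zero] using h2
  refine le_antisymm h1 ?_
  exact _root_.neg_le.1 (hq.neg_le x)

/-- Every sublinear map dominates a linear map. -/
theorem exists_linearMap_le {p : E → L0 P} (hp : IsSublinear p) :
    ∃ f : E →ₗ[L0 P] L0 P, ∀ x, f x ≤ p x := by
  obtain ⟨q, hqp, hq⟩ := zorn_le_nonempty₀ (α := (E → L0 P)ᵒᵈ)
    {q | IsSublinear (OrderDual.ofDual q) ∧ OrderDual.ofDual q ≤ p} (fun c hcs hc y hy => by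
      obtain ⟨q, hq, hqr⟩ := exists_isGLB_chain (p := p) (c := OrderDual.ofDual '' c)
        (by rintro _ ⟨r, hr, rfl⟩; exact hcs hr)
        (by
          rintro _ ⟨r, hr, rfl⟩ _ ⟨t, ht, rfl⟩ hne
          exact (hc hr ht (fun h => hne (congrArg _ h))).symm)
        ⟨_, y, hy, rfl⟩
      exact ⟨OrderDual.toDual q, ⟨hq, (hqr _ ⟨y, hy, rfl⟩).trans (hcs hy).2⟩,
        fun r hr => hqr _ ⟨r, hr, rfl⟩⟩) (OrderDual.toDual p) ⟨hp, le_rfl⟩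
  have hmin : ∀ r : E → L0 P, IsSublinear r → r ≤ OrderDual.ofDual q → r = OrderDual.ofDual q :=
    fun r hr hrq => le_antisymm hrq (hq.2 (y := OrderDual.toDual r) ⟨hr, hrq.trans hq.1.2⟩ hrq)
  obtain ⟨f, hf⟩ := hq.1.1.exists_linearMap_eq (hq.1.1.map_neg_of_minimal hmin)
  exact ⟨f, fun x => (hf x).trans_le (hq.1.2 x)⟩

end IsSublinear

/-- The weight is `a / (a + b)`; where `a + b = 0` the default value `0` is harmless since `a` and
`b` vanish there. It merges `a • u + b • v` into one multiple of a convex combination. -/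
theorem exists_convex_weight {a b : L0 P} (ha : 0 ≤ a) (hb : 0 ≤ b) :
    ∃ l : L0 P, 0 ≤ l ∧ l ≤ 1 ∧ (a + b) * l = a ∧ (a + b) * (1 - l) = b := by
  obtain ⟨l, hl⟩ := exists_ae_eq_real P
    ((measurable_coe_L0 a).div ((measurable_coe_L0 a).add (measurable_coe_L0 b)))
  have h : (a + b) * l = a := by
    apply AEEqFun.ext
    filter_upwards [hl, ae_nonneg ha, ae_nonneg hb, ae_mul (a + b) l, ae_add a b]
      with ω h1 h2 h3 h4 h5
    rw [h4, h5, h1]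
    simp only [Pi.div_apply, Pi.add_apply]
    rcases (add_nonneg h2 h3).eq_or_lt with h | h
    · have : a ω = 0 := by linarith
      rw [← h]; simp [this]
    · exact mul_div_cancel₀ _ h.ne'
  refine ⟨l, nonneg_of_ae ?_, le_one_of_ae ?_, h, ?_⟩
  · filter_upwards [hl, ae_nonneg ha, ae_nonneg hb] with ω h1 h2 h3
    rw [h1]
    exact div_nonneg h2 (add_nonneg h2 h3)
  · filter_upwards [hl, ae_nonneg ha, ae_nonneg hb] with ω h1 h2 h3
    rw [h1]
    exact div_le_one_of_le₀ (by simp only [Pi.add_apply]; linarith) (add_nonneg h2 h3)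
  · rw [mul_sub, h, mul_one, add_sub_cancel_left]

/-- Separation of a point from a convex set at `p`-distance at least `d`. -/
theorem IsSublinear.exists_linearMap_separating [IsFiniteMeasure P] {p : E → L0 P}
    (hp : IsSublinear p) {C : Set E} (hC : L0Convex P C) (hne : C.Nonempty) {x₀ : E} {d : L0 P}
    (hd : ∀ c ∈ C, d ≤ p (c - x₀)) :
    ∃ f : E →ₗ[L0 P] L0 P, (∀ x, f x ≤ p x) ∧ ∀ c ∈ C, f x₀ + d ≤ f c := by
  -- Convexity of `C` makes the infimum of `S y` sublinear in `y`. A linear map below it is below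
  -- `p` (take `l = 0`) and at most `-d` at `x₀ - c` (take `l = 1`).
  let S : E → Set (L0 P) := fun y =>
    {a | ∃ c ∈ C, ∃ l : L0 P, 0 ≤ l ∧ a = p (y + l • (c - x₀)) - l * d}
  obtain ⟨c₀, hc₀⟩ := hne
  have hSne : ∀ y, (S y).Nonempty := fun y => ⟨_, c₀, hc₀, 0, le_rfl, rfl⟩
  have hb : ∀ y, -p (-y) ∈ lowerBounds (S y) := by
    rintro y _ ⟨c, hc, l, hl, rfl⟩
    have h1 := hp.add_le (y + l • (c - x₀)) (-y)
    rw [add_neg_cancel_comm] at h1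
    have h2 := (L0.mul_le_mul_of_nonneg (hd c hc) hl).trans ((hp.mul_le hl _).trans h1)
    rw [neg_le_iff_add_nonneg, sub_add_eq_add_sub]
    exact sub_nonneg.2 h2
  choose q hq using fun y => exists_isGLB_real (hSne y) (hb y)
  have hqs : IsSublinear q := by
    refine IsSublinear.of_isGLB hSne hq ?_ ?_
    · rintro y z _ ⟨c, hc, l, hl, rfl⟩ _ ⟨e, he, k, hk, rfl⟩
      obtain ⟨t, ht0, ht1, h1, h2⟩ := exists_convex_weight hl hk
      refine ⟨_, ⟨_, hC t ht0 ht1 c hc e he, l + k, add_nonneg hl hk, rfl⟩, ?_⟩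
      have e1 : y + z + (l + k) • (t • c + (1 - t) • e - x₀) =
          y + l • (c - x₀) + (z + k • (e - x₀)) := by
        rw [smul_sub, smul_add, smul_smul, smul_smul, h1, h2, add_smul, smul_sub, smul_sub]
        abel
      rw [e1, add_mul, sub_add_sub_comm]
      exact sub_le_sub_right (hp.add_le _ _) _
    · rintro k hk y _ ⟨c, hc, l, hl, rfl⟩
      refine ⟨_, ⟨c, hc, k * l, L0.mul_nonneg hk hl, rfl⟩, ?_⟩
      have h1 := hp.smul_le k hk (y + l • (c - x₀))
      rw [smul_add, smul_smul] at h1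
      rw [mul_sub, mul_assoc]
      exact sub_le_sub_right h1 _
  obtain ⟨f, hf⟩ := hqs.exists_linearMap_le
  refine ⟨f, fun x => (hf x).trans ((hq x).1 ⟨c₀, hc₀, 0, le_rfl, by simp⟩), fun c hc => ?_⟩
  have h1 : f (x₀ - c) ≤ -d := (hf _).trans ((hq _).1 ⟨c, hc, 1, zero_le_one_L0, by
    simp [hp.map_zero]⟩)
  rw [map_sub] at h1
  have h2 := add_le_add_left h1 (f c + d)
  calc f x₀ + d = f x₀ - f c + (f c + d) := by abel
    _ ≤ -d + (f c + d) := h2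
    _ = f c := by abel

end HahnBanach

end CondIndex

end

/-! ### One-sided continuous versions of local increasing maps -/

noncomputable section

namespace CondIndex

variable {Ω : Type*} [MeasurableSpace Ω] {P : Measure Ω}

/-! ### Sequences decreasing or increasing strictly to an extended real -/

/-- A sequence that decreases to `x`, strictly from above if `x < ∞`. -/
def up (k : ℕ) (x : EReal) : EReal :=
  max (x + ((1 / ((k : ℝ) + 1) : ℝ) : EReal)) ((-(k : ℝ) : ℝ) : EReal)

/-- A sequence that increases to `x`, strictly from below if `x > -∞`. -/
def down (k : ℕ) (x : EReal) : EReal := -up k (-x)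

theorem lt_up (k : ℕ) {x : EReal} (hx : x < ⊤) : x < up k x := by
  induction x with
  | bot => exact lt_max_of_lt_right (EReal.bot_lt_coe _)
  | top => exact absurd hx (lt_irrefl _)
  | coe r =>
    refine lt_max_of_lt_left ?_
    have : r < r + 1 / ((k : ℝ) + 1) := lt_add_of_pos_right _ (by positivity)
    exact_mod_cast this

theorem up_lt_top (k : ℕ) {x : EReal} (hx : x < ⊤) : up k x < ⊤ := by
  refine max_lt ?_ (EReal.coe_lt_top _)
  exact EReal.add_lt_top hx.ne (EReal.coe_ne_top _)

theorem bot_lt_up (k : ℕ) (x : EReal) : ⊥ < up k x := lt_max_of_lt_right (EReal.bot_lt_coe _)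

theorem exists_up_lt {x y : EReal} (h : x < y) : ∃ k, up k x < y := by
  obtain ⟨z, hxz, hzy⟩ := EReal.lt_iff_exists_real_btwn.1 h
  obtain ⟨w, hxw, hwz⟩ := EReal.lt_iff_exists_real_btwn.1 hxz
  have hwz' : w < z := by exact_mod_cast hwz
  obtain ⟨k₁, hk₁⟩ := exists_nat_one_div_lt (sub_pos.2 hwz')
  obtain ⟨k₂, hk₂⟩ := exists_nat_gt (-z)
  refine ⟨max k₁ k₂, (max_lt ?_ ?_).trans_le hzy.le⟩
  · have h1 : (1 : ℝ) / ((max k₁ k₂ : ℕ) + 1) ≤ 1 / ((k₁ : ℝ) + 1) :=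
      one_div_le_one_div_of_le (by positivity) (by
        have : (k₁ : ℝ) ≤ (max k₁ k₂ : ℕ) := by exact_mod_cast le_max_left k₁ k₂
        linarith)
    calc x + ((1 / (((max k₁ k₂ : ℕ) : ℝ) + 1) : ℝ) : EReal)
        ≤ (w : EReal) + ((1 / (((max k₁ k₂ : ℕ) : ℝ) + 1) : ℝ) : EReal) :=
          add_le_add hxw.le le_rfl
      _ < (z : EReal) := by
          rw [← EReal.coe_add]
          have : w + 1 / (((max k₁ k₂ : ℕ) : ℝ) + 1) < z := by linarith
          exact_mod_cast this
  · have : (k₂ : ℝ) ≤ (max k₁ k₂ : ℕ) := by exact_mod_cast le_max_right k₁ k₂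
    have : -((max k₁ k₂ : ℕ) : ℝ) < z := by linarith
    exact_mod_cast this

theorem down_lt (k : ℕ) {x : EReal} (hx : ⊥ < x) : down k x < x := by
  have h : -x < up k (-x) := lt_up k (by rw [← EReal.neg_bot]; exact EReal.neg_lt_neg_iff.2 hx)
  exact EReal.neg_lt_comm.1 h

theorem exists_lt_down {x y : EReal} (h : y < x) : ∃ k, y < down k x := by
  obtain ⟨k, hk⟩ := exists_up_lt (EReal.neg_lt_neg_iff.2 h)
  exact ⟨k, EReal.lt_neg_comm.1 hk⟩

theorem measurable_up (k : ℕ) : Measurable (up k) :=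
  (measurable_id.add_const _).max measurable_const

theorem measurable_down (k : ℕ) : Measurable (down k) :=
  ((measurable_up k).comp measurable_neg).neg

/-- `up k` on `L̄⁰`. -/
def upBar (k : ℕ) (m : Lbar P) : Lbar P :=
  AEEqFun.mk (fun ω => up k (m ω))
    ((measurable_up k).comp (measurable_coe_Lbar m)).aestronglyMeasurable

/-- `down k` on `L̄⁰`. -/
def downBar (k : ℕ) (m : Lbar P) : Lbar P :=
  AEEqFun.mk (fun ω => down k (m ω))
    ((measurable_down k).comp (measurable_coe_Lbar m)).aestronglyMeasurable

theorem ae_upBar (m : Lbar P) : ∀ᵐ ω ∂P, ∀ k, upBar k m ω = up k (m ω) :=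
  ae_all_iff.2 fun _ => AEEqFun.coeFn_mk _ _

theorem ae_downBar (m : Lbar P) : ∀ᵐ ω ∂P, ∀ k, downBar k m ω = down k (m ω) :=
  ae_all_iff.2 fun _ => AEEqFun.coeFn_mk _ _

/-! ### Local increasing maps -/

/-- Local and increasing maps `L̄⁰ → L̄⁰`. -/
def LocalMono (F : Lbar P → Lbar P) : Prop :=
  ∀ s t, ∀ᵐ ω ∂P, s ω ≤ t ω → F s ω ≤ F t ω

/-- Gluing `s` on `{s ≤ t}` with `t` elsewhere gives an element below `t`; locality recovers `F s`
on the first set. -/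
theorem localMono_of_monotone {F : Lbar P → Lbar P} (hmono : Monotone F)
    (hloc : ∀ (A : Set Ω) (hA : MeasurableSet A) (s t : Lbar P),
      F (glue hA s t) = glue hA (F s) (F t)) : LocalMono F := by
  intro s t
  have hA : MeasurableSet {ω | s ω ≤ t ω} :=
    measurableSet_le (measurable_coe_Lbar s) (measurable_coe_Lbar t)
  have h1 : glue hA s t ≤ t := by
    apply le_of_ae_le
    filter_upwards [ae_glue_of_mem hA s t, ae_glue_of_notMem hA s t] with ω h1 h2
    by_cases hω : ω ∈ {ω | s ω ≤ t ω}
    · rw [h1 hω]; exact hω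
    · rw [h2 hω]
  have h2 := hmono h1
  rw [hloc] at h2
  filter_upwards [ae_le_of_le h2, ae_glue_of_mem hA (F s) (F t)] with ω h3 h4 hω
  rwa [h4 hω] at h3

namespace LocalMono

variable {F : Lbar P → Lbar P}

theorem eq_on (hF : LocalMono F) (s t : Lbar P) : ∀ᵐ ω ∂P, s ω = t ω → F s ω = F t ω := by
  filter_upwards [hF s t, hF t s] with ω h1 h2 h
  exact le_antisymm (h1 h.le) (h2 h.ge)

theorem monotone (hF : LocalMono F) : Monotone F := fun s t h => le_of_ae_le <| by
  filter_upwards [hF s t, ae_le_of_le h] with ω h1 h2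
  exact h1 h2

theorem rightVersion_eq_top (F : Lbar P → Lbar P) (m : Lbar P) :
    ∀ᵐ ω ∂P, m ω = ⊤ → rightVersion F m ω = ⊤ := by
  filter_upwards [ae_constBar (P := P) ⊤,
    ae_glue_of_notMem (measurableSet_lt_top m) (essInfSet {x | ∃ n : Lbar P,
      (∀ᵐ ω ∂P, m ω < ⊤ → m ω < n ω) ∧ x = F n}) (AEEqFun.const Ω ⊤)] with ω h1 h2 hω
  rw [← h1]
  exact h2 (fun h => (ne_of_lt h) hω)

theorem leftVersion_eq_bot (F : Lbar P → Lbar P) (m : Lbar P) :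
    ∀ᵐ ω ∂P, m ω = ⊥ → leftVersion F m ω = ⊥ := by
  filter_upwards [ae_constBar (P := P) ⊥,
    ae_glue_of_notMem (measurableSet_bot_lt m) (essSupSet {x | ∃ n : Lbar P,
      (∀ᵐ ω ∂P, ⊥ < m ω → n ω < m ω) ∧ x = F n}) (AEEqFun.const Ω ⊥)] with ω h1 h2 hω
  rw [← h1]
  exact h2 (fun h => (ne_of_gt h) hω)

variable [IsFiniteMeasure P]

/-- `n` need not be admissible in the defining infimum, but becomes so when replaced by `⊤` off `{m
< n}`; by locality this leaves `F n` unchanged on `{m < n}`. -/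
theorem rightVersion_le (hF : LocalMono F) (m n : Lbar P) :
    ∀ᵐ ω ∂P, m ω < n ω → rightVersion F m ω ≤ F n ω := by
  have hA : MeasurableSet {ω | m ω < n ω} :=
    measurableSet_lt (measurable_coe_Lbar m) (measurable_coe_Lbar n)
  have hadm : ∀ᵐ ω ∂P, m ω < ⊤ → m ω < glue hA n (AEEqFun.const Ω ⊤) ω := by
    filter_upwards [ae_glue_of_mem hA n (AEEqFun.const Ω ⊤),
      ae_glue_of_notMem hA n (AEEqFun.const Ω ⊤), ae_constBar (P := P) ⊤] with ω h1 h2 h3 hω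
    by_cases h : ω ∈ {ω | m ω < n ω}
    · rw [h1 h]; exact h
    · rwa [h2 h, h3]
  filter_upwards [ae_essInfSet_le (S := {x | ∃ n : Lbar P,
      (∀ᵐ ω ∂P, m ω < ⊤ → m ω < n ω) ∧ x = F n}) ⟨_, hadm, rfl⟩,
    ae_glue_of_mem (measurableSet_lt_top m) (essInfSet {x | ∃ n : Lbar P,
      (∀ᵐ ω ∂P, m ω < ⊤ → m ω < n ω) ∧ x = F n}) (AEEqFun.const Ω ⊤),
    hF.eq_on (glue hA n (AEEqFun.const Ω ⊤)) n, ae_glue_of_mem hA n (AEEqFun.const Ω ⊤)]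
    with ω h1 h2 h3 h4 hω
  rw [← h3 (h4 hω)]
  exact (h2 (hω.trans_le le_top)).trans_le h1

/-- Every admissible `n` is eventually above `up k m`, at an index depending on `ω`. With
`rightVersion_le` this lets the essential infimum be handled pointwise through a countable one. -/
theorem le_rightVersion (hF : LocalMono F) (m : Lbar P) :
    ∀ᵐ ω ∂P, ⨅ k, F (upBar k m) ω ≤ rightVersion F m ω := by
  obtain ⟨b, hb⟩ := exists_ae_eq_ereal P
    (Measurable.iInf fun k => measurable_coe_Lbar (F (upBar k m)))
  have h1 := ae_le_essInfSet_on (measurableSet_lt_top m) (b := b) (S := {x | ∃ n : Lbar P,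
      (∀ᵐ ω ∂P, m ω < ⊤ → m ω < n ω) ∧ x = F n}) (by
    rintro _ ⟨n, hn, rfl⟩
    filter_upwards [hn, hb, ae_upBar m, ae_all_iff.2 fun k => hF (upBar k m) n]
      with ω h1 h2 h3 h4 hω
    obtain ⟨k, hk⟩ := exists_up_lt (h1 hω)
    rw [h2]
    exact (iInf_le _ k).trans (h4 k (by rw [h3]; exact hk.le)))
  filter_upwards [h1, hb, rightVersion_eq_top F m, ae_glue_of_mem (measurableSet_lt_top m)
      (essInfSet {x | ∃ n : Lbar P, (∀ᵐ ω ∂P, m ω < ⊤ → m ω < n ω) ∧ x = F n})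
      (AEEqFun.const Ω ⊤)] with ω h1 h2 h3 h4
  rcases eq_or_ne (m ω) ⊤ with h | h
  · rw [h3 h]; exact le_top
  · rw [← h2]
    exact (h1 h.lt_top).trans_eq (h4 h.lt_top).symm

theorem le_leftVersion (hF : LocalMono F) (m n : Lbar P) :
    ∀ᵐ ω ∂P, n ω < m ω → F n ω ≤ leftVersion F m ω := by
  have hA : MeasurableSet {ω | n ω < m ω} :=
    measurableSet_lt (measurable_coe_Lbar n) (measurable_coe_Lbar m)
  have hadm : ∀ᵐ ω ∂P, ⊥ < m ω → glue hA n (AEEqFun.const Ω ⊥) ω < m ω := by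
    filter_upwards [ae_glue_of_mem hA n (AEEqFun.const Ω ⊥),
      ae_glue_of_notMem hA n (AEEqFun.const Ω ⊥), ae_constBar (P := P) ⊥] with ω h1 h2 h3 hω
    by_cases h : ω ∈ {ω | n ω < m ω}
    · rw [h1 h]; exact h
    · rwa [h2 h, h3]
  filter_upwards [ae_le_essSupSet (S := {x | ∃ n : Lbar P,
      (∀ᵐ ω ∂P, ⊥ < m ω → n ω < m ω) ∧ x = F n}) ⟨_, hadm, rfl⟩,
    ae_glue_of_mem (measurableSet_bot_lt m) (essSupSet {x | ∃ n : Lbar P,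
      (∀ᵐ ω ∂P, ⊥ < m ω → n ω < m ω) ∧ x = F n}) (AEEqFun.const Ω ⊥),
    hF.eq_on (glue hA n (AEEqFun.const Ω ⊥)) n, ae_glue_of_mem hA n (AEEqFun.const Ω ⊥)]
    with ω h1 h2 h3 h4 hω
  rw [← h3 (h4 hω)]
  exact h1.trans_eq (h2 (bot_le.trans_lt hω)).symm

theorem leftVersion_le (hF : LocalMono F) (m : Lbar P) :
    ∀ᵐ ω ∂P, leftVersion F m ω ≤ ⨆ k, F (downBar k m) ω := by
  obtain ⟨b, hb⟩ := exists_ae_eq_ereal P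
    (Measurable.iSup fun k => measurable_coe_Lbar (F (downBar k m)))
  have h1 := ae_essSupSet_le_on (measurableSet_bot_lt m) (b := b) (S := {x | ∃ n : Lbar P,
      (∀ᵐ ω ∂P, ⊥ < m ω → n ω < m ω) ∧ x = F n}) (by
    rintro _ ⟨n, hn, rfl⟩
    filter_upwards [hn, hb, ae_downBar m, ae_all_iff.2 fun k => hF n (downBar k m)]
      with ω h1 h2 h3 h4 hω
    obtain ⟨k, hk⟩ := exists_lt_down (h1 hω)
    rw [h2]
    exact (h4 k (by rw [h3]; exact hk.le)).trans (le_iSup (fun k => F (downBar k m) ω) k))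
  filter_upwards [h1, hb, leftVersion_eq_bot F m, ae_glue_of_mem (measurableSet_bot_lt m)
      (essSupSet {x | ∃ n : Lbar P, (∀ᵐ ω ∂P, ⊥ < m ω → n ω < m ω) ∧ x = F n})
      (AEEqFun.const Ω ⊥)] with ω h1 h2 h3 h4
  rcases eq_or_ne (m ω) ⊥ with h | h
  · rw [h3 h]; exact bot_le
  · rw [← h2]
    exact (h4 h.bot_lt).trans_le (h1 h.bot_lt)

theorem le_rightVersion_self (hF : LocalMono F) (m : Lbar P) :
    ∀ᵐ ω ∂P, F m ω ≤ rightVersion F m ω := by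
  filter_upwards [hF.le_rightVersion m, rightVersion_eq_top F m, ae_upBar m,
    ae_all_iff.2 fun k => hF m (upBar k m)] with ω h1 h2 h3 h4
  rcases eq_or_ne (m ω) ⊤ with h | h
  · rw [h2 h]; exact le_top
  · exact (le_iInf fun k => h4 k (by rw [h3]; exact (lt_up k h.lt_top).le)).trans h1

theorem leftVersion_le_self (hF : LocalMono F) (m : Lbar P) :
    ∀ᵐ ω ∂P, leftVersion F m ω ≤ F m ω := by
  filter_upwards [hF.leftVersion_le m, leftVersion_eq_bot F m, ae_downBar m,
    ae_all_iff.2 fun k => hF (downBar k m) m] with ω h1 h2 h3 h4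
  rcases eq_or_ne (m ω) ⊥ with h | h
  · rw [h2 h]; exact bot_le
  · exact h1.trans (iSup_le fun k => h4 k (by rw [h3]; exact (down_lt k h.bot_lt).le))

theorem rightVersion (hF : LocalMono F) : LocalMono (rightVersion F) := by
  intro s t
  filter_upwards [hF.le_rightVersion t, rightVersion_eq_top F t, ae_upBar t,
    ae_all_iff.2 fun k => hF.rightVersion_le s (upBar k t)] with ω h1 h2 h3 h4 hst
  rcases eq_or_ne (t ω) ⊤ with h | h
  · rw [h2 h]; exact le_top
  · exact (le_iInf fun k => h4 k (by rw [h3]; exact hst.trans_lt (lt_up k h.lt_top))).trans h1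

theorem rightVersion_rightVersion (hF : LocalMono F) :
    CondIndex.rightVersion (CondIndex.rightVersion F) = CondIndex.rightVersion F := by
  funext m
  refine le_antisymm (le_of_ae_le ?_) (le_of_ae_le (hF.rightVersion.le_rightVersion_self m))
  filter_upwards [hF.le_rightVersion m, rightVersion_eq_top F m, ae_upBar m,
    ae_all_iff.2 fun k => hF.rightVersion.rightVersion_le m (upBar k m),
    ae_all_iff.2 fun k => ae_all_iff.2 fun j => hF.rightVersion_le (upBar j m) (upBar k m)]
    with ω h1 h2 h3 h4 h5
  rcases eq_or_ne (m ω) ⊤ with h | h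
  · rw [h2 h]; exact le_top
  · refine le_trans (le_iInf fun k => ?_) h1
    obtain ⟨j, hj⟩ := exists_up_lt (lt_up k h.lt_top)
    exact (h4 j (by rw [h3]; exact lt_up j h.lt_top)).trans (h5 k j (by rwa [h3, h3]))

/-- Between `down k m` and `m` there is a further `down j m`, and `F⁺ (down k m) ≤ F (down j m)`. -/
theorem leftVersion_rightVersion_le (hF : LocalMono F) (m : Lbar P) :
    ∀ᵐ ω ∂P, CondIndex.leftVersion (CondIndex.rightVersion F) m ω
      ≤ CondIndex.leftVersion F m ω := by
  filter_upwards [hF.rightVersion.leftVersion_le m, leftVersion_eq_bot (CondIndex.rightVersion F) m,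
    ae_downBar m, ae_all_iff.2 fun k => hF.le_leftVersion m (downBar k m),
    ae_all_iff.2 fun k => ae_all_iff.2 fun j => hF.rightVersion_le (downBar k m) (downBar j m)]
    with ω h1 h2 h3 h4 h5
  rcases eq_or_ne (m ω) ⊥ with h | h
  · rw [h2 h]; exact bot_le
  · refine h1.trans (iSup_le fun k => ?_)
    obtain ⟨j, hj⟩ := exists_lt_down (down_lt k h.bot_lt)
    exact (h5 k j (by rwa [h3, h3])).trans (h4 j (by rw [h3]; exact down_lt j h.bot_lt))

end LocalMono

end CondIndex

end

/-! ### From risk functions to assessment indices -/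

noncomputable section

namespace CondIndex

variable {Ω : Type*} [MeasurableSpace Ω] {P : Measure Ω}
  {X : Type*} [AddCommGroup X] [Module (L0 P) X]

theorem glue_self {A : Set Ω} (hA : MeasurableSet A) (s : Lbar P) : glue hA s s = s := by
  apply AEEqFun.ext
  filter_upwards [ae_glue_of_mem hA s s, ae_glue_of_notMem hA s s] with ω h1 h2
  by_cases hω : ω ∈ A
  exacts [h1 hω, h2 hω]

theorem eq_glue_of_ae {A : Set Ω} (hA : MeasurableSet A) {u s t : Lbar P}
    (h1 : ∀ᵐ ω ∂P, ω ∈ A → u ω = s ω) (h2 : ∀ᵐ ω ∂P, ω ∉ A → u ω = t ω) : u = glue hA s t := by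
  apply AEEqFun.ext
  filter_upwards [ae_glue_of_mem hA s t, ae_glue_of_notMem hA s t, h1, h2] with ω h3 h4 h5 h6
  by_cases hω : ω ∈ A
  · rw [h3 hω, h5 hω]
  · rw [h4 hω, h6 hω]

/-! ### Risk functions induce assessment indices -/

variable [TopologicalSpace X] {K : Set X}

theorem weakDual_comb_apply (l k : L0 P) (Z₁ Z₂ : WeakDual (L0 P) X) (x : X) :
    (l • Z₁ + k • Z₂) x = l * Z₁ x + k * Z₂ x := rfl

namespace IsRiskFunction

variable {R : polarCone (P := P) K → Lbar P → Lbar P}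

theorem localMono (hR : IsRiskFunction R) (Z : polarCone (P := P) K) : LocalMono (R Z) :=
  localMono_of_monotone (hR.increasing Z) fun A hA s t => hR.isLocal A hA Z Z Z (by
    rw [← add_smul, ind_add_ind_compl, one_smul]) s t

theorem eq_on (hR : IsRiskFunction R) {A : Set Ω} (hA : MeasurableSet A)
    {Z Z' : polarCone (P := P) K} (h : ∀ x, ∀ᵐ ω ∂P, ω ∈ A → Z.1 x ω = Z'.1 x ω) (s : Lbar P) :
    ∀ᵐ ω ∂P, ω ∈ A → R Z s ω = R Z' s ω := by
  have h1 := hR.isLocal A hA Z Z' Z' (by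
    refine DFunLike.ext _ _ fun x => ?_
    rw [weakDual_comb_apply, ind_mul_eq_of_ae hA (h x), ← add_mul, ind_add_ind_compl, one_mul]) s s
  rw [glue_self] at h1
  filter_upwards [ae_glue_of_mem hA (R Z s) (R Z' s)] with ω h2 hω
  rw [h1, h2 hω]

variable [IsFiniteMeasure P]

theorem robust_le (R : polarCone (P := P) K → Lbar P → Lbar P) (Z : polarCone (P := P) K)
    (x : X) : ∀ᵐ ω ∂P, robust R x ω ≤ R Z (toBar (Z.1 x)) ω :=
  ae_essInfSet_le ⟨Z, rfl⟩

theorem le_robust_on {x : X} {A : Set Ω} (hA : MeasurableSet A) {b : Lbar P}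
    (h : ∀ Z : polarCone (P := P) K, ∀ᵐ ω ∂P, ω ∈ A → b ω ≤ R Z (toBar (Z.1 x)) ω) :
    ∀ᵐ ω ∂P, ω ∈ A → b ω ≤ robust R x ω := by
  refine ae_le_essInfSet_on hA ?_
  rintro _ ⟨Z, rfl⟩
  exact h Z

/-- The value of the robust functional on `A` only depends on the argument on `A`. -/
theorem robust_le_robust_on (hR : IsRiskFunction R) {A : Set Ω} (hA : MeasurableSet A) {x y : X}
    (h : ∀ Z : polarCone (P := P) K, ∀ᵐ ω ∂P, ω ∈ A → Z.1 x ω ≤ Z.1 y ω) :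
    ∀ᵐ ω ∂P, ω ∈ A → robust R x ω ≤ robust R y ω := by
  refine le_robust_on hA fun Z => ?_
  filter_upwards [robust_le R Z x, hR.localMono Z (toBar (Z.1 x)) (toBar (Z.1 y)), h Z,
    ae_toBar (Z.1 x), ae_toBar (Z.1 y)] with ω h1 h2 h3 h4 h5 hω
  refine h1.trans (h2 ?_)
  rw [h4, h5]
  exact_mod_cast h3 hω

/-- Quasiconcavity holds because `⟨Z, l x + (1 - l) y⟩` is at least the smaller of `⟨Z, x⟩` and `⟨Z,
y⟩`, chosen separately at each `ω`, and `R Z` is locally increasing. -/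
theorem robust_isAssessmentIndex (hR : IsRiskFunction R) : IsAssessmentIndex K (robust R) where
  isLocal A hA x y := by
    have e : ∀ Z : polarCone (P := P) K, ∀ᵐ ω ∂P,
        (ω ∈ A → Z.1 (ind P hA • x + ind P hA.compl • y) ω = Z.1 x ω) ∧
        (ω ∉ A → Z.1 (ind P hA • x + ind P hA.compl • y) ω = Z.1 y ω) := fun Z => by
      have e1 : Z.1 (ind P hA • x + ind P hA.compl • y) =
          ind P hA * Z.1 x + ind P hA.compl * Z.1 y := by
        rw [map_add, map_smul, map_smul, smul_eq_mul, smul_eq_mul]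
      rw [e1]
      filter_upwards [ae_add (ind P hA * Z.1 x) (ind P hA.compl * Z.1 y),
        ae_mul (ind P hA) (Z.1 x), ae_mul (ind P hA.compl) (Z.1 y), ae_ind_of_mem (P := P) hA,
        ae_ind_of_notMem (P := P) hA, ae_ind_of_mem (P := P) hA.compl,
        ae_ind_of_notMem (P := P) hA.compl] with ω h1 h2 h3 h4 h5 h6 h7
      rw [h1, h2, h3]
      refine ⟨fun hω => ?_, fun hω => ?_⟩
      · rw [h4 hω, h7 (by simpa using hω)]; ring
      · rw [h5 hω, h6 hω]; ring
    refine eq_glue_of_ae hA ?_ ?_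
    · filter_upwards [hR.robust_le_robust_on hA fun Z => (e Z).mono fun ω h hω => (h.1 hω).le,
        hR.robust_le_robust_on hA fun Z => (e Z).mono fun ω h hω => (h.1 hω).ge] with ω h1 h2 hω
      exact le_antisymm (h1 hω) (h2 hω)
    · filter_upwards [hR.robust_le_robust_on hA.compl
          fun Z => (e Z).mono fun ω h hω => (h.2 hω).le,
        hR.robust_le_robust_on hA.compl fun Z => (e Z).mono fun ω h hω => (h.2 hω).ge]
        with ω h1 h2 hω
      exact le_antisymm (h1 hω) (h2 hω)
  quasiconcave l hl0 hl1 x y := by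
    refine (isGLB_essInfSet _).2 ?_
    rintro _ ⟨Z, rfl⟩
    apply le_of_ae_le
    have e1 : Z.1 (l • x + (1 - l) • y) = l * Z.1 x + (1 - l) * Z.1 y := by
      rw [map_add, map_smul, map_smul, smul_eq_mul, smul_eq_mul]
    simp only
    rw [e1]
    filter_upwards [AEEqFun.coeFn_inf (robust R x) (robust R y), robust_le R Z x, robust_le R Z y,
      hR.localMono Z (toBar (Z.1 x)) (toBar (l * Z.1 x + (1 - l) * Z.1 y)),
      hR.localMono Z (toBar (Z.1 y)) (toBar (l * Z.1 x + (1 - l) * Z.1 y)),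
      ae_toBar (Z.1 x), ae_toBar (Z.1 y), ae_toBar (l * Z.1 x + (1 - l) * Z.1 y),
      ae_add (l * Z.1 x) ((1 - l) * Z.1 y), ae_mul l (Z.1 x), ae_mul (1 - l) (Z.1 y),
      ae_sub 1 l, ae_one (P := P), ae_nonneg hl0, ae_le_one hl1]
      with ω h1 h2 h3 h4 h5 h6 h7 h8 h9 h10 h11 h12 h13 h14 h15
    rw [h6, h8, h9, h10, h11, h12, h13, EReal.coe_le_coe_iff] at h4
    rw [h7, h8, h9, h10, h11, h12, h13, EReal.coe_le_coe_iff] at h5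
    rw [h1]
    rcases le_total (Z.1 x ω) (Z.1 y ω) with h | h
    · exact (inf_le_left.trans h2).trans (h4 (by nlinarith))
    · exact (inf_le_right.trans h3).trans (h5 (by nlinarith))
  monotone x y hxy := by
    have := hR.robust_le_robust_on MeasurableSet.univ (x := y) (y := x) fun Z => by
      have h1 : 0 ≤ Z.1 (x - y) := Z.2 _ hxy
      rw [map_sub] at h1
      filter_upwards [ae_nonneg h1, ae_sub (Z.1 x) (Z.1 y)] with ω h2 h3 _
      rw [h3] at h2
      linarith
    exact le_of_ae_le (this.mono fun ω h => h (Set.mem_univ ω))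

/-- The upper level sets of `R Z` are closed in `L⁰`. -/
theorem isClosed_le (hR : IsRiskFunction R) (Z : polarCone (P := P) K) (m : Lbar P) :
    IsClosed {s : L0 P | m ≤ R Z (toBar s)} := by
  rw [← isOpen_compl_iff, isOpen_iff_mem_nhds]
  intro s hs
  have hs' : ¬ ∀ᵐ ω ∂P, m ω ≤ R Z (toBar s) ω := fun h => hs (le_of_ae_le h)
  have hm : MeasurableSet {ω | ¬ m ω ≤ R Z (toBar s) ω} :=
    (measurableSet_le (measurable_coe_Lbar m) (measurable_coe_Lbar _)).compl
  rw [ae_iff] at hs'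
  have hloc := hR.localMono Z
  have hinf := hloc.le_rightVersion (toBar s)
  rw [← hR.rightContinuous Z] at hinf
  -- Right-continuity: the failure at `s` persists on a nonnull set at some `up k s`, so the ball of
  -- radius `up k s - s` around `s` avoids the level set.
  obtain ⟨k, hk⟩ : ∃ k, P ({ω | ¬ m ω ≤ R Z (toBar s) ω} ∩
      {ω | R Z (upBar k (toBar s)) ω < m ω}) ≠ 0 := by
    by_contra hc
    simp only [not_exists, not_not] at hc
    refine hs' (measure_eq_zero_iff_ae_notMem.2 ?_)
    filter_upwards [ae_all_iff.2 fun k => measure_eq_zero_iff_ae_notMem.1 (hc k), hinf]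
      with ω h1 h2 hω
    refine hω ((le_iInf fun k => ?_).trans h2)
    by_contra hlt
    exact h1 k ⟨hω, not_le.1 hlt⟩
  obtain ⟨t, ht⟩ := exists_ae_eq_real P (measurable_coe_Lbar (upBar k (toBar s))).ereal_toReal
  have hst : ∀ᵐ ω ∂P, toBar t ω = upBar k (toBar s) ω ∧ s ω < t ω := by
    filter_upwards [ht, ae_toBar t, ae_toBar s, ae_upBar (toBar s)] with ω h1 h2 h3 h4
    have h5 := h4 k
    rw [h3] at h5
    have h6 : ((upBar k (toBar s) ω).toReal : EReal) = upBar k (toBar s) ω := by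
      rw [h5]
      exact EReal.coe_toReal (up_lt_top k (EReal.coe_lt_top _)).ne (bot_lt_up k _).ne'
    refine ⟨by rw [h2, h1, h6], ?_⟩
    rw [← EReal.coe_lt_coe_iff, h1, h6, h5]
    exact lt_up k (EReal.coe_lt_top _)
  refine (mem_nhds_iff_ball _ _).2 ⟨t - s, ?_, fun n hn hle => hk ?_⟩
  · filter_upwards [hst, ae_sub t s] with ω h1 h2
    rw [h2]
    linarith [h1.2]
  · refine measure_eq_zero_iff_ae_notMem.2 ?_
    filter_upwards [hn, ae_sub t s, hst, hloc (toBar n) (upBar k (toBar s)), ae_toBar n,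
      ae_toBar t, ae_le_of_le (show m ≤ R Z (toBar n) from hle)] with ω h1 h2 h3 h4 h5 h6 h7 hω
    rw [h2] at h1
    have h8 : n ω ≤ t ω := by
      have := neg_abs_le (s ω - n ω)
      linarith
    have h9 : toBar n ω ≤ upBar k (toBar s) ω := by
      rw [← h3.1, h5, h6]
      exact_mod_cast h8
    exact absurd (h7.trans (h4 h9)) (not_le.2 hω.2)

theorem robust_isUSC (hR : IsRiskFunction R) : IsUSC (robust R) := by
  intro m
  have : {x | m ≤ robust R x} = ⋂ Z : polarCone (P := P) K,
      (fun x => Z.1 x) ⁻¹' {s : L0 P | m ≤ R Z (toBar s)} := by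
    ext x
    simp only [Set.mem_iInter, Set.mem_preimage, Set.mem_ofPred_eq]
    refine ⟨fun h Z => h.trans ((isGLB_essInfSet _).1 ⟨Z, rfl⟩), fun h => (isGLB_essInfSet _).2 ?_⟩
    rintro _ ⟨Z, rfl⟩
    exact h Z
  rw [this]
  exact isClosed_iInter fun Z => (hR.isClosed_le Z m).preimage
    (ContinuousLinearMap.continuous (Z.1 : X →L[L0 P] L0 P))

end IsRiskFunction

end CondIndex

end

/-! ### The candidate risk function and its minimality -/

noncomputable section

namespace CondIndex

variable {Ω : Type*} [MeasurableSpace Ω] {P : Measure Ω}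
  {X : Type*} [AddCommGroup X] [Module (L0 P) X]

/-! ### Arithmetic of extended reals -/

theorem ereal_comb_le_coe {l k a b : ℝ} (hl : 0 ≤ l) (hk : 0 ≤ k) {s t : EReal} (hs : s ≤ a)
    (ht : t ≤ b) : (l : EReal) * s + (k : EReal) * t ≤ ((l * a + k * b : ℝ) : EReal) := by
  rw [EReal.coe_add, EReal.coe_mul, EReal.coe_mul]
  exact add_le_add (mul_le_mul_of_nonneg_left hs (by exact_mod_cast hl))
    (mul_le_mul_of_nonneg_left ht (by exact_mod_cast hk))

theorem ereal_comb_lt_coe {l k a b : ℝ} (hl : 0 ≤ l) (hk : 0 ≤ k) (hlk : l + k = 1) {s t : EReal}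
    (hs : s < a) (ht : t < b) :
    (l : EReal) * s + (k : EReal) * t < ((l * a + k * b : ℝ) : EReal) := by
  obtain ⟨s', hs1, hs2⟩ := EReal.lt_iff_exists_real_btwn.1 hs
  obtain ⟨t', ht1, ht2⟩ := EReal.lt_iff_exists_real_btwn.1 ht
  refine (ereal_comb_le_coe hl hk hs1.le ht1.le).trans_lt ?_
  have hs3 : s' < a := by exact_mod_cast hs2
  have ht3 : t' < b := by exact_mod_cast ht2
  rw [EReal.coe_lt_coe_iff]
  rcases hl.eq_or_lt with h | h
  · have : k = 1 := by linarith
    subst this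
    rw [← h]; linarith
  · nlinarith

theorem ereal_coe_mul_lt_iff {l : ℝ} (hl : 0 < l) (z : ℝ) (s : EReal) :
    ((l * z : ℝ) : EReal) < s ↔ (z : EReal) < s * ((l⁻¹ : ℝ) : EReal) := by
  induction s with
  | bot => rw [EReal.bot_mul_coe_of_pos (inv_pos.2 hl)]; simp
  | top => rw [EReal.top_mul_coe_of_pos (inv_pos.2 hl)]
           exact iff_of_true (EReal.coe_lt_top _) (EReal.coe_lt_top _)
  | coe r =>
    rw [← EReal.coe_mul, EReal.coe_lt_coe_iff, EReal.coe_lt_coe_iff, ← div_eq_mul_inv,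
      lt_div_iff₀' hl]

theorem ereal_mul_inv_lt_mul_inv {l : ℝ} (hl : 0 < l) {s t : EReal} (h : s < t) :
    s * ((l⁻¹ : ℝ) : EReal) < t * ((l⁻¹ : ℝ) : EReal) := by
  obtain ⟨r, h1, h2⟩ := EReal.lt_iff_exists_real_btwn.1 h
  have e : l * (r * l⁻¹) = r := by field_simp
  refine lt_of_le_of_lt (b := ((r * l⁻¹ : ℝ) : EReal)) ?_
    ((ereal_coe_mul_lt_iff hl _ _).1 (by rwa [e]))
  rw [EReal.coe_mul]
  exact mul_le_mul_of_nonneg_right h1.le (by exact_mod_cast (inv_pos.2 hl).le)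

theorem divBar_divBar {l k : L0 P} (hl : IsPos l) (hk : ∀ᵐ ω ∂P, k ω = (l ω)⁻¹) (s : Lbar P) :
    divBar (divBar s l) k = s := by
  apply AEEqFun.ext
  filter_upwards [ae_divBar (divBar s l) k, ae_divBar s l, hl, hk] with ω h1 h2 h3 h4
  rw [h1, h2, h4, inv_inv, mul_assoc, ← EReal.coe_mul, inv_mul_cancel₀ h3.ne', EReal.coe_one,
    mul_one]

/-! ### The minimal risk function of an assessment index -/

variable [TopologicalSpace X] {K : Set X}

/-- The left-continuous function `(Z, s) ↦ esssup {α x : ⟨Z, x⟩ < s}`, where the supremum also runs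
over the parts of `Ω` on which the constraint holds. -/
def levelSup (α : X → Lbar P) (Z : WeakDual (L0 P) X) (s : Lbar P) : Lbar P :=
  essSupSet {y | ∃ x, ∀ᵐ ω ∂P, y ω = ⊥ ∨ (y ω ≤ α x ω ∧ (Z x ω : EReal) < s ω)}

/-- The right-continuous version of `levelSup`. -/
def minRisk (α : X → Lbar P) (Z : polarCone (P := P) K) : Lbar P → Lbar P :=
  rightVersion (levelSup α Z.1)

variable {α : X → Lbar P} [IsFiniteMeasure P]

theorem le_levelSup (α : X → Lbar P) (Z : WeakDual (L0 P) X) (s : Lbar P) (x : X) :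
    ∀ᵐ ω ∂P, (Z x ω : EReal) < s ω → α x ω ≤ levelSup α Z s ω := by
  obtain ⟨y, hy⟩ := exists_ae_eq_ereal_cases (P := P)
    (measurableSet_lt (measurable_toEReal_L0 (Z x)) (measurable_coe_Lbar s))
    (measurable_coe_Lbar (α x)) (measurable_const (a := (⊥ : EReal)))
  have : ∀ᵐ ω ∂P, y ω ≤ levelSup α Z s ω := ae_le_essSupSet ⟨x, by
    filter_upwards [hy] with ω h
    by_cases hω : (Z x ω : EReal) < s ω
    · exact Or.inr ⟨(h.1 hω).le, hω⟩
    · exact Or.inl (h.2 hω)⟩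
  filter_upwards [this, hy] with ω h1 h2 h3
  rwa [h2.1 h3] at h1

theorem levelSup_le_on {Z : WeakDual (L0 P) X} {s : Lbar P} {A : Set Ω} (hA : MeasurableSet A)
    {b : Lbar P} (h : ∀ x, ∀ᵐ ω ∂P, ω ∈ A → (Z x ω : EReal) < s ω → α x ω ≤ b ω) :
    ∀ᵐ ω ∂P, ω ∈ A → levelSup α Z s ω ≤ b ω := by
  refine ae_essSupSet_le_on hA ?_
  rintro y ⟨x, hx⟩
  filter_upwards [hx, h x] with ω h1 h2 hω
  rcases h1 with h1 | h1
  · rw [h1]; exact bot_le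
  · exact h1.1.trans (h2 hω h1.2)

theorem levelSup_le {Z : WeakDual (L0 P) X} {s b : Lbar P}
    (h : ∀ x, ∀ᵐ ω ∂P, (Z x ω : EReal) < s ω → α x ω ≤ b ω) :
    ∀ᵐ ω ∂P, levelSup α Z s ω ≤ b ω := by
  filter_upwards [levelSup_le_on MeasurableSet.univ fun x => (h x).mono fun ω h _ => h] with ω h
  exact h (Set.mem_univ ω)

theorem levelSup_le_levelSup_on {Z Z' : WeakDual (L0 P) X} {s t : Lbar P} {A : Set Ω}
    (hA : MeasurableSet A) (hZ : ∀ x, ∀ᵐ ω ∂P, ω ∈ A → Z x ω = Z' x ω)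
    (hst : ∀ᵐ ω ∂P, ω ∈ A → s ω ≤ t ω) :
    ∀ᵐ ω ∂P, ω ∈ A → levelSup α Z s ω ≤ levelSup α Z' t ω := by
  refine levelSup_le_on hA fun x => ?_
  filter_upwards [hZ x, hst, le_levelSup α Z' t x] with ω h1 h2 h3 hω h4
  exact h3 (by rw [← h1 hω]; exact h4.trans_le (h2 hω))

theorem levelSup_localMono (α : X → Lbar P) (Z : WeakDual (L0 P) X) :
    LocalMono (levelSup α Z) := fun s t =>
  levelSup_le_levelSup_on (measurableSet_le (measurable_coe_Lbar s) (measurable_coe_Lbar t))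
    (fun _ => Eventually.of_forall fun _ _ => rfl) (Eventually.of_forall fun _ h => h)

theorem minRisk_le_minRisk_on {Z Z' : polarCone (P := P) K} {s t : Lbar P} {A : Set Ω}
    (hA : MeasurableSet A) (hZ : ∀ x, ∀ᵐ ω ∂P, ω ∈ A → Z.1 x ω = Z'.1 x ω)
    (hst : ∀ᵐ ω ∂P, ω ∈ A → s ω ≤ t ω) :
    ∀ᵐ ω ∂P, ω ∈ A → minRisk α Z s ω ≤ minRisk α Z' t ω := by
  filter_upwards [(levelSup_localMono α Z'.1).le_rightVersion t, ae_upBar t, hst,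
    LocalMono.rightVersion_eq_top (levelSup α Z'.1) t,
    ae_all_iff.2 fun k => (levelSup_localMono α Z.1).rightVersion_le s (upBar k t),
    ae_all_iff.2 fun k => levelSup_le_levelSup_on (α := α) hA hZ
      (Eventually.of_forall fun ω _ => le_refl (upBar k t ω))] with ω h1 h2 h3 h4 h5 h6 hω
  rcases eq_or_ne (t ω) ⊤ with h | h
  · exact le_top.trans_eq (h4 h).symm
  · refine (le_iInf fun k => ?_).trans h1
    exact (h5 k (by rw [h2]; exact (h3 hω).trans_lt (lt_up k h.lt_top))).trans (h6 k hω)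

theorem le_minRisk (α : X → Lbar P) (Z : polarCone (P := P) K) (s : Lbar P) (x : X) :
    ∀ᵐ ω ∂P, (Z.1 x ω : EReal) ≤ s ω → α x ω ≤ minRisk α Z s ω := by
  filter_upwards [(levelSup_localMono α Z.1).le_rightVersion s, ae_upBar s,
    LocalMono.rightVersion_eq_top (levelSup α Z.1) s,
    ae_all_iff.2 fun k => le_levelSup α Z.1 (upBar k s) x] with ω h1 h2 h3 h4 hω
  rcases eq_or_ne (s ω) ⊤ with h | h
  · exact le_top.trans_eq (h3 h).symm
  · exact (le_iInf fun k => h4 k (by rw [h2]; exact hω.trans_lt (lt_up k h.lt_top))).trans h1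

/-- `levelSup` is left-continuous because its constraint is strict: `⟨Z, x⟩ < s` implies `⟨Z, x⟩ <
down k s` for some `k`. Hence passing to the right version loses nothing. -/
theorem leftVersion_minRisk (α : X → Lbar P) (Z : polarCone (P := P) K) (s : Lbar P) :
    leftVersion (minRisk α Z) s = levelSup α Z.1 s := by
  have hG := levelSup_localMono α Z.1
  refine le_antisymm (le_of_ae_le ?_) (le_of_ae_le (levelSup_le fun x => ?_))
  · filter_upwards [hG.leftVersion_rightVersion_le s, hG.leftVersion_le_self s] with ω h1 h2
    exact h1.trans h2
  · filter_upwards [ae_downBar s, ae_all_iff.2 fun k => le_levelSup α Z.1 (downBar k s) x,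
      ae_all_iff.2 fun k => hG.le_rightVersion_self (downBar k s),
      ae_all_iff.2 fun k => hG.rightVersion.le_leftVersion s (downBar k s)] with ω h1 h2 h3 h4 hω
    obtain ⟨k, hk⟩ := exists_lt_down hω
    exact (h2 k (by rwa [h1])).trans ((h3 k).trans
      (h4 k (by rw [h1]; exact down_lt k (bot_le.trans_lt hω))))

theorem minRisk_isRiskFunction (α : X → Lbar P) : IsRiskFunction (minRisk (K := K) α) where
  isLocal A hA Z₁ Z₂ Z hZ s t := by
    have e1 : ∀ x, ∀ᵐ ω ∂P, (ω ∈ A → Z.1 x ω = Z₁.1 x ω) ∧ (ω ∈ Aᶜ → Z.1 x ω = Z₂.1 x ω) := by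
      intro x
      rw [hZ, weakDual_comb_apply]
      filter_upwards [ae_add (ind P hA * Z₁.1 x) (ind P hA.compl * Z₂.1 x),
        ae_mul (ind P hA) (Z₁.1 x), ae_mul (ind P hA.compl) (Z₂.1 x), ae_ind_of_mem (P := P) hA,
        ae_ind_of_notMem (P := P) hA, ae_ind_of_mem (P := P) hA.compl,
        ae_ind_of_notMem (P := P) hA.compl] with ω h1 h2 h3 h4 h5 h6 h7
      rw [h1, h2, h3]
      refine ⟨fun hω => ?_, fun hω => ?_⟩
      · rw [h4 hω, h7 (by simpa using hω)]; ring
      · rw [h5 hω, h6 hω]; ring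
    refine eq_glue_of_ae hA ?_ ?_
    · filter_upwards [minRisk_le_minRisk_on (α := α) hA (fun x => (e1 x).mono fun ω h => h.1)
          ((ae_glue_of_mem hA s t).mono fun ω h hω => (h hω).le),
        minRisk_le_minRisk_on (α := α) hA (fun x => (e1 x).mono fun ω h hω => (h.1 hω).symm)
          ((ae_glue_of_mem hA s t).mono fun ω h hω => (h hω).ge)] with ω h1 h2 hω
      exact le_antisymm (h1 hω) (h2 hω)
    · filter_upwards [minRisk_le_minRisk_on (α := α) hA.compl
          (fun x => (e1 x).mono fun ω h => h.2)
          ((ae_glue_of_notMem hA s t).mono fun ω h hω => (h hω).le),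
        minRisk_le_minRisk_on (α := α) hA.compl
          (fun x => (e1 x).mono fun ω h hω => (h.2 hω).symm)
          ((ae_glue_of_notMem hA s t).mono fun ω h hω => (h hω).ge)] with ω h1 h2 hω
      exact le_antisymm (h1 hω) (h2 hω)
  increasing Z := (levelSup_localMono α Z.1).rightVersion.monotone
  rightContinuous Z := (levelSup_localMono α Z.1).rightVersion_rightVersion.symm

/-- If `⟨Z₁, x⟩ ≥ s` and `⟨Z₂, x⟩ ≥ t`, the combined constraint fails; so where it holds, `x`
competes in one of the two suprema on the right. -/
theorem levelSup_comb_le {l : L0 P} (hl0 : 0 ≤ l) (hl1 : l ≤ 1) (Z₁ Z₂ : WeakDual (L0 P) X)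
    (s t : Lbar P) : ∀ᵐ ω ∂P, levelSup α (l • Z₁ + (1 - l) • Z₂) (combBar l s (1 - l) t) ω ≤
      levelSup α Z₁ s ω ⊔ levelSup α Z₂ t ω := by
  obtain ⟨b, hb⟩ := exists_ae_eq_ereal P
    ((measurable_coe_Lbar (levelSup α Z₁ s)).sup (measurable_coe_Lbar (levelSup α Z₂ t)))
  have := levelSup_le (α := α) (Z := l • Z₁ + (1 - l) • Z₂) (s := combBar l s (1 - l) t) (b := b)
    fun x => by
      rw [weakDual_comb_apply]
      filter_upwards [le_levelSup α Z₁ s x, le_levelSup α Z₂ t x, hb, ae_combBar l s (1 - l) t,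
        ae_add (l * Z₁ x) ((1 - l) * Z₂ x), ae_mul l (Z₁ x), ae_mul (1 - l) (Z₂ x), ae_sub 1 l,
        ae_one (P := P), ae_nonneg hl0, ae_le_one hl1] with ω h1 h2 h3 h4 h5 h6 h7 h8 h9 h10 h11 hω
      rw [h3]
      by_cases hs : (Z₁ x ω : EReal) < s ω
      · exact (h1 hs).trans le_sup_left
      by_cases ht : (Z₂ x ω : EReal) < t ω
      · exact (h2 ht).trans le_sup_right
      refine absurd hω (not_lt.2 ?_)
      rw [h4, h5, h6, h7]
      refine ereal_comb_le_coe h10 ?_ (not_lt.1 hs) (not_lt.1 ht)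
      rw [h8, h9]
      linarith
  filter_upwards [this, hb] with ω h1 h2
  rwa [h2] at h1

theorem minRisk_comb_le {l : L0 P} (hl0 : 0 ≤ l) (hl1 : l ≤ 1) {Z₁ Z₂ Z : polarCone (P := P) K}
    (hZ : Z.1 = l • Z₁.1 + (1 - l) • Z₂.1) (s t : Lbar P) :
    minRisk α Z (combBar l s (1 - l) t) ≤ minRisk α Z₁ s ⊔ minRisk α Z₂ t := by
  have h1 := (levelSup_localMono α Z₁.1).le_rightVersion s
  have h2 := (levelSup_localMono α Z₂.1).le_rightVersion t
  -- When `s, t < ⊤`, the values `up j s` and `up k t` are real, so the combination strictly exceeds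
  -- that of `s` and `t` with no `∞ - ∞`. If `s` or `t` is `⊤`, the right-hand side of the claim is
  -- `⊤`.
  have h3 : ∀ᵐ ω ∂P, ∀ j k, minRisk α Z (combBar l s (1 - l) t) ω ≤
      levelSup α Z.1 (combBar l (upBar j s) (1 - l) (upBar k t)) ω ∨ s ω = ⊤ ∨ t ω = ⊤ := by
    refine ae_all_iff.2 fun j => ae_all_iff.2 fun k => ?_
    filter_upwards [(levelSup_localMono α Z.1).rightVersion_le (combBar l s (1 - l) t)
        (combBar l (upBar j s) (1 - l) (upBar k t)), ae_upBar s, ae_upBar t,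
      ae_combBar l s (1 - l) t, ae_combBar l (upBar j s) (1 - l) (upBar k t), ae_sub 1 l,
        ae_one (P := P), ae_nonneg hl0, ae_le_one hl1] with ω h1 h2 h3 h4 h5 h6 h7 h8 h9
    by_cases hs : s ω = ⊤
    · exact Or.inr (Or.inl hs)
    by_cases ht : t ω = ⊤
    · exact Or.inr (Or.inr ht)
    refine Or.inl (h1 ?_)
    have hs' := EReal.coe_toReal (up_lt_top j (Ne.lt_top hs)).ne (bot_lt_up j (s ω)).ne'
    have ht' := EReal.coe_toReal (up_lt_top k (Ne.lt_top ht)).ne (bot_lt_up k (t ω)).ne'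
    rw [h4, h5, h2, h3, ← hs', ← ht', ← EReal.coe_mul, ← EReal.coe_mul, ← EReal.coe_add]
    refine ereal_comb_lt_coe h8 ?_ ?_ ?_ ?_
    · rw [h6, h7]; linarith
    · rw [h6, h7]; ring
    · rw [hs']; exact lt_up j (Ne.lt_top hs)
    · rw [ht']; exact lt_up k (Ne.lt_top ht)
  apply le_of_ae_le
  filter_upwards [h1, h2, h3, AEEqFun.coeFn_sup (minRisk α Z₁ s) (minRisk α Z₂ t),
    LocalMono.rightVersion_eq_top (levelSup α Z₁.1) s,
    LocalMono.rightVersion_eq_top (levelSup α Z₂.1) t,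
    ae_all_iff.2 fun j => ae_all_iff.2 fun k =>
      levelSup_comb_le (α := α) hl0 hl1 Z₁.1 Z₂.1 (upBar j s) (upBar k t)]
    with ω h1 h2 h3 h4 h5 h6 h7
  rw [h4]
  by_cases hs : s ω = ⊤
  · exact le_trans (le_top.trans_eq (h5 hs).symm) le_sup_left
  by_cases ht : t ω = ⊤
  · exact le_trans (le_top.trans_eq (h6 ht).symm) le_sup_right
  by_contra hlt
  rw [not_le, sup_lt_iff] at hlt
  obtain ⟨j, hj⟩ := iInf_lt_iff.1 (h1.trans_lt hlt.1)
  obtain ⟨k, hk⟩ := iInf_lt_iff.1 (h2.trans_lt hlt.2)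
  rcases h3 j k with h | h | h
  · rw [hZ] at h
    exact absurd (h.trans (h7 j k)) (not_le.2 (max_lt hj hk))
  · exact hs h
  · exact ht h

theorem levelSup_smul_le {l : L0 P} (hl : IsPos l) {Z Z' : WeakDual (L0 P) X} (hZ : Z' = l • Z)
    (s : Lbar P) : ∀ᵐ ω ∂P, levelSup α Z (divBar s l) ω ≤ levelSup α Z' s ω := by
  refine levelSup_le fun x => ?_
  have e : Z' x = l * Z x := by rw [hZ]; rfl
  have h0 := le_levelSup α Z' s x
  rw [e] at h0
  filter_upwards [h0, ae_mul l (Z x), hl, ae_divBar s l] with ω h1 h2 h3 h4 hω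
  refine h1 ?_
  rw [h2, ereal_coe_mul_lt_iff h3]
  rwa [h4] at hω

theorem minRisk_smul_le {l : L0 P} (hl : IsPos l) {Z Z' : polarCone (P := P) K}
    (hZ : Z'.1 = l • Z.1) (s : Lbar P) :
    ∀ᵐ ω ∂P, minRisk α Z (divBar s l) ω ≤ minRisk α Z' s ω := by
  filter_upwards [(levelSup_localMono α Z'.1).le_rightVersion s, ae_upBar s,
    LocalMono.rightVersion_eq_top (levelSup α Z'.1) s, ae_divBar s l, hl,
    ae_all_iff.2 fun k => ae_divBar (upBar k s) l,
    ae_all_iff.2 fun k => levelSup_smul_le (α := α) hl hZ (upBar k s),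
    ae_all_iff.2 fun k => (levelSup_localMono α Z.1).rightVersion_le (divBar s l)
      (divBar (upBar k s) l)] with ω h1 h2 h3 h4 h5 h6 h7 h8
  rcases eq_or_ne (s ω) ⊤ with h | h
  · exact le_top.trans_eq (h3 h).symm
  · refine (le_iInf fun k => (h8 k ?_).trans (h7 k)).trans h1
    rw [h4, h6, h2]
    exact ereal_mul_inv_lt_mul_inv h5 (lt_up k h.lt_top)

/-- One inequality suffices; the other is the same one for `l⁻¹`. -/
theorem minRisk_smul {l : L0 P} (hl : IsPos l) {Z Z' : polarCone (P := P) K}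
    (hZ : Z'.1 = l • Z.1) (s : Lbar P) : minRisk α Z' s = minRisk α Z (divBar s l) := by
  obtain ⟨k, hk, hlk, hk'⟩ := exists_inv_of_isPos hl
  refine le_antisymm (le_of_ae_le ?_) (le_of_ae_le (minRisk_smul_le hl hZ s))
  have hZ' : Z.1 = k • Z'.1 := by rw [hZ, smul_smul, mul_comm, hlk, one_smul]
  have := minRisk_smul_le (α := α) hk hZ' (divBar s l)
  rwa [divBar_divBar hl hk'] at this

/-- Every `x` is reached at the level `s = ⟨Z, x⟩`, whatever `Z` is. The right-hand side does not
involve `Z`, which is the uniform asymptotic maximum. -/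
theorem essSupSet_minRisk (α : X → Lbar P) (Z : polarCone (P := P) K) :
    essSupSet (Set.range fun s : L0 P => minRisk α Z (toBar s)) = essSupSet (Set.range α) := by
  refine le_antisymm ((isLUB_essSupSet _).2 ?_) ((isLUB_essSupSet _).2 ?_)
  · rintro _ ⟨s, rfl⟩
    apply le_of_ae_le
    filter_upwards [(levelSup_localMono α Z.1).rightVersion_le (toBar s) (upBar 0 (toBar s)),
      levelSup_le (α := α) (Z := Z.1) (s := upBar 0 (toBar s)) (b := essSupSet (Set.range α))
        (fun x => (ae_le_essSupSet (⟨x, rfl⟩ : α x ∈ Set.range α)).mono fun ω h _ => h),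
      ae_upBar (toBar s), ae_toBar s] with ω h1 h2 h3 h4
    refine (h1 ?_).trans h2
    rw [h3, h4]
    exact lt_up 0 (EReal.coe_lt_top _)
  · rintro _ ⟨x, rfl⟩
    apply le_of_ae_le
    filter_upwards [le_minRisk α Z (toBar (Z.1 x)) x, ae_toBar (Z.1 x),
      ae_le_essSupSet (S := Set.range fun s : L0 P => minRisk α Z (toBar s))
        (Set.mem_range_self (Z.1 x))] with ω h1 h2 h3
    exact (h1 h2.ge).trans h3

theorem isClosed_levelSup_le (α : X → Lbar P) (m : Lbar P) :
    IsClosed {p : polarCone (P := P) K × L0 P | levelSup α p.1.1 (toBar p.2) ≤ m} := by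
  rw [← isOpen_compl_iff, isOpen_iff_mem_nhds]
  rintro ⟨Z, s⟩ hp
  obtain ⟨x, hx⟩ : ∃ x, P {ω | (Z.1 x ω : EReal) < (s ω : EReal) ∧ m ω < α x ω} ≠ 0 := by
    by_contra hc
    simp only [not_exists, not_not] at hc
    refine hp (le_of_ae_le (levelSup_le fun x => ?_))
    filter_upwards [measure_eq_zero_iff_ae_notMem.1 (hc x), ae_toBar s] with ω h1 h2 h3
    rw [h2] at h3
    by_contra hlt
    exact h1 ⟨h3, not_le.1 hlt⟩
  set B := {ω | (Z.1 x ω : EReal) < (s ω : EReal) ∧ m ω < α x ω}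
  have hB : MeasurableSet B :=
    (measurableSet_lt (measurable_toEReal_L0 (Z.1 x)) (measurable_toEReal_L0 s)).inter
      (measurableSet_lt (measurable_coe_Lbar m) (measurable_coe_Lbar (α x)))
  -- A third of the gap, so that moving `⟨Z, x⟩` and `s` by `e` each keeps the strict inequality on
  -- `B`; the value `1` off `B` only serves positivity.
  obtain ⟨e, he⟩ := exists_ae_eq_real_cases (P := P) hB
    (((measurable_coe_L0 s).sub (measurable_coe_L0 (Z.1 x))).div_const 3)
    (measurable_const (a := (1 : ℝ)))
  have hepos : IsPos e := by
    filter_upwards [he] with ω h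
    by_cases hω : ω ∈ B
    · rw [h.1 hω]
      have : Z.1 x ω < s ω := by exact_mod_cast hω.1
      simp only [Pi.sub_apply]
      linarith
    · rw [h.2 hω]; exact one_pos
  have hn1 : {p : polarCone (P := P) K × L0 P | p.1.1 x ∈ ball (Z.1 x) e} ∈ 𝓝 (Z, s) := by
    have hc : Continuous fun p : polarCone (P := P) K × L0 P => p.1.1 x :=
      (WeakDual.eval_continuous x).comp (continuous_subtype_val.comp continuous_fst)
    exact hc.continuousAt.preimage_mem_nhds ((mem_nhds_iff_ball _ _).2 ⟨e, hepos, subset_rfl⟩)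
  have hn2 : {p : polarCone (P := P) K × L0 P | p.2 ∈ ball s e} ∈ 𝓝 (Z, s) :=
    continuous_snd.continuousAt.preimage_mem_nhds
      ((mem_nhds_iff_ball _ _).2 ⟨e, hepos, subset_rfl⟩)
  filter_upwards [hn1, hn2]
  rintro ⟨Z', s'⟩ h1 h2 hle
  refine hx (measure_eq_zero_iff_ae_notMem.2 ?_)
  filter_upwards [h1, h2, he, le_levelSup α Z'.1 (toBar s') x, ae_toBar s',
    ae_le_of_le (show levelSup α Z'.1 (toBar s') ≤ m from hle)] with ω h1 h2 h3 h4 h5 h6 hω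
  have h7 : Z.1 x ω < s ω := by exact_mod_cast hω.1
  have h8 := h3.1 hω
  simp only [Pi.sub_apply] at h8
  rw [h8] at h1 h2
  have h9 : Z'.1 x ω < s' ω := by
    have := (abs_le.1 h1).1
    have := (abs_le.1 h2).2
    simp only at *
    linarith
  refine absurd ((h4 ?_).trans h6) (not_le.2 hω.2)
  rw [h5]
  exact_mod_cast h9

theorem minRisk_isMinimal (α : X → Lbar P) : IsMinimalRiskFunction (minRisk (K := K) α) where
  toIsRiskFunction := minRisk_isRiskFunction α
  quasiconvex _ hl0 hl1 _ _ _ hZ s t := minRisk_comb_le hl0 hl1 hZ s t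
  scaling _ hl _ _ hZ s := minRisk_smul hl hZ s
  asymptoticMax Z Z' := by rw [essSupSet_minRisk, essSupSet_minRisk]
  lsc m := by
    simp only [leftVersion_minRisk]
    exact isClosed_levelSup_le α m

/-- For the zero functional the constraint `0 < 0` has no solutions, so `levelSup` at level `0` is
`⊥`, and it bounds `minRisk` at every `s < 0`. -/
theorem minRisk_isNormalizedAtZero (α : X → Lbar P) :
    IsNormalizedAtZero (minRisk (K := K) α) := by
  intro Z hZ s
  filter_upwards [(levelSup_localMono α Z.1).rightVersion_le s (toBar 0),
    levelSup_le (α := α) (Z := Z.1) (s := toBar 0) (b := AEEqFun.const Ω ⊥) (fun x => by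
      have e : Z.1 x = 0 := by rw [hZ]; rfl
      rw [e]
      filter_upwards [ae_toBar (0 : L0 P)] with ω h1 h2
      rw [h1] at h2
      exact absurd h2 (lt_irrefl _)), ae_constBar (P := P) ⊥, ae_toBar (0 : L0 P),
    ae_zero (P := P)] with ω h1 h2 h3 h4 h5 hω
  rw [h3] at h2
  refine le_bot_iff.1 ((h1 ?_).trans h2)
  rw [h4, h5]
  exact_mod_cast hω

end CondIndex

end

noncomputable section

namespace CondIndex

variable {Ω : Type*} [MeasurableSpace Ω] {P : Measure Ω}
  {X : Type*} [AddCommGroup X] [Module (L0 P) X]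

/-! ### Gauges of neighbourhoods of zero -/

theorem IsSublinear.smul_eq {q : X → L0 P} (hq : IsSublinear q) {l : L0 P} (hl : 0 ≤ l) (x : X) :
    q (l • x) = l * q x := le_antisymm (hq.smul_le l hl x) (hq.mul_le hl x)

theorem IsSublinear.eq_on {q : X → L0 P} (hq : IsSublinear q) {A : Set Ω} (hA : MeasurableSet A)
    {x y : X} (h : ind P hA • x = ind P hA • y) : ∀ᵐ ω ∂P, ω ∈ A → q x ω = q y ω := by
  apply ae_eq_of_ind_mul_eq hA
  rw [← hq.smul_eq (ind_nonneg hA), ← hq.smul_eq (ind_nonneg hA), h]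

theorem IsPos.add {a b : L0 P} (ha : IsPos a) (hb : IsPos b) : IsPos (a + b) := by
  filter_upwards [ha, hb, ae_add a b] with ω h1 h2 h3
  rw [h3]
  exact add_pos h1 h2

theorem IsPos.add_nonneg {a b : L0 P} (ha : 0 ≤ a) (hb : IsPos b) : IsPos (a + b) := by
  filter_upwards [ae_nonneg ha, hb, ae_add a b] with ω h1 h2 h3
  rw [h3]
  linarith

theorem le_of_forall_isPos_add {a b : L0 P} (h : ∀ e : L0 P, IsPos e → a ≤ b + e) : a ≤ b := by
  have h1 : ∀ n : ℕ, ∀ᵐ ω ∂P, a ω ≤ b ω + 1 / ((n : ℝ) + 1) := fun n => by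
    obtain ⟨e, he⟩ := exists_ae_eq_real P (measurable_const (a := 1 / ((n : ℝ) + 1)))
    filter_upwards [he, ae_add b e, ae_le_of_le (h e (he.mono fun ω h => by rw [h]; positivity))]
      with ω h1 h2 h3
    rwa [h2, h1] at h3
  apply le_of_ae_le
  filter_upwards [ae_all_iff.2 h1] with ω h
  refine le_of_forall_pos_le_add fun ε hε => ?_
  obtain ⟨n, hn⟩ := exists_nat_one_div_lt hε
  exact (h n).trans (by linarith)

/-- On `e • U` the map satisfies `f ≤ e`; balancedness gives the same for `-f`, so this
neighbourhood is mapped into the ball of radius `e`. -/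
theorem continuous_of_le_gauge [TopologicalSpace X] [IsTopologicalAddGroup X]
    [ContinuousSMul (L0 P) X] {U : Set X} (hU : U ∈ 𝓝 (0 : X)) (hbal : L0Balanced P U)
    {p : X → L0 P} (hp : ∀ l, IsPos l → ∀ u ∈ U, p (l • u) ≤ l) {f : X →ₗ[L0 P] L0 P}
    (hf : ∀ x, f x ≤ p x) : Continuous f := by
  refine continuous_of_continuousAt_zero f ?_
  rw [ContinuousAt, map_zero]
  intro V hV
  obtain ⟨e, he, heV⟩ := (mem_nhds_iff_ball _ _).1 hV
  obtain ⟨k, hk, hek, -⟩ := exists_inv_of_isPos he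
  have h1 : {x : X | k • x ∈ U} ∈ 𝓝 (0 : X) := by
    have hc : ContinuousAt (fun x : X => k • x) 0 := (continuous_const_smul k).continuousAt
    exact hc.preimage_mem_nhds (by simpa using hU)
  rw [mem_map]
  filter_upwards [h1] with x hx
  refine heV (mem_ball_zero.2 ?_)
  have h2 : f x ≤ e := by
    have := (hf (e • k • x)).trans (hp e he _ hx)
    rwa [smul_smul, hek, one_smul] at this
  have h3 : -f x ≤ e := by
    have h4 : (-1 : L0 P) • k • x ∈ U := hbal (-1) (by
      filter_upwards [ae_neg (1 : L0 P), ae_one (P := P)] with ω h1 h2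
      rw [h1, h2]; simp) _ hx
    have := (hf (e • (-1 : L0 P) • k • x)).trans (hp e he _ h4)
    rwa [smul_comm e, smul_smul e, hek, one_smul, neg_one_smul, map_neg] at this
  filter_upwards [ae_le_of_le h2, ae_le_of_le h3, ae_neg (f x)] with ω h4 h5 h6
  rw [h6] at h5
  exact abs_le.2 ⟨by linarith, h4⟩

variable [IsFiniteMeasure P]

/-- The Minkowski functional, the infimum of the `l > 0` with `x ∈ l • U`. `σ`-stability makes these
scalars stable under gluing, so where `p x < 1` a single such `l` is below `1`. -/
theorem exists_gauge {U : Set X} (hσ : SigmaStable P U) (hconv : L0Convex P U)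
    (habs : L0Absorbent P U) (hbal : L0Balanced P U) :
    ∃ p : X → L0 P, IsSublinear p ∧ (∀ x, 0 ≤ p x) ∧ (∀ l, IsPos l → ∀ u ∈ U, p (l • u) ≤ l) ∧
      ∀ (x : X) (A : Set Ω) (hA : MeasurableSet A), (∀ᵐ ω ∂P, ω ∈ A → p x ω < 1) →
        ind P hA • x ∈ U := by
  let S : X → Set (L0 P) := fun x => {l | IsPos l ∧ ∃ u ∈ U, x = l • u}
  have hne : ∀ x, (S x).Nonempty := fun x => by
    obtain ⟨l, hl, hu⟩ := habs x
    exact ⟨l, hl, hu⟩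
  have hb : ∀ x, 0 ∈ lowerBounds (S x) := fun x l hl => hl.1.le
  choose p hp using fun x => exists_isGLB_real (hne x) (hb x)
  have hle : ∀ l, IsPos l → ∀ u ∈ U, p (l • u) ≤ l := fun l hl u hu => (hp _).1 ⟨hl, u, hu, rfl⟩
  refine ⟨p, ⟨fun x y => ?_, fun l hl x => ?_⟩, fun x => (hp x).2 (hb x), hle, fun x A hA h => ?_⟩
  · refine le_add_of_isGLB (hp x) (hp y) ?_
    rintro a ⟨ha, u, hu, rfl⟩ b ⟨hb, v, hv, rfl⟩
    obtain ⟨t, ht0, ht1, h1, h2⟩ := exists_convex_weight ha.le hb.le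
    refine (hp _).1 ⟨ha.add hb, _, hconv t ht0 ht1 u hu v hv, ?_⟩
    rw [smul_add, smul_smul, smul_smul, h1, h2]
  · refine le_mul_of_isGLB (hne x) (hp x) hl ?_
    rintro a ⟨ha, u, hu, rfl⟩
    -- `l * a` may vanish and is then not an admissible scalar; `l * a + e` is, and the weight `t ≤
    -- 1` it introduces is absorbed by balancedness.
    refine le_of_forall_isPos_add fun e he => ?_
    have hpos : IsPos (l * a + e) := IsPos.add_nonneg (L0.mul_nonneg hl ha.le) he
    obtain ⟨t, ht0, ht1, h1, -⟩ := exists_convex_weight (L0.mul_nonneg hl ha.le) he.le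
    refine (hp _).1 ⟨hpos, t • u, hbal t ?_ u hu, ?_⟩
    · filter_upwards [ae_nonneg ht0, ae_le_one ht1] with ω h1 h2
      exact abs_le.2 ⟨by linarith, h2⟩
    · rw [smul_smul, smul_smul, h1]
  · obtain ⟨l, ⟨hl, u, hu, rfl⟩, hlt⟩ := exists_lt_on_of_isGLB (hne x) (fun B hB y hy => by
      obtain ⟨z, hz⟩ := hB.exists_concat_real y
      have hzpos : IsPos z := hB.ae_of_forall fun n => by
        filter_upwards [hz n, (hy n).1] with ω h1 h2 hω
        rw [h1 hω]; exact h2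
      obtain ⟨k, hk, hzk, hk'⟩ := exists_inv_of_isPos hzpos
      refine ⟨z, ⟨hzpos, k • x, ?_, by rw [smul_smul, hzk, one_smul]⟩,
        fun n => (hz n).mono fun ω h hω => (h hω).le⟩
      choose u hu hxu using fun n => (hy n).2
      refine hσ B hB u hu _ fun n => ?_
      rw [hxu n, smul_smul, smul_smul, mul_assoc]
      have : ind P (hB.measurable n) * (k * y n) = ind P (hB.measurable n) * 1 := by
        apply ind_mul_eq_of_ae
        filter_upwards [hz n, hk', ae_mul k (y n), ae_one (P := P), hzpos] with ω h1 h2 h3 h4 h5 hω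
        rw [h3, h4, h2, ← h1 hω]
        exact inv_mul_cancel₀ h5.ne'
      rw [← mul_assoc] at this ⊢
      rw [this, mul_one]) (hp x) hA (e := 1) (by
        filter_upwards [h, ae_one (P := P)] with ω h1 h2 hω
        rw [h2]; exact h1 hω)
    rw [smul_smul]
    refine hbal _ ?_ u hu
    filter_upwards [ae_mul (ind P hA) l, ae_ind_of_mem (P := P) hA, ae_ind_of_notMem (P := P) hA,
      hl, hlt, ae_one (P := P)] with ω h1 h2 h3 h4 h5 h6
    rw [h1]
    by_cases hω : ω ∈ A
    · rw [h2 hω, one_mul, abs_of_pos h4]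
      exact (h6 ▸ h5 hω).le
    · rw [h3 hω]; simp

end CondIndex

end

noncomputable section

namespace CondIndex

variable {Ω : Type*} [MeasurableSpace Ω] {P : Measure Ω}
  {X : Type*} [AddCommGroup X] [Module (L0 P) X]

/-! ### The robust representation -/

theorem exists_rat_between {f g : Ω → EReal} {A : Set Ω} (hA : P A ≠ 0)
    (h : ∀ ω ∈ A, f ω < g ω) :
    ∃ q : ℚ, P (A ∩ {ω | f ω < ((q : ℝ) : EReal) ∧ ((q : ℝ) : EReal) < g ω}) ≠ 0 := by
  by_contra hc
  simp only [not_exists, not_not] at hc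
  refine hA (measure_mono_null (fun ω hω => ?_) (measure_iUnion_null hc))
  obtain ⟨q, hq⟩ := EReal.lt_iff_exists_rat_btwn.1 (h ω hω)
  exact Set.mem_iUnion.2 ⟨q, hω, hq⟩

theorem ind_smul_glue {A : Set Ω} (hA : MeasurableSet A) (x y : X) :
    ind P hA • (ind P hA • x + ind P hA.compl • y) = ind P hA • x := by
  have h1 : ind P hA * ind P hA = ind P hA := by
    have := ind_mul_eq_of_ae (P := P) hA (a := ind P hA) (b := 1) (by
      filter_upwards [ae_ind_of_mem (P := P) hA, ae_one (P := P)] with ω h1 h2 hω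
      rw [h1 hω, h2])
    rwa [mul_one] at this
  have h2 : ind P hA * ind P hA.compl = 0 := by
    have := ind_mul_eq_of_ae (P := P) hA (a := ind P hA.compl) (b := 0) (by
      filter_upwards [ae_ind_of_notMem (P := P) hA.compl, ae_zero (P := P)] with ω h1 h2 hω
      rw [h1 (by simpa using hω), h2])
    rwa [mul_zero] at this
  rw [smul_add, smul_smul, smul_smul, h1, h2, zero_smul, add_zero]

theorem IsAssessmentIndex.eq_on {K : Set X} {α : X → Lbar P} (hα : IsAssessmentIndex K α)
    {A : Set Ω} (hA : MeasurableSet A) {x y : X} (h : ind P hA • x = ind P hA • y) :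
    ∀ᵐ ω ∂P, ω ∈ A → α x ω = α y ω := by
  have h1 := hα.isLocal A hA y x
  rw [← h, ← add_smul, ind_add_ind_compl, one_smul] at h1
  filter_upwards [ae_glue_of_mem hA (α y) (α x)] with ω h2 hω
  rw [h1, h2 hω]

theorem ae_map_glue {A : Set Ω} (hA : MeasurableSet A) (f : X →ₗ[L0 P] L0 P) (x y : X) :
    ∀ᵐ ω ∂P, ω ∈ A → f (ind P hA • x + ind P hA.compl • y) ω = f x ω := by
  apply ae_eq_of_ind_mul_eq hA
  rw [← smul_eq_mul, ← map_smul, ind_smul_glue, map_smul, smul_eq_mul]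

theorem IsAssessmentIndex.glue_mem {K : Set X} {α : X → Lbar P} (hα : IsAssessmentIndex K α)
    {A : Set Ω} (hA : MeasurableSet A) {m : Lbar P} {x y : X}
    (hx : ∀ᵐ ω ∂P, ω ∈ A → m ω ≤ α x ω) (hy : m ≤ α y) :
    m ≤ α (ind P hA • x + ind P hA.compl • y) := by
  rw [hα.isLocal A hA x y]
  apply le_of_ae_le
  filter_upwards [ae_glue_of_mem hA (α x) (α y), ae_glue_of_notMem hA (α x) (α y), hx,
    ae_le_of_le hy] with ω h1 h2 h3 h4
  by_cases hω : ω ∈ A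
  · rw [h1 hω]; exact h3 hω
  · rw [h2 hω]; exact h4

variable [IsFiniteMeasure P] [TopologicalSpace X] [IsTopologicalAddGroup X]
  [ContinuousSMul (L0 P) X]

/-- A point at which `α < m` on the nonnull set `A` is separated from `{α ≥ m}` on a nonnull part
of `A` by an element of the polar cone. -/
theorem exists_separating_polarCone (hX : IsConditionallyLocallyConvex P X) {K : Set X}
    (hK : IsConvexCone P K) {α : X → Lbar P} (hα : IsAssessmentIndex K α) (husc : IsUSC α)
    {A : Set Ω} (hA : MeasurableSet A) (hPA : P A ≠ 0) {m : Lbar P} {x x' : X}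
    (hx : ∀ᵐ ω ∂P, ω ∈ A → α x ω < m ω) (hx' : m ≤ α x') :
    ∃ (Z : polarCone (P := P) K) (d : L0 P), P (A ∩ {ω | 0 < d ω}) ≠ 0 ∧
      ∀ c, m ≤ α c → Z.1 x + d ≤ Z.1 c := by
  -- If the gauge distance from `x` to the level set vanished on `A` for every neighbourhood, the
  -- point equal to `x` on `A` and to `x'` off `A` would be in the closed level set.
  obtain ⟨U, hU, p, d, hbal, hp, hple, hd, hdpos⟩ : ∃ U ∈ 𝓝 (0 : X), ∃ (p : X → L0 P) (d : L0 P),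
      L0Balanced P U ∧ IsSublinear p ∧ (∀ l, IsPos l → ∀ u ∈ U, p (l • u) ≤ l) ∧
      (∀ c, m ≤ α c → d ≤ p (c - x)) ∧ P (A ∩ {ω | 0 < d ω}) ≠ 0 := by
    by_contra hcon
    have hmem : ind P hA • x + ind P hA.compl • x' ∈ closure {c | m ≤ α c} := by
      rw [mem_closure_iff_nhds]
      intro W hW
      have hV : {v | ind P hA • x + ind P hA.compl • x' + v ∈ W} ∈ 𝓝 (0 : X) :=
        ContinuousAt.preimage_mem_nhds (by fun_prop) (by simpa using hW)
      obtain ⟨U, hU, hUV, hσ, hconv, habs, hbal⟩ := hX.nhds_base _ hV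
      obtain ⟨p, hp, hp0, hple, hpU⟩ := exists_gauge hσ hconv habs hbal
      let S : Set (L0 P) := {a | ∃ c, m ≤ α c ∧ a = p (c - x)}
      have hSne : S.Nonempty := ⟨_, x', hx', rfl⟩
      obtain ⟨d, hd⟩ := exists_isGLB_real (S := S) hSne (b := 0) (by
        rintro _ ⟨c, -, rfl⟩
        exact hp0 _)
      have hd0 : P (A ∩ {ω | 0 < d ω}) = 0 := by
        by_contra hne
        exact hcon ⟨U, hU, p, d, hbal, hp, hple, fun c hc => hd.1 ⟨c, hc, rfl⟩, hne⟩
      obtain ⟨_, ⟨c, hc, rfl⟩, hlt⟩ := exists_lt_on_of_isGLB hSne (fun B hB y hy => by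
        choose c hc hyc using hy
        obtain ⟨z, hz⟩ := hX.exists_concat B hB c
        refine ⟨_, ⟨z, le_of_ae_le (hB.ae_of_forall fun n => ?_), rfl⟩, fun n => ?_⟩
        · filter_upwards [hα.eq_on (hB.measurable n) (hz n), ae_le_of_le (hc n)] with ω h1 h2 hω
          rw [h1 hω]; exact h2
        · filter_upwards [hp.eq_on (hB.measurable n) (x := z - x) (y := c n - x) (by
            rw [smul_sub, smul_sub, hz n])] with ω h1 hω
          rw [h1 hω, hyc n]) hd hA (e := 1) (by
          filter_upwards [measure_eq_zero_iff_ae_notMem.1 hd0, ae_one (P := P)] with ω h1 h2 hω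
          rw [h2]
          by_contra hlt
          exact h1 ⟨hω, show 0 < d ω by linarith [not_lt.1 hlt]⟩)
      have hcU := hpU (c - x) A hA (by
        filter_upwards [hlt, ae_one (P := P)] with ω h1 h2 hω
        rw [← h2]; exact h1 hω)
      refine ⟨ind P hA • c + ind P hA.compl • x', ?_, hα.glue_mem hA
        ((ae_le_of_le hc).mono fun ω h _ => h) hx'⟩
      have h1 := hUV hcU
      have e : ind P hA • x + ind P hA.compl • x' + ind P hA • (c - x) =
          ind P hA • c + ind P hA.compl • x' := by rw [smul_sub]; abel
      rw [← e]
      exact h1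
    rw [(husc m).closure_eq] at hmem
    obtain ⟨ω, hω, h1, h2, h3⟩ := exists_of_ae_of_measure_ne_zero hPA
      ((ae_le_of_le (show m ≤ α _ from hmem)).and
        ((hα.eq_on hA (ind_smul_glue hA x x')).and hx))
    rw [h2 hω] at h1
    exact absurd (h3 hω) (not_lt.2 h1)
  have hconv : L0Convex P {c | m ≤ α c} := fun l hl0 hl1 y hy z hz =>
    (le_inf hy hz).trans (hα.quasiconcave l hl0 hl1 y z)
  obtain ⟨f, hfp, hf⟩ := hp.exists_linearMap_separating hconv ⟨x', hx'⟩ hd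
  let Z : WeakDual (L0 P) X := (⟨f, continuous_of_le_gauge hU hbal hple hfp⟩ : X →L[L0 P] L0 P)
  have hZ : ∀ y, Z y = f y := fun y => rfl
  refine ⟨⟨Z, fun k hk => nonneg_of_ae ?_⟩, d, hdpos, fun c hc => hf c hc⟩
  -- By monotonicity of `α` the ray `x' + (n + 1) • k` stays in the level set; boundedness of `f`
  -- from below along it forces `f k ≥ 0`.
  have h1 : ∀ n : ℕ, ∀ᵐ ω ∂P, f x ω + d ω ≤ f x' ω + ((n : ℝ) + 1) * f k ω := fun n => by
    obtain ⟨l, hl⟩ := exists_ae_eq_real P (measurable_const (a := (n : ℝ) + 1))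
    have hlpos : IsPos l := hl.mono fun ω h => by rw [h]; positivity
    have h2 := hf (x' + l • k) (hx'.trans (hα.monotone _ _ (by
      rw [add_sub_cancel_left]; exact hK.smul_mem l hlpos k hk)))
    rw [map_add, map_smul, smul_eq_mul] at h2
    filter_upwards [ae_le_of_le h2, ae_add (f x) d, ae_add (f x') (l * f k), ae_mul l (f k), hl]
      with ω h3 h4 h5 h6 h7
    rwa [h4, h5, h6, h7] at h3
  filter_upwards [ae_all_iff.2 h1] with ω h
  rw [hZ]
  by_contra hneg
  rw [not_le] at hneg
  obtain ⟨n, hn⟩ := exists_nat_gt ((f x' ω - f x ω - d ω) / (-f k ω))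
  rw [div_lt_iff₀ (by linarith)] at hn
  have := h n
  nlinarith

theorem robust_minRisk (hX : IsConditionallyLocallyConvex P X) {K : Set X}
    (hK : IsConvexCone P K) {α : X → Lbar P} (hα : IsAssessmentIndex K α) (husc : IsUSC α)
    (x : X) : α x = robust (minRisk (K := K) α) x := by
  refine le_antisymm ((isGLB_essInfSet _).2 ?_) (le_of_ae_le ?_)
  · rintro _ ⟨Z, rfl⟩
    apply le_of_ae_le
    filter_upwards [le_minRisk α Z (toBar (Z.1 x)) x, ae_toBar (Z.1 x)] with ω h1 h2
    exact h1 h2.ge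
  set b := robust (minRisk (K := K) α) x with hb
  refine ae_of_forall_measure_zero
    (measurableSet_le (measurable_coe_Lbar b) (measurable_coe_Lbar (α x))) fun hne hmeas => ?_
  obtain ⟨q, hq⟩ := exists_rat_between hne (f := α x) (g := b) fun ω hω => not_le.1 hω
  set A := {ω | ¬ b ω ≤ α x ω} ∩ {ω | α x ω < ((q : ℝ) : EReal) ∧ ((q : ℝ) : EReal) < b ω}
  have hA : MeasurableSet A := hmeas.inter
    ((measurableSet_lt (measurable_coe_Lbar (α x)) measurable_const).inter
      (measurableSet_lt measurable_const (measurable_coe_Lbar b)))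
  -- The zero functional yields `b ≤ esssup α`, so some `α x'` exceeds `q` on a nonnull part of `A`
  -- and the level set used below is nonempty.
  let Z₀ : polarCone (P := P) K := ⟨0, fun x _ => le_refl (0 : L0 P)⟩
  obtain ⟨_, ⟨x', rfl⟩, hx'⟩ := exists_lt_of_lt_essSupSet (S := Set.range α)
    (m := AEEqFun.const Ω ((q : ℝ) : EReal)) hA hq (by
      filter_upwards [IsRiskFunction.robust_le (minRisk (K := K) α) Z₀ x,
        ae_le_essSupSet (S := Set.range fun s : L0 P => minRisk α Z₀ (toBar s))
          (Set.mem_range_self (Z₀.1 x)), ae_constBar (P := P) ((q : ℝ) : EReal)] with ω h1 h2 h3 hω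
      rw [h3, ← essSupSet_minRisk α Z₀]
      exact hω.2.2.trans_le (h1.trans h2))
  set A₁ := A ∩ {ω | (AEEqFun.const Ω ((q : ℝ) : EReal) : Lbar P) ω < α x' ω}
  have hA₁ : MeasurableSet A₁ := hA.inter
    (measurableSet_lt (measurable_coe_Lbar _) (measurable_coe_Lbar _))
  -- The level `⊥` off `A₁` imposes no condition there, so `x'` satisfies `m ≤ α x'` on all of `Ω`.
  obtain ⟨m, hm⟩ := exists_ae_eq_ereal_cases (P := P) hA₁
    (measurable_const (a := ((q : ℝ) : EReal))) (measurable_const (a := (⊥ : EReal)))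
  have hmx' : m ≤ α x' := by
    apply le_of_ae_le
    filter_upwards [hm, ae_constBar (P := P) ((q : ℝ) : EReal)] with ω h1 h2
    by_cases hω : ω ∈ A₁
    · rw [h1.1 hω, ← h2]; exact hω.2.le
    · rw [h1.2 hω]; exact bot_le
  obtain ⟨Z, d, hd, hZ⟩ := exists_separating_polarCone hX hK hα husc hA₁ hx' (m := m) (x := x)
    (hm.mono fun ω h hω => by rw [h.1 hω]; exact hω.1.2.1) hmx'
  have hA₂ : MeasurableSet (A₁ ∩ {ω | 0 < d ω}) :=
    hA₁.inter (measurableSet_lt measurable_const (measurable_coe_L0 d))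
  -- The separation needs `m ≤ α` globally; a competitor `y` is therefore replaced by `x'` where `α
  -- y < m`.
  have hle := levelSup_le_on (α := α) (Z := Z.1) (s := toBar (Z.1 x + d)) (b := m) hA₂ fun y => by
    have hB : MeasurableSet {ω | m ω ≤ α y ω} :=
      measurableSet_le (measurable_coe_Lbar m) (measurable_coe_Lbar (α y))
    have h1 := hZ _ (hα.glue_mem hB (Eventually.of_forall fun ω hω => hω) hmx')
    filter_upwards [ae_le_of_le h1,
      ae_map_glue hB (ContinuousLinearMap.toLinearMap (Z.1 : X →L[L0 P] L0 P)) y x',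
      ae_toBar (Z.1 x + d)] with ω h2 h3 h4 _ h5
    by_contra hlt
    rw [h4, EReal.coe_lt_coe_iff] at h5
    have h6 : (Z.1 x + d) ω ≤ Z.1 y ω := h2.trans_eq (h3 (not_le.1 hlt).le)
    linarith
  obtain ⟨ω, hω, h1, h2, h3, h4, h5, h6, h7⟩ := exists_of_ae_of_measure_ne_zero hd (hle.and (hm.and
    ((IsRiskFunction.robust_le (minRisk (K := K) α) Z x).and
    (((levelSup_localMono α Z.1).rightVersion_le (toBar (Z.1 x)) (toBar (Z.1 x + d))).and
    ((ae_toBar (Z.1 x)).and ((ae_toBar (Z.1 x + d)).and (ae_add (Z.1 x) d)))))))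
  rw [h2.1 hω.1] at h1
  have h8 : toBar (Z.1 x) ω < toBar (Z.1 x + d) ω := by
    rw [h5, h6, h7, EReal.coe_lt_coe_iff]
    have : 0 < d ω := hω.2
    linarith
  exact absurd (h3.trans ((h4 h8).trans (h1 hω))) (not_le.2 hω.1.1.2.2)

end CondIndex

end

/-! ### The polar cone and the sublevel sets of left versions -/

noncomputable section

namespace CondIndex

variable {Ω : Type*} [MeasurableSpace Ω] {P : Measure Ω}
  {X : Type*} [AddCommGroup X] [Module (L0 P) X]

theorem ae_constReal (c : ℝ) : ∀ᵐ ω ∂P, (AEEqFun.const Ω c : L0 P) ω = c :=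
  AEEqFun.coeFn_const _ c

theorem down_coe_le (k : ℕ) (r : ℝ) :
    down k (r : EReal) ≤ ((r - 1 / ((k : ℝ) + 1) : ℝ) : EReal) := by
  have h : ((-(r - 1 / ((k : ℝ) + 1)) : ℝ) : EReal) ≤ up k (-(r : EReal)) := by
    refine le_max_of_le_left ?_
    rw [← EReal.coe_neg, ← EReal.coe_add, EReal.coe_le_coe_iff]
    linarith
  rw [EReal.coe_neg] at h
  exact EReal.neg_le_of_neg_le h

theorem coe_add_le_up (k : ℕ) (r : ℝ) :
    ((r + 1 / ((k : ℝ) + 1) : ℝ) : EReal) ≤ up k (r : EReal) := by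
  refine le_max_of_le_left ?_
  rw [← EReal.coe_add]

variable [TopologicalSpace X] {K : Set X}

theorem comb_mem_polarCone {l k : L0 P} (hl : 0 ≤ l) (hk : 0 ≤ k) (Z₁ Z₂ : polarCone (P := P) K) :
    l • Z₁.1 + k • Z₂.1 ∈ polarCone (P := P) K := fun x hx => by
  rw [weakDual_comb_apply]
  exact add_nonneg (L0.mul_nonneg hl (Z₁.2 x hx)) (L0.mul_nonneg hk (Z₂.2 x hx))

theorem smul_mem_polarCone {l : L0 P} (hl : 0 ≤ l) (Z : polarCone (P := P) K) :
    l • Z.1 ∈ polarCone (P := P) K := fun x hx => L0.mul_nonneg hl (Z.2 x hx)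

/-- Gluing of elements of `K° × L⁰` along a measurable set. -/
theorem exists_glue_pair {A : Set Ω} (hA : MeasurableSet A) (Z₁ Z₂ : polarCone (P := P) K)
    (s₁ s₂ : L0 P) : ∃ (Z : polarCone (P := P) K) (s : L0 P),
      (∀ x, ∀ᵐ ω ∂P, (ω ∈ A → Z.1 x ω = Z₁.1 x ω) ∧ (ω ∈ Aᶜ → Z.1 x ω = Z₂.1 x ω)) ∧
      ∀ᵐ ω ∂P, (ω ∈ A → s ω = s₁ ω) ∧ (ω ∈ Aᶜ → s ω = s₂ ω) := by
  refine ⟨⟨_, comb_mem_polarCone (ind_nonneg hA) (ind_nonneg hA.compl) Z₁ Z₂⟩,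
    ind P hA * s₁ + ind P hA.compl * s₂, fun x => ?_, ?_⟩
  · simp only [weakDual_comb_apply]
    filter_upwards [ae_add (ind P hA * Z₁.1 x) (ind P hA.compl * Z₂.1 x),
      ae_mul (ind P hA) (Z₁.1 x), ae_mul (ind P hA.compl) (Z₂.1 x), ae_ind_of_mem (P := P) hA,
      ae_ind_of_notMem (P := P) hA, ae_ind_of_mem (P := P) hA.compl,
      ae_ind_of_notMem (P := P) hA.compl] with ω h1 h2 h3 h4 h5 h6 h7
    rw [h1, h2, h3]
    refine ⟨fun hω => ?_, fun hω => ?_⟩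
    · rw [h4 hω, h7 (by simpa using hω)]; ring
    · rw [h5 hω, h6 hω]; ring
  · filter_upwards [ae_add (ind P hA * s₁) (ind P hA.compl * s₂),
      ae_mul (ind P hA) s₁, ae_mul (ind P hA.compl) s₂, ae_ind_of_mem (P := P) hA,
      ae_ind_of_notMem (P := P) hA, ae_ind_of_mem (P := P) hA.compl,
      ae_ind_of_notMem (P := P) hA.compl] with ω h1 h2 h3 h4 h5 h6 h7
    rw [h1, h2, h3]
    refine ⟨fun hω => ?_, fun hω => ?_⟩
    · rw [h4 hω, h7 (by simpa using hω)]; ring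
    · rw [h5 hω, h6 hω]; ring

/-- The polar cone is stable under concatenation along countable partitions. -/
theorem exists_concat_polarCone [IsTopologicalAddGroup X]
    (hX : IsConditionallyLocallyConvex P X) {A : ℕ → Set Ω}
    (hA : IsPartition A) (Z : ℕ → polarCone (P := P) K) :
    ∃ Z' : polarCone (P := P) K, ∀ n x, ∀ᵐ ω ∂P, ω ∈ A n → Z'.1 x ω = (Z n).1 x ω := by
  choose F hF using fun x => hA.exists_concat_real fun n => (Z n).1 x
  let f : X →ₗ[L0 P] L0 P :=
    { toFun := F
      map_add' := fun x y => AEEqFun.ext <| hA.ae_of_forall fun n => by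
        have e := ae_add ((Z n).1 x) ((Z n).1 y)
        rw [← map_add] at e
        filter_upwards [hF x n, hF y n, hF (x + y) n, ae_add (F x) (F y), e]
          with ω h1 h2 h3 h4 h5 hω
        rw [h3 hω, h4, h1 hω, h2 hω, h5]
      map_smul' := fun l x => AEEqFun.ext <| hA.ae_of_forall fun n => by
        have e := ae_mul l ((Z n).1 x)
        rw [← smul_eq_mul, ← map_smul] at e
        filter_upwards [hF x n, hF (l • x) n, ae_mul l (F x), e] with ω h1 h2 h3 h4 hω
        rw [RingHom.id_apply, smul_eq_mul, h2 hω, h3, h1 hω, h4] }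
  -- Preimages of one ball under the `Z n` are concatenated into a neighbourhood of zero, which `f`
  -- maps into that ball.
  have hc : Continuous f := by
    refine continuous_of_continuousAt_zero f ?_
    rw [ContinuousAt, map_zero]
    intro V hV
    obtain ⟨e, he, heV⟩ := (mem_nhds_iff_ball _ _).1 hV
    have hU : ∀ n, {x : X | (Z n).1 x ∈ ball 0 e} ∈ 𝓝 (0 : X) := fun n => by
      have h1 : ContinuousAt (fun x => (Z n).1 x) 0 :=
        (ContinuousLinearMap.continuous ((Z n).1 : X →L[L0 P] L0 P)).continuousAt
      refine h1.preimage_mem_nhds ((mem_nhds_iff_ball _ _).2 ⟨e, he, ?_⟩)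
      rw [map_zero]
    rw [mem_map]
    filter_upwards [hX.nhds_concat A hA _ hU]
    rintro y ⟨x, hx, hy⟩
    refine heV (mem_ball_zero.2 (hA.ae_of_forall fun n => ?_))
    have h1 : ∀ᵐ ω ∂P, ω ∈ A n → (Z n).1 y ω = (Z n).1 (x n) ω := by
      apply ae_eq_of_ind_mul_eq (hA.measurable n)
      rw [← smul_eq_mul, ← smul_eq_mul, ← map_smul, ← map_smul, hy n]
    filter_upwards [hF y n, h1, mem_ball_zero.1 (hx n)] with ω h2 h3 h4 hω
    have : f y ω = (Z n).1 (x n) ω := (h2 hω).trans (h3 hω)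
    rwa [this]
  refine ⟨⟨(⟨f, hc⟩ : X →L[L0 P] L0 P), fun x hx => nonneg_of_ae (hA.ae_of_forall fun n => ?_)⟩,
    fun n x => hF x n⟩
  filter_upwards [hF x n, ae_nonneg ((Z n).2 x hx)] with ω h1 h2 hω
  exact h2.trans_eq (h1 hω).symm

theorem exists_pos_ball_subset {ι : Type*} (F : Finset ι) (g : ι → L0 P) (V : ι → Set (L0 P))
    (hV : ∀ x ∈ F, V x ∈ 𝓝 (g x)) (e₀ : L0 P) (he₀ : IsPos e₀) :
    ∃ e, IsPos e ∧ e ≤ e₀ ∧ ∀ x ∈ F, ball (g x) e ⊆ V x := by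
  classical
  induction F using Finset.induction_on with
  | empty => exact ⟨e₀, he₀, le_rfl, by simp⟩
  | insert a F ha ih =>
    obtain ⟨e, he, hle, h⟩ := ih fun x hx => hV x (Finset.mem_insert_of_mem hx)
    obtain ⟨e', he', h'⟩ := (mem_nhds_iff_ball _ _).1 (hV a (Finset.mem_insert_self a F))
    have hb : ∀ {c d : L0 P} (y : L0 P), c ≤ d → ball y c ⊆ ball y d := fun y hcd n hn => by
      filter_upwards [hn, ae_le_of_le hcd] with ω h1 h2
      exact h1.trans h2
    refine ⟨e ⊓ e', ?_, inf_le_left.trans hle, fun x hx => ?_⟩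
    · filter_upwards [he, he', AEEqFun.coeFn_inf e e'] with ω h1 h2 h3
      rw [h3]
      exact lt_min h1 h2
    · rcases Finset.mem_insert.1 hx with rfl | hx
      · exact (hb _ inf_le_right).trans h'
      · exact (hb _ inf_le_left).trans (h x hx)

/-- Basic neighbourhoods in `K° × L⁰` for the weak topology. -/
theorem exists_finset_of_mem_nhds {Z : polarCone (P := P) K} {s : L0 P}
    {W : Set (polarCone (P := P) K × L0 P)} (hW : W ∈ 𝓝 (Z, s)) :
    ∃ (F : Finset X) (e : L0 P), IsPos e ∧ ∀ (Z' : polarCone (P := P) K) (s' : L0 P),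
      (∀ x ∈ F, Z'.1 x ∈ ball (Z.1 x) e) → s' ∈ ball s e → (Z', s') ∈ W := by
  obtain ⟨u, hu, v, hv, huv⟩ := mem_nhds_prod_iff.1 hW
  obtain ⟨u', hu', hsub⟩ := (mem_nhds_subtype _ _ _).1 hu
  have hind : 𝓝 Z.1 = comap (fun (Y : WeakDual (L0 P) X) (x : X) => Y x) (𝓝 fun x => Z.1 x) :=
    nhds_induced _ _
  rw [hind, mem_comap] at hu'
  obtain ⟨t, ht, htu⟩ := hu'
  rw [nhds_pi, Filter.mem_pi] at ht
  obtain ⟨I, hI, V, hV, hIV⟩ := ht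
  obtain ⟨e₀, he₀, hev⟩ := (mem_nhds_iff_ball _ _).1 hv
  obtain ⟨e, he, hle, heV⟩ := exists_pos_ball_subset hI.toFinset (fun x => Z.1 x) V
    (fun x _ => hV x) e₀ he₀
  refine ⟨hI.toFinset, e, he, fun Z' s' h1 h2 => huv ⟨hsub (htu (hIV fun x hx => ?_)), hev ?_⟩⟩
  · exact heV x (hI.mem_toFinset.2 hx) (h1 x (hI.mem_toFinset.2 hx))
  · filter_upwards [h2, ae_le_of_le hle] with ω h3 h4
    exact h3.trans h4

/-! ### Left-continuous versions of risk functions -/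

variable [IsFiniteMeasure P] {R : polarCone (P := P) K → Lbar P → Lbar P}

theorem IsRiskFunction.leftVersion_le_on (hR : IsRiskFunction R) {A : Set Ω}
    (hA : MeasurableSet A) {Z Z' : polarCone (P := P) K}
    (hZ : ∀ x, ∀ᵐ ω ∂P, ω ∈ A → Z.1 x ω = Z'.1 x ω) {s t : L0 P}
    (hst : ∀ᵐ ω ∂P, ω ∈ A → s ω ≤ t ω) :
    ∀ᵐ ω ∂P, ω ∈ A → leftVersion (R Z) (toBar s) ω ≤ leftVersion (R Z') (toBar t) ω := by
  filter_upwards [(hR.localMono Z).leftVersion_le (toBar s),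
    ae_all_iff.2 fun k => hR.eq_on hA hZ (downBar k (toBar s)),
    ae_all_iff.2 fun k => (hR.localMono Z').le_leftVersion (toBar t) (downBar k (toBar s)),
    ae_downBar (toBar s), ae_toBar s, ae_toBar t, hst] with ω h1 h2 h3 h4 h5 h6 h7 hω
  refine h1.trans (iSup_le fun k => ?_)
  rw [h2 k hω]
  refine h3 k ?_
  rw [h4, h5, h6]
  exact (down_lt k (EReal.bot_lt_coe _)).trans_le (by exact_mod_cast h7 hω)

/-- This is what makes `{R⁻ ≤ m}` stable under positive scaling of the pair `(Z, s)`. -/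
theorem IsMinimalRiskFunction.leftVersion_smul_le (hR : IsMinimalRiskFunction R) {l : L0 P}
    (hl : IsPos l) {Z Z' : polarCone (P := P) K} (hZ : Z'.1 = l • Z.1) (s : L0 P) :
    ∀ᵐ ω ∂P, leftVersion (R Z') (toBar (l * s)) ω ≤ leftVersion (R Z) (toBar s) ω := by
  have hloc := hR.toIsRiskFunction.localMono
  filter_upwards [(hloc Z').leftVersion_le (toBar (l * s)), ae_downBar (toBar (l * s)), hl,
    ae_toBar (l * s), ae_toBar s, ae_mul l s,
    ae_all_iff.2 fun k => ae_divBar (downBar k (toBar (l * s))) l,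
    ae_all_iff.2 fun k => (hloc Z).le_leftVersion (toBar s) (divBar (downBar k (toBar (l * s))) l)]
    with ω h1 h2 h3 h4 h5 h6 h7 h8
  refine h1.trans (iSup_le fun k => ?_)
  rw [hR.scaling l hl Z Z' hZ]
  refine h8 k ?_
  have h9 := ereal_mul_inv_lt_mul_inv h3 (down_lt k (EReal.bot_lt_coe (l ω * s ω)))
  rw [h7, h2, h4, h5, h6]
  refine h9.trans_eq ?_
  rw [← EReal.coe_mul]
  congr 1
  field_simp

/-- Lowering both `s` and `t` by the same constant `1 / (k + 1)` lowers the combination by exactly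
that constant, which keeps it above `down k`; quasiconvexity of `R` then applies. -/
theorem IsMinimalRiskFunction.leftVersion_comb_le (hR : IsMinimalRiskFunction R) {l : L0 P}
    (hl0 : 0 ≤ l) (hl1 : l ≤ 1) {Z₁ Z₂ Z : polarCone (P := P) K}
    (hZ : Z.1 = l • Z₁.1 + (1 - l) • Z₂.1) (s t : L0 P) :
    ∀ᵐ ω ∂P, leftVersion (R Z) (toBar (l * s + (1 - l) * t)) ω ≤
      leftVersion (R Z₁) (toBar s) ω ⊔ leftVersion (R Z₂) (toBar t) ω := by
  have hloc := hR.toIsRiskFunction.localMono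
  let c : ℕ → L0 P := fun k => AEEqFun.const Ω (1 / ((k : ℝ) + 1))
  have hc : ∀ᵐ ω ∂P, ∀ k, c k ω = 1 / ((k : ℝ) + 1) := ae_all_iff.2 fun k => ae_constReal _
  have hq : ∀ᵐ ω ∂P, ∀ k,
      R Z (combBar l (toBar (s - c k)) (1 - l) (toBar (t - c k))) ω ≤
        R Z₁ (toBar (s - c k)) ω ⊔ R Z₂ (toBar (t - c k)) ω := ae_all_iff.2 fun k => by
    filter_upwards [ae_le_of_le (hR.quasiconvex l hl0 hl1 Z₁ Z₂ Z hZ (toBar (s - c k))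
      (toBar (t - c k))), AEEqFun.coeFn_sup (R Z₁ (toBar (s - c k))) (R Z₂ (toBar (t - c k)))]
      with ω h1 h2
    rwa [h2] at h1
  set u := l * s + (1 - l) * t
  have hu : ∀ᵐ ω ∂P, u ω = l ω * s ω + (1 - l ω) * t ω := by
    filter_upwards [ae_add (l * s) ((1 - l) * t), ae_mul l s, ae_mul (1 - l) t, ae_sub 1 l,
      ae_one (P := P)] with ω h1 h2 h3 h4 h5
    rw [h1, h2, h3, h4, h5]
  have hcomb : ∀ᵐ ω ∂P, ∀ k, downBar k (toBar u) ω ≤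
      combBar l (toBar (s - c k)) (1 - l) (toBar (t - c k)) ω := ae_all_iff.2 fun k => by
    filter_upwards [ae_downBar (toBar u), ae_toBar u, hu, hc, ae_toBar (s - c k),
      ae_toBar (t - c k), ae_sub s (c k), ae_sub t (c k), ae_sub 1 l, ae_one (P := P),
      ae_combBar l (toBar (s - c k)) (1 - l) (toBar (t - c k))]
      with ω h1 h2 h3 h4 h5 h6 h7 h8 h9 h10 h11
    rw [h1, h2, h11, h5, h6, h7, h8, h9, h10, h3, h4, ← EReal.coe_mul, ← EReal.coe_mul,
      ← EReal.coe_add]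
    refine (down_coe_le k _).trans_eq ?_
    congr 1
    ring
  filter_upwards [(hloc Z).leftVersion_le (toBar u), hq, hcomb, hc, ae_toBar s, ae_toBar t,
    ae_all_iff.2 fun k => hloc Z (downBar k (toBar u))
      (combBar l (toBar (s - c k)) (1 - l) (toBar (t - c k))),
    ae_all_iff.2 fun k => (hloc Z₁).le_leftVersion (toBar s) (toBar (s - c k)),
    ae_all_iff.2 fun k => (hloc Z₂).le_leftVersion (toBar t) (toBar (t - c k)),
    ae_all_iff.2 fun k => ae_toBar (s - c k), ae_all_iff.2 fun k => ae_toBar (t - c k),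
    ae_all_iff.2 fun k => ae_sub s (c k), ae_all_iff.2 fun k => ae_sub t (c k)]
    with ω h1 h2 h3 h4 h5 h6 h7 h8 h9 h10 h11 h12 h13
  refine h1.trans (iSup_le fun k => (h7 k (h3 k)).trans ((h2 k).trans
    (sup_le_sup (h8 k ?_) (h9 k ?_))))
  · rw [h5, h10, h12, h4, EReal.coe_lt_coe_iff]
    have : 0 < 1 / ((k : ℝ) + 1) := by positivity
    linarith
  · rw [h6, h11, h13, h4, EReal.coe_lt_coe_iff]
    have : 0 < 1 / ((k : ℝ) + 1) := by positivity
    linarith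

/-- The left-continuous version at `(0, 1)` dominates all other values. -/
theorem IsMinimalRiskFunction.leftVersion_le_zero_one (hR : IsMinimalRiskFunction R)
    {Z₀ : polarCone (P := P) K} (hZ₀ : Z₀.1 = 0) (Z : polarCone (P := P) K) (s : L0 P) :
    ∀ᵐ ω ∂P, leftVersion (R Z) (toBar s) ω ≤ leftVersion (R Z₀) (toBar 1) ω := by
  have hloc := hR.toIsRiskFunction.localMono
  have h0 : essSupSet (Set.range fun s : L0 P => R Z₀ (toBar s)) ≤
      leftVersion (R Z₀) (toBar 1) := by
    refine (isLUB_essSupSet _).2 ?_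
    rintro _ ⟨t, rfl⟩
    -- Since `l • 0 = 0`, scaling gives `R⁻(0, l) ≤ R⁻(0, 1)`, and `l > t` gives `R(0, t) ≤ R⁻(0,
    -- l)`.
    obtain ⟨l, hl⟩ := exists_ae_eq_real P (f := fun ω => |t ω| + 1)
      ((measurable_coe_L0 t).abs.add_const 1)
    have hlpos : IsPos l := hl.mono fun ω h => by rw [h]; positivity
    apply le_of_ae_le
    have h1 := hR.leftVersion_smul_le hlpos (Z := Z₀) (Z' := Z₀) (by rw [hZ₀, smul_zero]) 1
    rw [mul_one] at h1
    filter_upwards [h1, (hloc Z₀).le_leftVersion (toBar l) (toBar t), ae_toBar l, ae_toBar t, hl]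
      with ω h1 h2 h3 h4 h5
    refine (h2 ?_).trans h1
    rw [h3, h4, h5, EReal.coe_lt_coe_iff]
    linarith [le_abs_self (t ω)]
  rw [← hR.asymptoticMax Z Z₀] at h0
  filter_upwards [ae_le_of_le h0, (hloc Z).leftVersion_le_self (toBar s),
    ae_le_essSupSet (S := Set.range fun s : L0 P => R Z (toBar s)) (Set.mem_range_self s)]
    with ω h1 h2 h3
  exact h2.trans (h3.trans h1)

end CondIndex

end

noncomputable section

namespace CondIndex

variable {Ω : Type*} [MeasurableSpace Ω] {P : Measure Ω}

/-! ### Separation in the dual pair -/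

theorem L0.abs_add_le (a b : L0 P) : |a + b| ≤ |a| + |b| := by
  apply le_of_ae_le
  filter_upwards [AEEqFun.coeFn_abs a, AEEqFun.coeFn_abs b, AEEqFun.coeFn_abs (a + b),
    ae_add a b, ae_add |a| |b|] with ω h1 h2 h3 h4 h5
  rw [h3, h5, h1, h2, h4]
  exact _root_.abs_add_le _ _

theorem L0.abs_mul_le {l : L0 P} (hl : 0 ≤ l) (a : L0 P) : |l * a| ≤ l * |a| := by
  apply le_of_ae_le
  filter_upwards [AEEqFun.coeFn_abs a, AEEqFun.coeFn_abs (l * a), ae_mul l a, ae_mul l |a|,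
    ae_nonneg hl] with ω h1 h2 h3 h4 h5
  rw [h2, h3, h4, h1, abs_mul, abs_of_nonneg h5]

theorem L0.abs_nonneg (a : L0 P) : 0 ≤ |a| := by
  apply nonneg_of_ae
  filter_upwards [AEEqFun.coeFn_abs a] with ω h1
  rw [h1]
  exact _root_.abs_nonneg _

/-- The sum norm on `(L⁰)ᶠ × L⁰`. -/
def sumNorm {ι : Type*} [Fintype ι] (v : (ι → L0 P) × L0 P) : L0 P := ∑ i, |v.1 i| + |v.2|

section SumNorm

variable {ι : Type*} [Fintype ι]

theorem sumNorm_isSublinear : IsSublinear (sumNorm (P := P) (ι := ι)) where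
  add_le v w := by
    unfold sumNorm
    calc ∑ i, |v.1 i + w.1 i| + |v.2 + w.2|
        ≤ ∑ i, (|v.1 i| + |w.1 i|) + (|v.2| + |w.2|) :=
          add_le_add (Finset.sum_le_sum fun i _ => L0.abs_add_le _ _) (L0.abs_add_le _ _)
      _ = _ := by rw [Finset.sum_add_distrib]; abel
  smul_le l hl v := by
    unfold sumNorm
    calc ∑ i, |l * v.1 i| + |l * v.2|
        ≤ ∑ i, l * |v.1 i| + l * |v.2| :=
          add_le_add (Finset.sum_le_sum fun i _ => L0.abs_mul_le hl _) (L0.abs_mul_le hl _)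
      _ = _ := by rw [mul_add, Finset.mul_sum]

theorem sumNorm_nonneg (v : (ι → L0 P) × L0 P) : 0 ≤ sumNorm v :=
  add_nonneg (Finset.sum_nonneg fun _ _ => L0.abs_nonneg _) (L0.abs_nonneg _)

theorem abs_fst_le_sumNorm (v : (ι → L0 P) × L0 P) (i : ι) : |v.1 i| ≤ sumNorm v :=
  (Finset.single_le_sum (f := fun i => |v.1 i|) (fun _ _ => L0.abs_nonneg _)
    (Finset.mem_univ i)).trans (le_add_of_nonneg_right (L0.abs_nonneg _))

theorem abs_snd_le_sumNorm (v : (ι → L0 P) × L0 P) : |v.2| ≤ sumNorm v :=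
  le_add_of_nonneg_left (Finset.sum_nonneg fun _ _ => L0.abs_nonneg _)

/-- If `v = w` on `A`, coordinatewise, then the norms agree on `A`. -/
theorem sumNorm_eq_on {A : Set Ω} (hA : MeasurableSet A) {v w : (ι → L0 P) × L0 P}
    (h1 : ∀ i, ∀ᵐ ω ∂P, ω ∈ A → v.1 i ω = w.1 i ω) (h2 : ∀ᵐ ω ∂P, ω ∈ A → v.2 ω = w.2 ω) :
    ∀ᵐ ω ∂P, ω ∈ A → sumNorm v ω = sumNorm w ω := by
  refine sumNorm_isSublinear.eq_on hA (Prod.ext (funext fun i => ?_) ?_)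
  · exact ind_mul_eq_of_ae hA (h1 i)
  · exact ind_mul_eq_of_ae hA h2

end SumNorm

variable {X : Type*} [AddCommGroup X] [Module (L0 P) X] [TopologicalSpace X] {K : Set X}

/-- Evaluation of `(Z, s)` at a finite family. -/
def evalPair (F : Finset X) (Z : polarCone (P := P) K) (s : L0 P) : (F → L0 P) × L0 P :=
  (fun x => Z.1 x.1, s)

/-- A linear functional of finitely many evaluations is an evaluation. -/
theorem exists_linearMap_evalPair_eq (F : Finset X) (f : ((F → L0 P) × L0 P) →ₗ[L0 P] L0 P) :
    ∃ (x : X) (β : L0 P), ∀ (Z : polarCone (P := P) K) (s : L0 P),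
      f (evalPair F Z s) = Z.1 x + β * s := by
  classical
  refine ⟨∑ i : F, f (fun j => if i = j then 1 else 0, 0) • i.1, f (0, 1), fun Z s => ?_⟩
  have h1 : evalPair F Z s = LinearMap.inl (L0 P) _ _ (fun x : F => Z.1 x.1) +
      s • ((0, 1) : (F → L0 P) × L0 P) := by
    refine Prod.ext (funext fun i => ?_) ?_
    · simp [evalPair]
    · simp [evalPair]
  have h2 := LinearMap.pi_apply_eq_sum_univ (f ∘ₗ LinearMap.inl (L0 P) (F → L0 P) (L0 P))
    (fun x : F => Z.1 x.1)
  rw [h1, map_add, map_smul, smul_eq_mul, mul_comm s, ← LinearMap.comp_apply, h2, map_sum]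
  congr 1
  refine Finset.sum_congr rfl fun i _ => ?_
  rw [map_smul, smul_eq_mul, smul_eq_mul, mul_comm]
  rfl

variable [IsFiniteMeasure P] [IsTopologicalAddGroup X]
  {R : polarCone (P := P) K → Lbar P → Lbar P}

/-- A pair outside of `{R⁻ ≤ m}` on the nonnull set `A` has, on a nonnull part of `A`, positive
distance to it in finitely many evaluations. -/
theorem IsMinimalRiskFunction.exists_sumNorm_ge (hX : IsConditionallyLocallyConvex P X)
    (hR : IsMinimalRiskFunction R) {A : Set Ω} (hA : MeasurableSet A) (hPA : P A ≠ 0) {m : Lbar P}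
    {Z₀ Z₁ : polarCone (P := P) K} {s₀ s₁ : L0 P}
    (h0 : ∀ᵐ ω ∂P, ω ∈ A → m ω < leftVersion (R Z₀) (toBar s₀) ω)
    (h1 : leftVersion (R Z₁) (toBar s₁) ≤ m) :
    ∃ (F : Finset X) (d : L0 P), P (A ∩ {ω | 0 < d ω}) ≠ 0 ∧
      ∀ Z s, leftVersion (R Z) (toBar s) ≤ m →
        d ≤ sumNorm (evalPair F Z s - evalPair F Z₀ s₀) := by
  by_contra hcon
  obtain ⟨Z₂, s₂, hZ₂, hs₂⟩ := exists_glue_pair hA Z₀ Z₁ s₀ s₁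
  -- Otherwise the pair equal to `(Z₀, s₀)` on `A` and to `(Z₁, s₁)` off `A` would belong to the
  -- closed set `{R⁻ ≤ m}`.
  have hmem : (Z₂, s₂) ∈ closure {p : polarCone (P := P) K × L0 P |
      leftVersion (R p.1) (toBar p.2) ≤ m} := by
    rw [mem_closure_iff_nhds]
    intro W hW
    obtain ⟨F, e, he, hFW⟩ := exists_finset_of_mem_nhds hW
    let S : Set (L0 P) := {a | ∃ Z s, leftVersion (R Z) (toBar s) ≤ m ∧
      a = sumNorm (evalPair F Z s - evalPair F Z₀ s₀)}
    have hSne : S.Nonempty := ⟨_, Z₁, s₁, h1, rfl⟩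
    obtain ⟨d, hd⟩ := exists_isGLB_real (S := S) hSne (b := 0) (by
      rintro _ ⟨Z, s, -, rfl⟩
      exact sumNorm_nonneg _)
    have hd0 : P (A ∩ {ω | 0 < d ω}) = 0 := by
      by_contra hne
      exact hcon ⟨F, d, hne, fun Z s h => hd.1 ⟨Z, s, h, rfl⟩⟩
    obtain ⟨_, ⟨Z, s, hZs, rfl⟩, hlt⟩ := exists_lt_on_of_isGLB hSne (fun B hB y hy => by
      choose Z s hZs hy' using hy
      obtain ⟨Z', hZ'⟩ := exists_concat_polarCone hX hB Z
      obtain ⟨s', hs'⟩ := hB.exists_concat_real s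
      refine ⟨_, ⟨Z', s', le_of_ae_le (hB.ae_of_forall fun n => ?_), rfl⟩, fun n => ?_⟩
      · filter_upwards [hR.toIsRiskFunction.leftVersion_le_on (hB.measurable n) (hZ' n)
          ((hs' n).mono fun ω h hω => (h hω).le), ae_le_of_le (hZs n)] with ω h1 h2 hω
        exact (h1 hω).trans h2
      · rw [hy' n]
        filter_upwards [sumNorm_eq_on (hB.measurable n)
          (v := evalPair F Z' s' - evalPair F Z₀ s₀)
          (w := evalPair F (Z n) (s n) - evalPair F Z₀ s₀)
          (fun i => by
            filter_upwards [hZ' n i.1, ae_sub (Z'.1 i.1) (Z₀.1 i.1),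
              ae_sub ((Z n).1 i.1) (Z₀.1 i.1)] with ω h1 h2 h3 hω
            exact h2.trans ((congrArg (· - _) (h1 hω)).trans h3.symm))
          (by
            filter_upwards [hs' n, ae_sub s' s₀, ae_sub (s n) s₀] with ω h1 h2 h3 hω
            exact h2.trans ((congrArg (· - _) (h1 hω)).trans h3.symm))] with ω h1 hω
        exact (h1 hω).le) hd hA (e := e) (by
        filter_upwards [measure_eq_zero_iff_ae_notMem.1 hd0, he] with ω h1 h2 hω
        by_contra hlt
        exact h1 ⟨hω, show 0 < d ω by linarith [not_lt.1 hlt]⟩)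
    obtain ⟨Z₃, s₃, hZ₃, hs₃⟩ := exists_glue_pair hA Z Z₁ s s₁
    refine ⟨(Z₃, s₃), hFW Z₃ s₃ (fun x hx => ?_) ?_, ?_⟩
    · filter_upwards [hZ₃ x, hZ₂ x, hlt, he, ae_sub (Z.1 x) (Z₀.1 x),
        ae_le_of_le (abs_fst_le_sumNorm (evalPair F Z s - evalPair F Z₀ s₀) ⟨x, hx⟩),
        AEEqFun.coeFn_abs (Z.1 x - Z₀.1 x)] with ω h1 h2 h3 h4 h5 h6 h7
      by_cases hω : ω ∈ A
      · have h8 : |Z.1 x - Z₀.1 x| ω ≤ _ := h6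
        rw [h7, h5] at h8
        rw [h1.1 hω, h2.1 hω, abs_sub_comm]
        exact h8.trans (h3 hω).le
      · rw [h1.2 hω, h2.2 hω, sub_self, abs_zero]
        exact h4.le
    · filter_upwards [hs₃, hs₂, hlt, he, ae_sub s s₀,
        ae_le_of_le (abs_snd_le_sumNorm (evalPair F Z s - evalPair F Z₀ s₀)),
        AEEqFun.coeFn_abs (s - s₀)] with ω h1 h2 h3 h4 h5 h6 h7
      by_cases hω : ω ∈ A
      · have h8 : |s - s₀| ω ≤ _ := h6
        rw [h7, h5] at h8
        rw [h1.1 hω, h2.1 hω, abs_sub_comm]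
        exact h8.trans (h3 hω).le
      · rw [h1.2 hω, h2.2 hω, sub_self, abs_zero]
        exact h4.le
    · refine le_of_ae_le ?_
      filter_upwards [hR.toIsRiskFunction.leftVersion_le_on hA
          (fun x => (hZ₃ x).mono fun ω h => h.1) (hs₃.mono fun ω h hω => (h.1 hω).le),
        hR.toIsRiskFunction.leftVersion_le_on hA.compl
          (fun x => (hZ₃ x).mono fun ω h => h.2) (hs₃.mono fun ω h hω => (h.2 hω).le),
        ae_le_of_le hZs, ae_le_of_le h1] with ω h1 h2 h3 h4
      by_cases hω : ω ∈ A
      · exact (h1 hω).trans h3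
      · exact (h2 hω).trans h4
  rw [(hR.lsc m).closure_eq] at hmem
  obtain ⟨ω, hω, h2, h3, h4⟩ := exists_of_ae_of_measure_ne_zero hPA
    ((ae_le_of_le (show leftVersion (R Z₂) (toBar s₂) ≤ m from hmem)).and
      ((hR.toIsRiskFunction.leftVersion_le_on hA
        (fun x => (hZ₂ x).mono fun ω h hω => (h.1 hω).symm)
        (hs₂.mono fun ω h hω => (h.1 hω).ge)).and h0))
  exact absurd ((h3 hω).trans h2) (not_le.2 (h4 hω))

/-- Finitely many evaluations carry the problem into a finite free module with the sum norm. There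
each linear functional is a combination of coordinates, hence is evaluation at some `x` plus `β s`.
-/
theorem IsMinimalRiskFunction.exists_affine_separating (hX : IsConditionallyLocallyConvex P X)
    (hR : IsMinimalRiskFunction R) {A : Set Ω} (hA : MeasurableSet A) (hPA : P A ≠ 0) {m : Lbar P}
    {Z₀ Z₁ : polarCone (P := P) K} {s₀ s₁ : L0 P}
    (h0 : ∀ᵐ ω ∂P, ω ∈ A → m ω < leftVersion (R Z₀) (toBar s₀) ω)
    (h1 : ∀ᵐ ω ∂P, ω ∈ A → leftVersion (R Z₁) (toBar s₁) ω ≤ m ω) :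
    ∃ (x : X) (β d : L0 P), P (A ∩ {ω | 0 < d ω}) ≠ 0 ∧ ∀ Z s, ∀ᵐ ω ∂P, ω ∈ A →
      leftVersion (R Z) (toBar s) ω ≤ m ω →
        Z₀.1 x ω + β ω * s₀ ω + d ω ≤ Z.1 x ω + β ω * s ω := by
  obtain ⟨m', hm'⟩ := exists_ae_eq_ereal_cases (P := P) hA (measurable_coe_Lbar m)
    (measurable_const (a := (⊤ : EReal)))
  have h1' : leftVersion (R Z₁) (toBar s₁) ≤ m' := by
    apply le_of_ae_le
    filter_upwards [hm', h1] with ω h2 h3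
    by_cases hω : ω ∈ A
    · rw [h2.1 hω]; exact h3 hω
    · rw [h2.2 hω]; exact le_top
  obtain ⟨F, d, hd, hdle⟩ := hR.exists_sumNorm_ge hX hA hPA (m := m') (Z₀ := Z₀) (s₀ := s₀) (by
    filter_upwards [h0, hm'] with ω h2 h3 hω
    rw [h3.1 hω]; exact h2 hω) h1'
  let C : Set ((F → L0 P) × L0 P) :=
    {v | ∃ Z s, leftVersion (R Z) (toBar s) ≤ m' ∧ v = evalPair F Z s}
  have hC : L0Convex P C := by
    rintro l hl0 hl1 _ ⟨Z, s, hZ, rfl⟩ _ ⟨Z', s', hZ', rfl⟩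
    let Y : polarCone (P := P) K := ⟨_, comb_mem_polarCone hl0 (sub_nonneg.2 hl1) Z Z'⟩
    refine ⟨Y, l * s + (1 - l) * s', le_of_ae_le ?_, rfl⟩
    filter_upwards [hR.leftVersion_comb_le hl0 hl1 (Z := Y) rfl s s', ae_le_of_le hZ,
      ae_le_of_le hZ'] with ω h2 h3 h4
    exact h2.trans (sup_le h3 h4)
  obtain ⟨f, -, hf⟩ := sumNorm_isSublinear.exists_linearMap_separating hC ⟨_, Z₁, s₁, h1', rfl⟩
    (x₀ := evalPair F Z₀ s₀) (d := d) (by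
      rintro _ ⟨Z, s, hZ, rfl⟩
      exact hdle Z s hZ)
  obtain ⟨x, β, hxβ⟩ := exists_linearMap_evalPair_eq (K := K) F f
  refine ⟨x, β, d, hd, fun Z s => ?_⟩
  have hB : MeasurableSet {ω | leftVersion (R Z) (toBar s) ω ≤ m' ω} :=
    measurableSet_le (measurable_coe_Lbar _) (measurable_coe_Lbar _)
  obtain ⟨Z₂, s₂, hZ₂, hs₂⟩ := exists_glue_pair hB Z Z₁ s s₁
  have h2 := hf _ ⟨Z₂, s₂, le_of_ae_le (by
    filter_upwards [hR.toIsRiskFunction.leftVersion_le_on hB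
        (fun x => (hZ₂ x).mono fun ω h => h.1) (hs₂.mono fun ω h hω => (h.1 hω).le),
      hR.toIsRiskFunction.leftVersion_le_on hB.compl
        (fun x => (hZ₂ x).mono fun ω h => h.2) (hs₂.mono fun ω h hω => (h.2 hω).le),
      ae_le_of_le h1'] with ω h1 h2 h3
    by_cases hω : ω ∈ {ω | leftVersion (R Z) (toBar s) ω ≤ m' ω}
    · exact (h1 hω).trans hω
    · exact (h2 hω).trans h3), rfl⟩
  rw [hxβ, hxβ] at h2
  filter_upwards [ae_le_of_le h2, ae_add (Z₀.1 x + β * s₀) d, ae_add (Z₀.1 x) (β * s₀),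
    ae_mul β s₀, ae_add (Z₂.1 x) (β * s₂), ae_mul β s₂, hZ₂ x, hs₂, hm']
    with ω h3 h4 h5 h6 h7 h8 h9 h10 h11 hω hle
  have hωB : ω ∈ {ω | leftVersion (R Z) (toBar s) ω ≤ m' ω} := by
    rw [Set.mem_ofPred_eq, h11.1 hω]; exact hle
  rw [h4, h5, h6, h7, h8, h9.1 hωB, h10.1 hωB] at h3
  exact h3

/-- Separation of a pair from the cone `{R⁻ ≤ m}`. -/
theorem IsMinimalRiskFunction.exists_separating_pair (hX : IsConditionallyLocallyConvex P X)
    (hR : IsMinimalRiskFunction R) {A : Set Ω} (hA : MeasurableSet A) (hPA : P A ≠ 0) {m : Lbar P}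
    {Z₀ Z₁ : polarCone (P := P) K} {s₀ s₁ : L0 P}
    (h0 : ∀ᵐ ω ∂P, ω ∈ A → m ω < leftVersion (R Z₀) (toBar s₀) ω)
    (h1 : ∀ᵐ ω ∂P, ω ∈ A → leftVersion (R Z₁) (toBar s₁) ω ≤ m ω) :
    ∃ B ⊆ A, MeasurableSet B ∧ P B ≠ 0 ∧ ∃ (x : X) (β : L0 P),
      (∀ᵐ ω ∂P, ω ∈ B → β ω ≤ 0 ∧ Z₀.1 x ω + β ω * s₀ ω < 0) ∧
      ∀ Z s, ∀ᵐ ω ∂P, ω ∈ B → leftVersion (R Z) (toBar s) ω ≤ m ω →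
        0 ≤ Z.1 x ω + β ω * s ω := by
  obtain ⟨x, β, d, hd, hsep⟩ := hR.exists_affine_separating hX hA hPA h0 h1
  -- Letting `r → ∞` makes the functional nonnegative on the cone; letting `r → 0` puts `(Z₀, s₀)`
  -- at most at `-d`.
  have hscale : ∀ (r : ℝ) (_ : 0 < r) (Z : polarCone (P := P) K) (s : L0 P), ∀ᵐ ω ∂P, ω ∈ A →
      leftVersion (R Z) (toBar s) ω ≤ m ω →
        Z₀.1 x ω + β ω * s₀ ω + d ω ≤ r * (Z.1 x ω + β ω * s ω) := by
    intro r hr Z s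
    let l : L0 P := AEEqFun.const Ω r
    have hl : IsPos l := (ae_constReal r).mono fun ω h => by rw [h]; exact hr
    filter_upwards [hsep ⟨_, smul_mem_polarCone hl.le Z⟩ (l * s), ae_mul l s,
      ae_constReal (P := P) r, ae_mul l (Z.1 x),
      hR.leftVersion_smul_le hl (Z' := ⟨_, smul_mem_polarCone hl.le Z⟩) rfl s]
      with ω h2 h3 h4 h5 h6 hω hle
    have h7 := h2 hω (h6.trans hle)
    have h8 : (l • Z.1) x ω = r * Z.1 x ω := by
      rw [← h4]; exact h5
    rw [h8, h3, h4] at h7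
    linarith
  -- Lowering `s₁` stays in the sublevel set, so the lower bound survives as `n → ∞` only if `β ≤
  -- 0`.
  have hshift : ∀ n : ℕ, ∀ᵐ ω ∂P, ω ∈ A →
      Z₀.1 x ω + β ω * s₀ ω + d ω ≤ Z₁.1 x ω + β ω * (s₁ ω - n) := by
    intro n
    let c : L0 P := AEEqFun.const Ω (n : ℝ)
    filter_upwards [hsep Z₁ (s₁ - c), ae_sub s₁ c, ae_constReal (P := P) (n : ℝ), h1,
      hR.toIsRiskFunction.leftVersion_le_on MeasurableSet.univ (Z := Z₁) (Z' := Z₁) (s := s₁ - c)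
        (t := s₁) (fun _ => Eventually.of_forall fun _ _ => rfl) (by
          filter_upwards [ae_sub s₁ c, ae_constReal (P := P) (n : ℝ)] with ω h2 h3 _
          rw [h2, h3]
          have : (0 : ℝ) ≤ n := n.cast_nonneg
          linarith)] with ω h2 h3 h4 h5 h6 hω
    have h7 := h2 hω ((h6 (Set.mem_univ ω)).trans (h5 hω))
    rwa [h3, h4] at h7
  have harch : ∀ {a b : ℝ}, (∀ n : ℕ, a ≤ ((n : ℝ) + 1) * b) → 0 ≤ b := fun {a b} h => by
    by_contra hb
    rw [not_le] at hb
    obtain ⟨n, hn⟩ := exists_nat_gt (-a / -b)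
    rw [div_lt_iff₀ (by linarith)] at hn
    have := h n
    nlinarith
  refine ⟨A ∩ {ω | 0 < d ω}, Set.inter_subset_left,
    hA.inter (measurableSet_lt measurable_const (measurable_coe_L0 d)), hd, x, β, ?_, fun Z s => ?_⟩
  · filter_upwards [ae_all_iff.2 hshift, h1,
      ae_all_iff.2 fun n : ℕ => hscale (1 / ((n : ℝ) + 1)) (by positivity) Z₁ s₁] with ω h2 h3 h4 hω
    constructor
    · have : 0 ≤ -β ω := harch (a := Z₀.1 x ω + β ω * s₀ ω + d ω - Z₁.1 x ω - β ω * s₁ ω)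
        fun n => by
          have := h2 (n + 1) hω.1
          push_cast at this
          linarith
      linarith
    · have h5 : 0 ≤ -(Z₀.1 x ω + β ω * s₀ ω + d ω) := harch (a := -(Z₁.1 x ω + β ω * s₁ ω))
        fun n => by
          have h6 := h4 n hω.1 (h3 hω.1)
          have hn : (0 : ℝ) < (n : ℝ) + 1 := by positivity
          rw [one_div, inv_mul_eq_div, le_div_iff₀ hn] at h6
          linarith
      have : 0 < d ω := hω.2
      linarith
  · filter_upwards [ae_all_iff.2 fun n : ℕ => hscale ((n : ℝ) + 1) (by positivity) Z s]
      with ω h2 hω hle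
    exact harch fun n => h2 n hω.1 hle

end CondIndex

end

noncomputable section

namespace CondIndex

variable {Ω : Type*} [MeasurableSpace Ω] {P : Measure Ω} [IsFiniteMeasure P]
  {X : Type*} [AddCommGroup X] [Module (L0 P) X] [TopologicalSpace X]
  {K : Set X} {R : polarCone (P := P) K → Lbar P → Lbar P} {α : X → Lbar P}

/-! ### Uniqueness -/

theorem levelSup_le_of_robust (hR : IsRiskFunction R) (hα : ∀ x, α x = robust R x)
    (Z : polarCone (P := P) K) (s : Lbar P) : ∀ᵐ ω ∂P, levelSup α Z.1 s ω ≤ R Z s ω :=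
  levelSup_le fun x => by
    rw [hα x]
    filter_upwards [IsRiskFunction.robust_le R Z x, hR.localMono Z (toBar (Z.1 x)) s,
      ae_toBar (Z.1 x)] with ω h1 h2 h3 h4
    exact h1.trans (h2 (by rw [h3]; exact h4.le))

/-- If `⟨Z, x⟩ ≥ s` wherever `R⁻(Z, s) ≤ m`, then the robust functional at `x` is at least `m`. -/
theorem IsRiskFunction.le_robust_of_forall_le (hR : IsRiskFunction R) {B : Set Ω}
    (hB : MeasurableSet B) {m : Lbar P} {x : X}
    (h : ∀ (Z : polarCone (P := P) K) (s : L0 P), ∀ᵐ ω ∂P, ω ∈ B →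
      leftVersion (R Z) (toBar s) ω ≤ m ω → s ω ≤ Z.1 x ω) :
    ∀ᵐ ω ∂P, ω ∈ B → m ω ≤ robust R x ω := by
  refine le_robust_on hB fun Z => ?_
  have hloc := hR.localMono Z
  have hinf := hloc.le_rightVersion (toBar (Z.1 x))
  rw [← hR.rightContinuous Z] at hinf
  -- As `t k > ⟨Z, x⟩`, the hypothesis excludes `R⁻(Z, t k) ≤ m` on `B`; right-continuity of `R Z`
  -- lets `k → ∞`.
  let t : ℕ → L0 P := fun k => Z.1 x + AEEqFun.const Ω (1 / ((k : ℝ) + 1))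
  have ht : ∀ᵐ ω ∂P, ∀ k, t k ω = Z.1 x ω + 1 / ((k : ℝ) + 1) := ae_all_iff.2 fun k => by
    filter_upwards [ae_add (Z.1 x) (AEEqFun.const Ω (1 / ((k : ℝ) + 1))),
      ae_constReal (P := P) (1 / ((k : ℝ) + 1))] with ω h1 h2
    rw [h1, h2]
  filter_upwards [hinf, ht, ae_all_iff.2 fun k => ae_toBar (t k), ae_toBar (Z.1 x),
    ae_upBar (toBar (Z.1 x)), ae_all_iff.2 fun k => hloc (toBar (t k)) (upBar k (toBar (Z.1 x))),
    ae_all_iff.2 fun k => hloc.leftVersion_le_self (toBar (t k)),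
    ae_all_iff.2 fun k => h Z (t k)] with ω h1 h2 h3 h4 h5 h6 h7 h8 hω
  refine (le_iInf fun k => ?_).trans h1
  refine le_trans ?_ ((h7 k).trans (h6 k ?_))
  · by_contra hlt
    have h9 := h8 k hω (not_le.1 hlt).le
    rw [h2] at h9
    have : 0 < 1 / ((k : ℝ) + 1) := by positivity
    linarith
  · rw [h3, h2, h5, h4]
    exact coe_add_le_up k _

variable [IsTopologicalAddGroup X]

/-- On a nonnull part of a set on which `R⁻(Z₀, s₀) > m`, the robust functional is at least `m` at
a point of the half-space `{⟨Z₀, ·⟩ < s₀}`. -/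
theorem IsMinimalRiskFunction.exists_le_robust (hX : IsConditionallyLocallyConvex P X)
    (hR : IsMinimalRiskFunction R) {A : Set Ω} (hA : MeasurableSet A) (hPA : P A ≠ 0) {m : Lbar P}
    {Z₀ Z₁ : polarCone (P := P) K} {s₀ s₁ : L0 P}
    (h0 : ∀ᵐ ω ∂P, ω ∈ A → m ω < leftVersion (R Z₀) (toBar s₀) ω)
    (h1 : ∀ᵐ ω ∂P, ω ∈ A → leftVersion (R Z₁) (toBar s₁) ω ≤ m ω) :
    ∃ B ⊆ A, P B ≠ 0 ∧ ∃ x : X,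
      ∀ᵐ ω ∂P, ω ∈ B → Z₀.1 x ω < s₀ ω ∧ m ω ≤ robust R x ω := by
  let O : polarCone (P := P) K := ⟨0, fun x _ => le_refl (0 : L0 P)⟩
  -- Separating `(0, 1)` gives `β₁ < 0` outright, since the zero functional contributes nothing.
  obtain ⟨B₁, hB₁A, hB₁, hPB₁, x₁, β₁, hx₁, hsep₁⟩ := hR.exists_separating_pair hX hA hPA
    (Z₀ := O) (s₀ := 1) (by
      filter_upwards [h0, hR.leftVersion_le_zero_one (Z₀ := O) rfl Z₀ s₀] with ω h2 h3 hω
      exact (h2 hω).trans_le h3) h1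
  obtain ⟨B, hBB₁, hB, hPB, x₂, β₂, hx₂, hsep₂⟩ := hR.exists_separating_pair hX hB₁ hPB₁
    (h0.mono fun ω h hω => h (hB₁A hω)) (h1.mono fun ω h hω => h (hB₁A hω))
  -- Small enough that adding `e` times the first functional to the second keeps the value at `(Z₀,
  -- s₀)` negative; `l` then normalises the coefficient of `s` to `-1`.
  obtain ⟨e, he⟩ := exists_ae_eq_real P (f := fun ω => -(Z₀.1 x₂ ω + β₂ ω * s₀ ω) /
      (2 * (|Z₀.1 x₁ ω + β₁ ω * s₀ ω| + 1))) (by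
    have := measurable_coe_L0 (Z₀.1 x₂)
    have := measurable_coe_L0 (Z₀.1 x₁)
    have := measurable_coe_L0 β₁
    have := measurable_coe_L0 β₂
    have := measurable_coe_L0 s₀
    fun_prop)
  obtain ⟨l, hl⟩ := exists_ae_eq_real P (f := fun ω => (-(β₂ ω + e ω * β₁ ω))⁻¹) (by
    have := measurable_coe_L0 e
    have := measurable_coe_L0 β₁
    have := measurable_coe_L0 β₂
    fun_prop)
  have hβ₁ : ∀ᵐ ω ∂P, ω ∈ B → β₁ ω < 0 := by
    filter_upwards [hx₁, ae_one (P := P), ae_zero (P := P)] with ω h2 h3 h4 hω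
    have h5 := (h2 (hBB₁ hω)).2
    have h6 : O.1 x₁ ω = 0 := h4
    rw [h6, h3] at h5
    linarith
  have hpos : ∀ᵐ ω ∂P, ω ∈ B → 0 < e ω ∧ 0 < l ω ∧ l ω * (β₂ ω + e ω * β₁ ω) = -1 ∧
      Z₀.1 x₂ ω + β₂ ω * s₀ ω + e ω * (Z₀.1 x₁ ω + β₁ ω * s₀ ω) < 0 := by
    filter_upwards [he, hl, hβ₁, hx₂] with ω h2 h3 h4 h5 hω
    obtain ⟨h6, h7⟩ := h5 hω
    have h8 := h4 hω
    set w := Z₀.1 x₁ ω + β₁ ω * s₀ ω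
    have hw : 0 < |w| + 1 := by positivity
    have he0 : 0 < e ω := by rw [h2]; exact div_pos (by linarith) (by positivity)
    have hneg : 0 < -(β₂ ω + e ω * β₁ ω) := by nlinarith
    refine ⟨he0, by rw [h3]; exact inv_pos.2 hneg, ?_, ?_⟩
    · rw [h3]
      have := inv_mul_cancel₀ hneg.ne'
      linarith
    · have h9 : e ω * (2 * (|w| + 1)) = -(Z₀.1 x₂ ω + β₂ ω * s₀ ω) := by
        rw [h2]; exact div_mul_cancel₀ _ (by positivity)
      have h10 : e ω * w ≤ e ω * |w| := mul_le_mul_of_nonneg_left (le_abs_self w) he0.le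
      nlinarith
  have hval : ∀ Z : polarCone (P := P) K, ∀ᵐ ω ∂P,
      Z.1 (l • (x₂ + e • x₁)) ω = l ω * (Z.1 x₂ ω + e ω * Z.1 x₁ ω) := fun Z => by
    have e1 : Z.1 (l • (x₂ + e • x₁)) = l * (Z.1 x₂ + e * Z.1 x₁) := by
      rw [map_smul, map_add, map_smul, smul_eq_mul, smul_eq_mul]
    rw [e1]
    filter_upwards [ae_mul l (Z.1 x₂ + e * Z.1 x₁), ae_add (Z.1 x₂) (e * Z.1 x₁),
      ae_mul e (Z.1 x₁)] with ω h2 h3 h4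
    rw [h2, h3, h4]
  have hrob := hR.toIsRiskFunction.le_robust_of_forall_le hB (m := m) (x := l • (x₂ + e • x₁))
    fun Z s => by
      filter_upwards [hsep₁ Z s, hsep₂ Z s, hval Z, hpos] with ω h2 h3 h4 h5 hω hle
      obtain ⟨h6, h7, h8, -⟩ := h5 hω
      have h9 := mul_nonneg h7.le (add_nonneg (h3 hω hle) (mul_nonneg h6.le (h2 (hBB₁ hω) hle)))
      rw [h4]
      have h10 : l ω * (Z.1 x₂ ω + β₂ ω * s ω + e ω * (Z.1 x₁ ω + β₁ ω * s ω)) =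
          l ω * (Z.1 x₂ ω + e ω * Z.1 x₁ ω) + l ω * (β₂ ω + e ω * β₁ ω) * s ω := by ring
      rw [h10, h8] at h9
      linarith
  refine ⟨B, hBB₁.trans hB₁A, hPB, l • (x₂ + e • x₁), ?_⟩
  filter_upwards [hrob, hval Z₀, hpos] with ω h2 h3 h4 hω
  obtain ⟨h5, h6, h7, h8⟩ := h4 hω
  refine ⟨?_, h2 hω⟩
  have h9 := mul_neg_of_pos_of_neg h6 h8
  have h10 : l ω * (Z₀.1 x₂ ω + β₂ ω * s₀ ω + e ω * (Z₀.1 x₁ ω + β₁ ω * s₀ ω)) =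
      l ω * (Z₀.1 x₂ ω + e ω * Z₀.1 x₁ ω) + l ω * (β₂ ω + e ω * β₁ ω) * s₀ ω := by ring
  rw [h10, h7] at h9
  rw [h3]
  linarith

/-- The core of uniqueness: where `R⁻` exceeded `levelSup`, a point of `{⟨Z₀, ·⟩ < s₀}` with `α` at
least an intermediate rational would contradict the definition of `levelSup`. -/
theorem IsMinimalRiskFunction.leftVersion_le_levelSup (hX : IsConditionallyLocallyConvex P X)
    (hR : IsMinimalRiskFunction R) (hα : ∀ x, α x = robust R x) (Z₀ : polarCone (P := P) K)
    (s₀ : L0 P) (x₀ : X) : ∀ᵐ ω ∂P, (Z₀.1 x₀ ω ≠ 0 ∨ 0 < s₀ ω) →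
      leftVersion (R Z₀) (toBar s₀) ω ≤ levelSup α Z₀.1 (toBar s₀) ω := by
  have hmz : MeasurableSet {ω | Z₀.1 x₀ ω ≠ 0 ∨ 0 < s₀ ω} :=
    ((measurable_coe_L0 (Z₀.1 x₀)) (measurableSet_singleton 0).compl).union
      (measurableSet_lt measurable_const (measurable_coe_L0 s₀))
  refine ae_of_forall_measure_zero (hmz.imp
    (measurableSet_le (measurable_coe_Lbar _) (measurable_coe_Lbar _))) fun hne hmeas => ?_
  obtain ⟨q, hq⟩ := exists_rat_between hne (f := levelSup α Z₀.1 (toBar s₀))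
    (g := leftVersion (R Z₀) (toBar s₀)) fun ω hω => not_le.1 (Classical.not_imp.1 hω).2
  set A := {ω | ¬ ((Z₀.1 x₀ ω ≠ 0 ∨ 0 < s₀ ω) →
    leftVersion (R Z₀) (toBar s₀) ω ≤ levelSup α Z₀.1 (toBar s₀) ω)} ∩
    {ω | levelSup α Z₀.1 (toBar s₀) ω < ((q : ℝ) : EReal) ∧
      ((q : ℝ) : EReal) < leftVersion (R Z₀) (toBar s₀) ω} with hAdef
  have hA : MeasurableSet A := hmeas.inter
    ((measurableSet_lt (measurable_coe_Lbar _) measurable_const).inter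
      (measurableSet_lt measurable_const (measurable_coe_Lbar _)))
  let m : Lbar P := AEEqFun.const Ω ((q : ℝ) : EReal)
  have hm : ∀ᵐ ω ∂P, m ω = ((q : ℝ) : EReal) := ae_constBar _
  suffices h : ∃ B ⊆ A, P B ≠ 0 ∧ ∃ x : X,
      ∀ᵐ ω ∂P, ω ∈ B → Z₀.1 x ω < s₀ ω ∧ m ω ≤ robust R x ω by
    obtain ⟨B, hBA, hPB, x, hx⟩ := h
    have hG := le_levelSup α Z₀.1 (toBar s₀) x
    rw [hα x] at hG
    obtain ⟨ω, hω, h1, h2, h3, h4⟩ := exists_of_ae_of_measure_ne_zero hPB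
      (hx.and (hG.and (hm.and (ae_toBar s₀))))
    obtain ⟨h5, h6⟩ := h1 hω
    rw [h3] at h6
    exact absurd (h6.trans (h2 (by rw [h4]; exact_mod_cast h5))) (not_le.2 (hBA hω).2.1)
  by_cases hcase : ∃ (Z₁ : polarCone (P := P) K) (s₁ : L0 P),
      P (A ∩ {ω | leftVersion (R Z₁) (toBar s₁) ω ≤ m ω}) ≠ 0
  · obtain ⟨Z₁, s₁, hP₁⟩ := hcase
    obtain ⟨B, hBA, h⟩ := hR.exists_le_robust hX
      (hA.inter (measurableSet_le (measurable_coe_Lbar _) (measurable_coe_Lbar _))) hP₁ (m := m)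
      (Z₀ := Z₀) (s₀ := s₀) (by
        filter_upwards [hm] with ω h1 hω
        rw [h1]; exact hω.1.2.2) (Eventually.of_forall fun ω hω => hω.2)
    exact ⟨B, hBA.trans Set.inter_subset_left, h⟩
  · simp only [not_exists, not_not] at hcase
    -- No pair meets the sublevel set on a nonnull part of `A`, so every point has `α ≥ m` there. It
    -- remains to enter the half-space: by `0` if `s₀ > 0`, otherwise by the multiple of `x₀` with
    -- `⟨Z₀, l • x₀⟩ = -(|s₀| + 1)`.
    obtain ⟨l, hl⟩ := exists_ae_eq_real_cases (P := P)
      (measurableSet_lt measurable_const (measurable_coe_L0 s₀)) (measurable_const (a := (0 : ℝ)))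
      (g := fun ω => -(|s₀ ω| + 1) / Z₀.1 x₀ ω) (by
        have := measurable_coe_L0 (Z₀.1 x₀)
        have := measurable_coe_L0 s₀
        fun_prop)
    refine ⟨A, subset_rfl, hq, l • x₀, ?_⟩
    have hrob := hR.toIsRiskFunction.le_robust_of_forall_le hA (m := m) (x := l • x₀) fun Z s => by
      filter_upwards [measure_eq_zero_iff_ae_notMem.1 (hcase Z s)] with ω h1 hω h2
      exact absurd ⟨hω, h2⟩ h1
    have e1 : Z₀.1 (l • x₀) = l * Z₀.1 x₀ := by rw [map_smul, smul_eq_mul]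
    rw [e1]
    filter_upwards [hrob, hl, ae_mul l (Z₀.1 x₀)] with ω h1 h2 h3 hω
    refine ⟨?_, h1 hω⟩
    rw [h3]
    by_cases hs : 0 < s₀ ω
    · rw [h2.1 hs, zero_mul]; exact hs
    · have hz : Z₀.1 x₀ ω ≠ 0 := (Classical.not_imp.1 hω.1).1.resolve_right hs
      rw [h2.2 hs, div_mul_cancel₀ _ hz]
      linarith [neg_abs_le (s₀ ω)]

/-- Minimal risk functions that represent `α` agree with `minRisk α` where the functional does not
vanish or the second argument is nonnegative. -/
theorem IsMinimalRiskFunction.eq_minRisk_on (hX : IsConditionallyLocallyConvex P X)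
    (hR : IsMinimalRiskFunction R) (hα : ∀ x, α x = robust R x) (Z : polarCone (P := P) K)
    (s : Lbar P) (x : X) :
    ∀ᵐ ω ∂P, (Z.1 x ω ≠ 0 ∨ 0 ≤ s ω) → R Z s ω = minRisk α Z s ω := by
  have hloc := hR.toIsRiskFunction.localMono Z
  have hG := levelSup_localMono α Z.1
  have hinf := hloc.le_rightVersion s
  have htop := LocalMono.rightVersion_eq_top (R Z) s
  rw [← hR.rightContinuous Z] at hinf htop
  -- The comparison of left versions is available only at real arguments; `up k s` is real when `s <
  -- ⊤`, and `t k > s` turns `0 ≤ s` into the strict `0 < t k`.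
  choose t ht using fun k =>
    exists_ae_eq_real P (measurable_coe_Lbar (upBar k s)).ereal_toReal
  filter_upwards [hinf, htop, hG.le_rightVersion s,
    LocalMono.rightVersion_eq_top (levelSup α Z.1) s, ae_upBar s, ae_all_iff.2 ht,
    ae_all_iff.2 fun k => ae_toBar (t k),
    ae_all_iff.2 fun k => hG.rightVersion_le s (upBar k s),
    ae_all_iff.2 fun k => levelSup_le_of_robust hR.toIsRiskFunction hα Z (upBar k s),
    ae_all_iff.2 fun k => hloc.le_leftVersion (toBar (t k)) s,
    ae_all_iff.2 fun k => hR.leftVersion_le_levelSup hX hα Z (t k) x,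
    ae_all_iff.2 fun k => hG.eq_on (toBar (t k)) (upBar k s)]
    with ω h1 h2 h3 h4 h5 h6 h7 h8 h9 h10 h11 h12 hω
  rcases eq_or_ne (s ω) ⊤ with h | h
  · rw [h2 h]; exact (h4 h).symm
  have hlt : ∀ k, s ω < up k (s ω) := fun k => lt_up k h.lt_top
  refine le_antisymm ((le_iInf fun k => ?_).trans h3) ((le_iInf fun k => ?_).trans h1)
  · have hk : toBar (t k) ω = up k (s ω) := by
      rw [h7, h6, h5]
      exact EReal.coe_toReal (up_lt_top k h.lt_top).ne (bot_lt_up k _).ne'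
    refine (h10 k (by rw [hk]; exact hlt k)).trans ((h11 k (hω.imp id fun h0 => ?_)).trans_eq
      (h12 k (by rw [hk, h5])))
    rw [h7] at hk
    have := h0.trans_lt (hlt k)
    rw [← hk] at this
    exact_mod_cast this
  · exact (h8 k (by rw [h5]; exact hlt k)).trans (h9 k)

theorem IsMinimalRiskFunction.eq_minRisk (hX : IsConditionallyLocallyConvex P X)
    (hR : IsMinimalRiskFunction R) (hnorm : IsNormalizedAtZero R) (hα : ∀ x, α x = robust R x) :
    R = minRisk α := by
  funext Z s
  apply AEEqFun.ext
  have hmeas : MeasurableSet {ω | R Z s ω = minRisk α Z s ω} :=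
    measurableSet_eq_fun (measurable_coe_Lbar _) (measurable_coe_Lbar _)
  refine ae_of_forall_measure_zero hmeas fun hne hB => ?_
  let O : polarCone (P := P) K := ⟨0, fun x _ => le_refl (0 : L0 P)⟩
  -- Where the two functions differ, `Z` acts as the zero functional and `s < 0`; locality then
  -- transports both normalizations from `O` to `Z`.
  have hZ : ∀ x, ∀ᵐ ω ∂P, ω ∈ {ω | ¬ R Z s ω = minRisk α Z s ω} → Z.1 x ω = O.1 x ω := fun x => by
    filter_upwards [hR.eq_minRisk_on hX hα Z s x, ae_zero (P := P)] with ω h1 h2 hω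
    refine Eq.trans ?_ h2.symm
    by_contra hz
    exact hω (h1 (Or.inl hz))
  obtain ⟨ω, hω, h1, h2, h3, h4, h5⟩ := exists_of_ae_of_measure_ne_zero hne
    ((hR.eq_minRisk_on hX hα Z s 0).and ((hR.toIsRiskFunction.eq_on hB hZ s).and
      (((minRisk_isRiskFunction α).eq_on hB hZ s).and ((hnorm O rfl s).and
        (minRisk_isNormalizedAtZero α O rfl s)))))
  have hs : s ω < 0 := by
    by_contra hs
    exact hω (h1 (Or.inr (not_lt.1 hs)))
  exact hω (by rw [h2 hω, h3 hω, h4 hs, h5 hs])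

end CondIndex

end

open CondIndex
theorem mainTheorem1 {Ω : Type*} [MeasurableSpace Ω] (P : Measure Ω) [IsProbabilityMeasure P]
    {X : Type*} [AddCommGroup X] [Module (L0 P) X] [TopologicalSpace X]
    [IsTopologicalAddGroup X] [ContinuousSMul (L0 P) X]
    (hX : IsConditionallyLocallyConvex P X)
    (K : Set X) (hK : IsConvexCone P K) (hKclosed : IsClosed K) :
    (∀ α : X → Lbar P, IsAssessmentIndex K α → IsUSC α →
      (∃! R : polarCone (P := P) K → Lbar P → Lbar P,
        IsMinimalRiskFunction R ∧ IsNormalizedAtZero R ∧ ∀ x, α x = robust R x) ∧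
      (∀ R R' : polarCone (P := P) K → Lbar P → Lbar P,
        IsMinimalRiskFunction R → IsMinimalRiskFunction R' →
        (∀ x, α x = robust R x) → (∀ x, α x = robust R' x) →
        ∀ (Z : polarCone (P := P) K) (s : Lbar P) (x : X),
          ∀ᵐ ω ∂P, (Z.1 x ω ≠ 0 ∨ 0 ≤ s ω) → R Z s ω = R' Z s ω)) ∧
    (∀ R : polarCone (P := P) K → Lbar P → Lbar P, IsRiskFunction R →
      IsAssessmentIndex K (robust R) ∧ IsUSC (robust R)) := by
  refine ⟨fun α hα husc => ⟨⟨minRisk α, ⟨minRisk_isMinimal α, minRisk_isNormalizedAtZero α,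
    robust_minRisk hX hK hα husc⟩, fun R hR => hR.1.eq_minRisk hX hR.2.1 hR.2.2⟩,
    fun R R' hR hR' h h' Z s x => ?_⟩,
    fun R hR => ⟨hR.robust_isAssessmentIndex, hR.robust_isUSC⟩⟩
  filter_upwards [hR.eq_minRisk_on hX h Z s x, hR'.eq_minRisk_on hX h' Z s x] with ω h1 h2 hω
  rw [h1 hω, h2 hω]
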